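/- Let $n\ge 1$ be an integer, let $A:\mathbb{R}^n\to\mathbb{R}$ be a Lipschitz function, and set $\Sigma:=\{(x,A(x)):x\in\mathbb{R}^n\}\subset\mathbb{R}^{n+1}$. Let $\sigma:=\mathscr{H}^n\lfloor\Sigma$ be the restriction to $\Sigma$ of the $n$-dimensional Hausdorff measure of $\mathbb{R}^{n+1}$. Let $K:\mathbb{R}^{n+1}\setminus\{0\}\to\mathbb{R}$ be of class $C^2$, odd, and satisfy $K(\lambda x)=\lambda^{-n}K(x)$ for all $\lambda>0$ and $x\neq 0$. For $f\in L^2(\Sigma,\sigma)$ (complex-valued) define $$\mathcal{T}f(x):=\int_\Sigma K(x-y)f(y)\,d\sigma(y),\qquad x\in\mathbb{R}^{n+1}\setminus\Sigma .$$ Then this integral converges absolutely for every $x\in\mathbb{R}^{n+1}\setminus\Sigma$, the function $\mathcal{T}f$ is differentiable at every point of $\mathbb{R}^{n+1}\setminus\Sigma$, and there exists a finite constant $C>0$, depending only on $n$, on (upper bounds for) the norms $\|\partial^\alpha K\|_{L^\infty(S^n)}$, $|\alpha|\le 2$, and on (an upper bound for) the Lipschitz constant of $A$, such that for every $f\in L^2(\Sigma,\sigma)$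 $$\int_{\mathbb{R}^{n+1}\setminus\Sigma}|(\nabla\mathcal{T}f)(x)|^2\,\mathrm{dist}(x,\Sigma)\,dx\le C\int_\Sigma|f|^2\,d\sigma .$$ -/

import Mathlib

open MeasureTheory
open scoped NNReal ENNReal

noncomputable section

/-- A kernel on `ℝ^{n+1} ∖ {0}` of class `C²`, odd, and positively homogeneous of degree `-n`.
The value at the origin is arbitrary: every condition concerns nonzero points only. -/
structure IsHomogeneousOddKernel (n : ℕ) (K : EuclideanSpace ℝ (Fin (n + 1)) → ℝ) : Prop where
  contDiffOn : ContDiffOn ℝ 2 K {0}ᶜ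
  homogeneous : ∀ r : ℝ, 0 < r → ∀ x, x ≠ 0 → K (r • x) = (r ^ n)⁻¹ * K x
  odd : ∀ x, x ≠ 0 → K (-x) = -K x

/-- The partial derivative `∂_{i₁} ⋯ ∂_{iₖ} K` at the point `x`. As `i` runs over all `k`-tuples of
coordinate indices this gives (for `K` of class `C^k` near `x`) precisely the derivatives `∂^α K (x)`
with `|α| = k`. -/
def mixedPartial {d k : ℕ} (i : Fin k → Fin d) (K : EuclideanSpace ℝ (Fin d) → ℝ)
    (x : EuclideanSpace ℝ (Fin d)) : ℝ :=
  iteratedFDeriv ℝ k K x (fun l => EuclideanSpace.single (i l) 1)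

/-- The graph `{(x, A x) : x ∈ ℝⁿ}` as a subset of `ℝ^{n+1}`. -/
def graphSet {n : ℕ} (A : EuclideanSpace ℝ (Fin n) → ℝ) : Set (EuclideanSpace ℝ (Fin (n + 1))) :=
  Set.range fun x : EuclideanSpace ℝ (Fin n) =>
    WithLp.toLp 2 (Fin.snoc (α := fun _ => ℝ) (fun i => x i) (A x))

/-- Surface measure: the restriction of the `n`-dimensional Hausdorff measure of `ℝ^{n+1}`
(with the Euclidean distance) to the set `S`. -/
def surfaceMeasure {n : ℕ} (S : Set (EuclideanSpace ℝ (Fin (n + 1)))) :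
    Measure (EuclideanSpace ℝ (Fin (n + 1))) :=
  (μH[(n : ℝ)] : Measure (EuclideanSpace ℝ (Fin (n + 1)))).restrict S

/-- The integral operator `𝒯 f (x) = ∫_S K(x - y) f(y) dσ(y)`. -/
def layerOperator {n : ℕ} (K : EuclideanSpace ℝ (Fin (n + 1)) → ℝ)
    (S : Set (EuclideanSpace ℝ (Fin (n + 1)))) (f : EuclideanSpace ℝ (Fin (n + 1)) → ℂ)
    (x : EuclideanSpace ℝ (Fin (n + 1))) : ℂ :=
  ∫ y, K (x - y) • f y ∂(surfaceMeasure S)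

/-- The squared length `|∇u(x)|² = ∑ⱼ |∂ⱼu(x)|²` of the gradient of a complex-valued function of
real variables. -/
def gradSq {d : ℕ} (u : EuclideanSpace ℝ (Fin d) → ℂ) (x : EuclideanSpace ℝ (Fin d)) : ℝ :=
  ∑ j : Fin d, ‖fderiv ℝ u x (EuclideanSpace.single j 1)‖ ^ 2

end

/-! The shear `(x, t) ↦ (x, A x + t)` preserves volume, sends `t ≠ 0` onto the complement of the
graph, and the distance to the graph is at most `|t|`. In base coordinates surface measure is at
most a constant times Lebesgue measure, so the density becomes some `g` in `L²(ℝⁿ)`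
(`exists_base_density`). A partial derivative of `K` becomes a kernel `κ(u, s)` of order `-(n + 1)`.
For `t > 0` the claim is that the operators `θ_t` with kernels `t κ(x - y, A x - A y + t)` (`theta`)
satisfy `∫∫ |θ_t g|² dx dt / t ≤ C ‖g‖²`; the side `t < 0` follows by reflection.

Cancellation: `κ` has integral zero over every hyperplane graph that avoids the origin
(`IsFlatKernel.flat`). In tangential directions a derivative is integrated. In the vertical
direction, oddness makes the symmetrized integral of `K` over a hyperplane converge and homogeneity
of degree `-n` makes it independent of the height, so its derivative in the height vanishes
(`integral_fderiv_vertical`).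

The operator is split as in a `T1` argument: `θ_t g = (θ_t - θ_t 1 · P_t) g + θ_t 1 · P_t g`, with
`P_t` convolution with a bump. The first kernel has mean value zero and Hölder regularity of order
`1/2`, so the adjoints at scales `r ≤ R` are almost orthogonal with gain `√(r / R)`; this sums over
the scales `ρ 4ᵏ` (`exists_sum_integral_kernelOp_sq_le`). For the second, flatness bounds `|θ_t
1(x)|` by a weighted deviation of `A` from an arbitrary affine function
(`abs_thetaOne_le_flatness`). What remains is a weighted geometric lemma,
`exists_sum_scaleFlatness_sq_le`.

For that lemma let `A` have a continuous gradient `a`, and average along a random walk with uniform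
steps in balls of radii `ρ 4ᵏ`. The one-step inequality `mul_sq_avg_le` bounds the oscillation of
the averaged gradient, weighted by the squared average of `g`, by differences of energies at
successive times. These telescope, which takes the place of a Carleson embedding. The oscillation of
the gradient controls the Taylor remainder of the averaged `A`; the distance from `A` to its
averages is summed by a recursion from fine to coarse scales, the tails of the deviation by one from
coarse to fine scales.

The discrete bounds are uniform in `ρ`, so integration over one period of scales gives the bound for
`dt / t` (`lintegral_Ioi_div_le`). Smoothness of `A` and special densities are removed by
mollification, density of nice functions and Fatou's lemma. -/

noncomputable section

set_option linter.unusedSectionVars false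

/-! ### Poisson-type weights and convolution inequalities -/

section Weight

variable {E : Type*} [NormedAddCommGroup E] [InnerProductSpace ℝ E]

/-- The Poisson-type weight `r / (r + ‖u‖) ^ (d + 1)`, where `d` is the dimension of the space. -/
def poissonWeight (r : ℝ) (u : E) : ℝ := r / (r + ‖u‖) ^ (Module.finrank ℝ E + 1)

theorem poissonWeight_pos {r : ℝ} (hr : 0 < r) (u : E) : 0 < poissonWeight r u := by
  unfold poissonWeight; positivity

theorem poissonWeight_nonneg {r : ℝ} (hr : 0 < r) (u : E) : 0 ≤ poissonWeight r u :=
  (poissonWeight_pos hr u).le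

theorem poissonWeight_neg (r : ℝ) (u : E) : poissonWeight r (-u) = poissonWeight r u := by
  simp [poissonWeight]

theorem poissonWeight_sub_comm (r : ℝ) (u v : E) :
    poissonWeight r (u - v) = poissonWeight r (v - u) := by
  rw [← neg_sub, poissonWeight_neg]

theorem continuous_poissonWeight {r : ℝ} (hr : 0 < r) :
    Continuous (poissonWeight r : E → ℝ) := by
  unfold poissonWeight
  refine Continuous.div (by fun_prop) (by fun_prop) fun u => ?_
  positivity

theorem poissonWeight_mul_sqrt_eq {r : ℝ} (hr : 0 < r) (u : E) :
    poissonWeight r u * √(1 + ‖u‖ / r) = (r ^ Module.finrank ℝ E)⁻¹ *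
      (1 + ‖r⁻¹ • u‖) ^ (-((Module.finrank ℝ E : ℝ) + 1 / 2)) := by
  have h1 : ‖r⁻¹ • u‖ = ‖u‖ / r := by
    rw [norm_smul, norm_inv, Real.norm_of_nonneg hr.le, inv_mul_eq_div]
  rw [h1]
  set q := 1 + ‖u‖ / r with hq
  have hq0 : 0 < q := by positivity
  have h2 : r + ‖u‖ = r * q := by rw [hq]; field_simp
  have h3 : q ^ (-((Module.finrank ℝ E : ℝ) + 1 / 2)) = (q ^ (Module.finrank ℝ E + 1))⁻¹ * √q := by
    rw [Real.sqrt_eq_rpow, ← Real.rpow_natCast, ← Real.rpow_neg hq0.le, ← Real.rpow_add hq0]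
    congr 1
    push_cast
    ring
  rw [h3, poissonWeight, h2, mul_pow, pow_succ r]
  have := hr.ne'
  have := hq0.ne'
  field_simp

/-- The factor `√(r / R)` obtained here is the decay in the almost orthogonality of two scales. -/
theorem poissonWeight_mul_sqrt_div_le {r R : ℝ} (hr : 0 < r) (hR : 0 < R) (u : E) :
    poissonWeight r u * √(‖u‖ / R) ≤ √(r / R) * (poissonWeight r u * √(1 + ‖u‖ / r)) := by
  have h : √(‖u‖ / R) = √(r / R) * √(‖u‖ / r) := by
    rw [← Real.sqrt_mul (by positivity)]
    congr 1
    field_simp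
  rw [h]
  have h2 : √(‖u‖ / r) ≤ √(1 + ‖u‖ / r) := Real.sqrt_le_sqrt (by linarith)
  have := mul_le_mul_of_nonneg_left h2 (mul_nonneg (Real.sqrt_nonneg (r / R))
    (poissonWeight_nonneg hr u))
  linarith

variable [FiniteDimensional ℝ E] [MeasurableSpace E] [BorelSpace E]

theorem integrable_scaled {φ : E → ℝ} (hφ : Integrable φ) {r : ℝ} (hr : 0 < r) :
    Integrable (fun u => (r ^ Module.finrank ℝ E)⁻¹ * φ (r⁻¹ • u)) ∧
      ∫ u, (r ^ Module.finrank ℝ E)⁻¹ * φ (r⁻¹ • u) = ∫ u, φ u := by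
  refine ⟨(hφ.comp_smul (inv_ne_zero hr.ne')).const_mul _, ?_⟩
  rw [integral_const_mul, Measure.integral_comp_inv_smul_of_nonneg _ _ hr.le, smul_eq_mul,
    inv_mul_cancel_left₀ (by positivity)]

variable (E) in
-- Scaling reduces to `r = 1`, where the product decays with the power `-(d + 1/2)`, which is still
-- integrable. This spare half power pays later for Hölder regularity of order `1/2`; a full power
-- would diverge logarithmically.
theorem exists_poissonWeight_sqrt_bound :
    ∃ c : ℝ, 0 < c ∧ ∀ r : ℝ, 0 < r →
      Integrable (fun u : E => poissonWeight r u * √(1 + ‖u‖ / r)) ∧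
      ∫ u : E, poissonWeight r u * √(1 + ‖u‖ / r) ≤ c := by
  have hφ : Integrable (fun u : E => (1 + ‖u‖) ^ (-((Module.finrank ℝ E : ℝ) + 1 / 2))) :=
    integrable_one_add_norm (by linarith)
  refine ⟨(∫ u : E, (1 + ‖u‖) ^ (-((Module.finrank ℝ E : ℝ) + 1 / 2))) + 1, ?_, ?_⟩
  · have : 0 ≤ ∫ u : E, (1 + ‖u‖) ^ (-((Module.finrank ℝ E : ℝ) + 1 / 2)) :=
      integral_nonneg fun u => by positivity
    linarith
  intro r hr
  obtain ⟨hi, he⟩ := integrable_scaled hφ hr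
  simp_rw [poissonWeight_mul_sqrt_eq hr]
  exact ⟨hi, by rw [he]; linarith⟩

variable (E) in
/-- A constant bounding the integrals of all Poisson weights, even against `√(1 + ‖u‖ / r)`. -/
def weightConst : ℝ := (exists_poissonWeight_sqrt_bound E).choose

variable (E) in
theorem weightConst_pos : 0 < weightConst E := (exists_poissonWeight_sqrt_bound E).choose_spec.1

theorem integrable_poissonWeight_mul_sqrt {r : ℝ} (hr : 0 < r) :
    Integrable (fun u : E => poissonWeight r u * √(1 + ‖u‖ / r)) :=
  ((exists_poissonWeight_sqrt_bound E).choose_spec.2 r hr).1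

theorem integral_poissonWeight_mul_sqrt_le {r : ℝ} (hr : 0 < r) :
    ∫ u : E, poissonWeight r u * √(1 + ‖u‖ / r) ≤ weightConst E :=
  ((exists_poissonWeight_sqrt_bound E).choose_spec.2 r hr).2

theorem integrable_poissonWeight {r : ℝ} (hr : 0 < r) :
    Integrable (poissonWeight r : E → ℝ) := by
  refine (integrable_poissonWeight_mul_sqrt hr).mono'
    (continuous_poissonWeight hr).aestronglyMeasurable (Filter.Eventually.of_forall fun u => ?_)
  rw [Real.norm_of_nonneg (poissonWeight_nonneg hr u)]
  refine le_mul_of_one_le_right (poissonWeight_nonneg hr u) ?_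
  rw [Real.one_le_sqrt]
  have : 0 ≤ ‖u‖ / r := by positivity
  linarith

theorem integral_poissonWeight_le {r : ℝ} (hr : 0 < r) :
    ∫ u : E, poissonWeight r u ≤ weightConst E := by
  refine le_trans (integral_mono (integrable_poissonWeight hr)
    (integrable_poissonWeight_mul_sqrt hr) fun u => ?_) (integral_poissonWeight_mul_sqrt_le hr)
  refine le_mul_of_one_le_right (poissonWeight_nonneg hr u) ?_
  rw [Real.one_le_sqrt]
  have : 0 ≤ ‖u‖ / r := by positivity
  linarith

theorem integrable_poissonWeight_mul_sqrt_div {r R : ℝ} (hr : 0 < r) (hR : 0 < R) :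
    Integrable (fun u : E => poissonWeight r u * √(‖u‖ / R)) := by
  refine ((integrable_poissonWeight_mul_sqrt hr).const_mul (√(r / R))).mono'
    ((continuous_poissonWeight hr).mul (by fun_prop)).aestronglyMeasurable
    (Filter.Eventually.of_forall fun u => ?_)
  rw [Real.norm_of_nonneg (mul_nonneg (poissonWeight_nonneg hr u) (Real.sqrt_nonneg _))]
  exact poissonWeight_mul_sqrt_div_le hr hR u

theorem integral_poissonWeight_mul_sqrt_div_le {r R : ℝ} (hr : 0 < r) (hR : 0 < R) :
    ∫ u : E, poissonWeight r u * √(‖u‖ / R) ≤ √(r / R) * weightConst E := by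
  refine le_trans (integral_mono (integrable_poissonWeight_mul_sqrt_div hr hR)
    ((integrable_poissonWeight_mul_sqrt hr).const_mul (√(r / R)))
    (poissonWeight_mul_sqrt_div_le hr hR)) ?_
  rw [integral_const_mul]
  exact mul_le_mul_of_nonneg_left (integral_poissonWeight_mul_sqrt_le hr) (Real.sqrt_nonneg _)

/-- The weight is at most `r ^ (-d)`, so its square is dominated by a multiple of the weight itself.
-/
theorem memLp_two_poissonWeight {r : ℝ} (hr : 0 < r) : MemLp (poissonWeight r : E → ℝ) 2 := by
  refine (memLp_two_iff_integrable_sq (continuous_poissonWeight hr).aestronglyMeasurable).2 ?_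
  refine ((integrable_poissonWeight hr).const_mul ((r ^ Module.finrank ℝ E)⁻¹)).mono'
    ((continuous_poissonWeight hr).pow 2).aestronglyMeasurable
    (Filter.Eventually.of_forall fun u => ?_)
  rw [Real.norm_of_nonneg (sq_nonneg _), sq]
  refine mul_le_mul_of_nonneg_right ?_ (poissonWeight_nonneg hr u)
  rw [poissonWeight, div_le_iff₀ (by positivity)]
  have h1 : r ^ (Module.finrank ℝ E + 1) ≤ (r + ‖u‖) ^ (Module.finrank ℝ E + 1) := by
    gcongr; linarith [norm_nonneg u]
  calc r = (r ^ Module.finrank ℝ E)⁻¹ * r ^ (Module.finrank ℝ E + 1) := by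
        rw [pow_succ]; field_simp
    _ ≤ _ := by gcongr

/-! ### Young-type bounds for convolution forms -/

theorem integrable_conv_fst {v a : E → ℝ} (hv : Integrable v) (ha : Integrable a) :
    Integrable (fun p : E × E => v (p.1 - p.2) * a p.1) (volume.prod volume) := by
  have h := (ha.mul_prod hv)
  have mp : MeasurePreserving (fun p : E × E => (p.1, p.1 - p.2)) (volume.prod volume)
      (volume.prod volume) := by
    have h1 := measurePreserving_prod_neg_add (volume : Measure E) (volume : Measure E)
    have h2 : MeasurePreserving (Prod.map id Neg.neg : E × E → E × E) (volume.prod volume)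
      (volume.prod volume) := (MeasurePreserving.id _).prod (Measure.measurePreserving_neg _)
    convert h2.comp h1 using 2 with p
    simp [sub_eq_add_neg, add_comm]
  have h3 := mp.integrable_comp_of_integrable h
  refine h3.congr (Filter.Eventually.of_forall fun p => ?_)
  simp [mul_comm]

theorem integrable_conv_snd {v a : E → ℝ} (hv : Integrable v) (ha : Integrable a) :
    Integrable (fun p : E × E => v (p.1 - p.2) * a p.2) (volume.prod volume) := by
  refine (ha.convolution_integrand (ContinuousLinearMap.mul ℝ ℝ) hv).congr
    (Filter.Eventually.of_forall fun p => ?_)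
  simp [mul_comm]

theorem integral_conv_fst {v a : E → ℝ} (hv : Integrable v) (ha : Integrable a) :
    ∫ p : E × E, v (p.1 - p.2) * a p.1 ∂(volume.prod volume) = (∫ u, v u) * ∫ x, a x := by
  rw [integral_prod _ (integrable_conv_fst hv ha)]
  simp only
  simp_rw [integral_mul_const, integral_sub_left_eq_self v volume, integral_const_mul]

theorem integral_conv_snd {v a : E → ℝ} (hv : Integrable v) (ha : Integrable a) :
    ∫ p : E × E, v (p.1 - p.2) * a p.2 ∂(volume.prod volume) = (∫ u, v u) * ∫ x, a x := by
  rw [integral_prod_symm _ (integrable_conv_snd hv ha)]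
  simp only
  simp_rw [integral_mul_const, integral_sub_right_eq_self v, integral_const_mul]

theorem integrable_conv_mul {v a b : E → ℝ} (hv : Integrable v) (hv0 : ∀ u, 0 ≤ v u)
    (ha : MemLp a 2) (hb : MemLp b 2) :
    Integrable (fun p : E × E => v (p.1 - p.2) * (|a p.1| * |b p.2|)) (volume.prod volume) := by
  refine ((integrable_conv_fst hv ha.integrable_sq).add
    (integrable_conv_snd hv hb.integrable_sq)).mono' ?_ (Filter.Eventually.of_forall fun p => ?_)
  · have h1 : AEStronglyMeasurable (fun p : E × E => v (p.1 - p.2)) (volume.prod volume) :=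
      hv.aestronglyMeasurable.comp_quasiMeasurePreserving
        (quasiMeasurePreserving_sub_of_right_invariant volume volume)
    exact h1.mul ((ha.aestronglyMeasurable.norm.comp_fst).mul
      (hb.aestronglyMeasurable.norm.comp_snd))
  · have := hv0 (p.1 - p.2)
    rw [Real.norm_of_nonneg (by positivity)]
    simp only [Pi.add_apply]
    rw [← mul_add]
    refine mul_le_mul_of_nonneg_left ?_ this
    nlinarith [sq_nonneg (|a p.1| - |b p.2|), sq_abs (a p.1), sq_abs (b p.2), sq_nonneg (a p.1),
      sq_nonneg (b p.2)]

theorem integral_conv_mul_le {v a b : E → ℝ} (hv : Integrable v) (hv0 : ∀ u, 0 ≤ v u)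
    (ha : MemLp a 2) (hb : MemLp b 2) :
    ∫ p : E × E, v (p.1 - p.2) * (|a p.1| * |b p.2|) ∂(volume.prod volume) ≤
      (∫ u, v u) * ((∫ x, a x ^ 2) + ∫ x, b x ^ 2) := by
  rw [mul_add, ← integral_conv_fst hv ha.integrable_sq, ← integral_conv_snd hv hb.integrable_sq,
    ← integral_add (integrable_conv_fst hv ha.integrable_sq)
      (integrable_conv_snd hv hb.integrable_sq)]
  refine integral_mono (integrable_conv_mul hv hv0 ha hb) ((integrable_conv_fst hv
    ha.integrable_sq).add (integrable_conv_snd hv hb.integrable_sq)) fun p => ?_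
  have := hv0 (p.1 - p.2)
  simp only
  rw [← mul_add]
  refine mul_le_mul_of_nonneg_left ?_ this
  nlinarith [sq_nonneg (|a p.1| - |b p.2|), sq_abs (a p.1), sq_abs (b p.2), sq_nonneg (a p.1),
    sq_nonneg (b p.2)]

/-- Young's inequality `‖v * a‖₂ ≤ ‖v‖₁ ‖a‖₂`. -/
theorem young_memLp {v a : E → ℝ} (hv : Integrable v) (hv0 : ∀ u, 0 ≤ v u) (ha : MemLp a 2) :
    MemLp (fun x => ∫ y, v (x - y) * |a y|) 2 ∧
      ∫ x, (∫ y, v (x - y) * |a y|) ^ 2 ≤ (∫ u, v u) ^ 2 * ∫ x, a x ^ 2 := by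
  have hmeas : AEStronglyMeasurable (fun p : E × E => v (p.1 - p.2)) (volume.prod volume) :=
    hv.aestronglyMeasurable.comp_quasiMeasurePreserving
      (quasiMeasurePreserving_sub_of_right_invariant volume volume)
  have hm : AEStronglyMeasurable (fun x => ∫ y, v (x - y) * |a y|) volume :=
    (hmeas.mul ha.aestronglyMeasurable.norm.comp_snd).integral_prod_right'
  have hI := integrable_conv_snd hv ha.integrable_sq
  -- Cauchy–Schwarz for the product `√v · (√v |a|)`, at almost every `x`.
  have hpt : ∀ᵐ x, (∫ y, v (x - y) * |a y|) ^ 2 ≤ (∫ u, v u) * ∫ y, v (x - y) * a y ^ 2 := by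
    filter_upwards [hI.prod_right_ae] with x hx
    have hvx : Integrable (fun y => v (x - y)) := hv.comp_sub_left x
    have hm1 : AEStronglyMeasurable (fun y => v (x - y)) volume := hvx.aestronglyMeasurable
    have h1 : MemLp (fun y => √(v (x - y))) 2 := by
      rw [memLp_two_iff_integrable_sq (Real.continuous_sqrt.comp_aestronglyMeasurable hm1)]
      exact hvx.congr (Filter.Eventually.of_forall fun y => (Real.sq_sqrt (hv0 _)).symm)
    have h2 : MemLp (fun y => √(v (x - y)) * |a y|) 2 := by
      refine (memLp_two_iff_integrable_sq
        ((Real.continuous_sqrt.comp_aestronglyMeasurable hm1).mul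
          ha.aestronglyMeasurable.norm)).2 ?_
      refine hx.congr (Filter.Eventually.of_forall fun y => ?_)
      simp only [Pi.mul_apply, Real.norm_eq_abs, mul_pow, sq_abs, Real.sq_sqrt (hv0 _)]
    have hcs := integral_mul_le_Lp_mul_Lq_of_nonneg (μ := volume) Real.HolderConjugate.two_two
      (f := fun y => √(v (x - y))) (g := fun y => √(v (x - y)) * |a y|)
      (Filter.Eventually.of_forall fun y => Real.sqrt_nonneg _)
      (Filter.Eventually.of_forall fun y => by positivity) (by simpa using h1) (by simpa using h2)
    have e1 : ∀ y, √(v (x - y)) * (√(v (x - y)) * |a y|) = v (x - y) * |a y| := fun y => by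
      rw [← mul_assoc, Real.mul_self_sqrt (hv0 _)]
    have e2 : ∀ y, √(v (x - y)) ^ (2 : ℝ) = v (x - y) := fun y => by
      rw [Real.rpow_two, Real.sq_sqrt (hv0 _)]
    have e3 : ∀ y, (√(v (x - y)) * |a y|) ^ (2 : ℝ) = v (x - y) * a y ^ 2 := fun y => by
      rw [Real.rpow_two, mul_pow, Real.sq_sqrt (hv0 _), sq_abs]
    simp_rw [e1, e2, e3, ← Real.sqrt_eq_rpow, integral_sub_left_eq_self v volume] at hcs
    have h0 : 0 ≤ ∫ y, v (x - y) * |a y| := integral_nonneg fun y => by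
      have := hv0 (x - y); positivity
    have hA : 0 ≤ ∫ u, v u := integral_nonneg hv0
    have hB : 0 ≤ ∫ y, v (x - y) * a y ^ 2 := integral_nonneg fun y => by
      have := hv0 (x - y); positivity
    calc _ ≤ (√(∫ u, v u) * √(∫ y, v (x - y) * a y ^ 2)) ^ 2 := by gcongr
      _ = _ := by rw [mul_pow, Real.sq_sqrt hA, Real.sq_sqrt hB]
  have hint : Integrable (fun x => (∫ u, v u) * ∫ y, v (x - y) * a y ^ 2) :=
    (hI.integral_prod_left).const_mul _
  have hsq : Integrable (fun x => (∫ y, v (x - y) * |a y|) ^ 2) := by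
    refine hint.mono' (hm.pow 2) ?_
    filter_upwards [hpt] with x hx
    rwa [Real.norm_of_nonneg (sq_nonneg _)]
  refine ⟨(memLp_two_iff_integrable_sq hm).2 hsq, ?_⟩
  refine (integral_mono_ae hsq hint hpt).trans (le_of_eq ?_)
  rw [integral_const_mul, ← integral_prod _ hI, integral_conv_snd hv ha.integrable_sq]
  ring

end Weight

/-! ### Almost orthogonality of kernels at different scales -/

section AlmostOrthogonality

variable {E : Type*} [NormedAddCommGroup E] [InnerProductSpace ℝ E] [FiniteDimensional ℝ E]
  [MeasurableSpace E] [BorelSpace E]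

theorem MeasureTheory.MemLp.integrable_fun_mul {α : Type*} [MeasurableSpace α] {μ : Measure α}
    {f g : α → ℝ} (hf : MemLp f 2 μ) (hg : MemLp g 2 μ) : Integrable (fun x => f x * g x) μ :=
  hf.integrable_mul hg

theorem MeasureTheory.abs_integral_le_of_abs_le {α : Type*} [MeasurableSpace α] {μ : Measure α}
    {f g : α → ℝ} (hg : Integrable g μ) (h : ∀ᵐ x ∂μ, |f x| ≤ g x) : |∫ x, f x ∂μ| ≤ ∫ x, g x ∂μ :=
  norm_integral_le_of_norm_le (f := f) hg h

/-- The integral operator with kernel `S`. -/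
def kernelOp (S : E → E → ℝ) (f : E → ℝ) (x : E) : ℝ := ∫ y, S x y * f y

/-- A measurable kernel dominated by `B` times the Poisson weight at scale `r`. -/
structure IsPoissonKernel (S : E → E → ℝ) (B r : ℝ) : Prop where
  measurable : Measurable (Function.uncurry S)
  size : ∀ x y, |S x y| ≤ B * poissonWeight r (x - y)

variable {S S' : E → E → ℝ} {B r R : ℝ}

theorem IsPoissonKernel.flip (hS : IsPoissonKernel S B r) :
    IsPoissonKernel (fun x y => S y x) B r where
  measurable := hS.measurable.comp measurable_swap
  size x y := by rw [poissonWeight_sub_comm]; exact hS.size y x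

theorem IsPoissonKernel.integrable_mul_mul (hS : IsPoissonKernel S B r) (hr : 0 < r)
    {a b : E → ℝ} (ha : MemLp a 2) (hb : MemLp b 2) :
    Integrable (fun p : E × E => S p.1 p.2 * (a p.1 * b p.2)) (volume.prod volume) := by
  refine ((integrable_conv_mul (integrable_poissonWeight hr) (poissonWeight_nonneg hr) ha
    hb).const_mul B).mono' ?_ (Filter.Eventually.of_forall fun p => ?_)
  · exact (hS.measurable.aestronglyMeasurable).mul
      (ha.aestronglyMeasurable.comp_fst.mul hb.aestronglyMeasurable.comp_snd)
  · rw [norm_mul, norm_mul, ← mul_assoc]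
    have := hS.size p.1 p.2
    simp only [Real.norm_eq_abs]
    rw [mul_assoc, ← mul_assoc B]
    exact mul_le_mul_of_nonneg_right this (by positivity)

theorem IsPoissonKernel.integrable_mul (hS : IsPoissonKernel S B r) (hr : 0 < r)
    {f : E → ℝ} (hf : MemLp f 2) (x : E) : Integrable (fun y => S x y * f y) := by
  have h1 : MemLp (fun y => B * poissonWeight r (x - y)) 2 :=
    ((memLp_two_poissonWeight hr).comp_measurePreserving
      (Measure.measurePreserving_sub_left volume x)).const_mul B
  have h2 : MemLp (fun y => S x y) 2 := h1.mono
    (hS.measurable.comp measurable_prodMk_left).aestronglyMeasurable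
    (Filter.Eventually.of_forall fun y => (hS.size x y).trans (le_abs_self _))
  exact h2.integrable_mul hf

theorem IsPoissonKernel.integrable (hS : IsPoissonKernel S B r) (hr : 0 < r) (x : E) :
    Integrable (fun y => S x y) :=
  (((integrable_poissonWeight hr).comp_sub_left x).const_mul B).mono'
    (hS.measurable.comp measurable_prodMk_left).aestronglyMeasurable
    (Filter.Eventually.of_forall fun y => hS.size x y)

theorem IsPoissonKernel.memLp_kernelOp (hS : IsPoissonKernel S B r) (hr : 0 < r)
    {f : E → ℝ} (hf : MemLp f 2) : MemLp (kernelOp S f) 2 := by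
  have h := (young_memLp (integrable_poissonWeight hr) (poissonWeight_nonneg hr) hf).1.const_mul B
  refine h.mono ?_ (Filter.Eventually.of_forall fun x => ?_)
  · exact (hS.measurable.aestronglyMeasurable.mul
      hf.aestronglyMeasurable.comp_snd).integral_prod_right'
  · refine le_trans ?_ (le_abs_self _)
    rw [← integral_const_mul]
    refine norm_integral_le_of_norm_le ?_ (Filter.Eventually.of_forall fun y => ?_)
    · have h1 : MemLp (fun y => poissonWeight r (x - y)) 2 :=
        (memLp_two_poissonWeight hr).comp_measurePreserving
          (Measure.measurePreserving_sub_left volume x)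
      exact (h1.integrable_fun_mul hf.norm).const_mul B
    · rw [norm_mul, ← mul_assoc]
      exact mul_le_mul_of_nonneg_right (hS.size _ _) (abs_nonneg _)

theorem IsPoissonKernel.integral_mul_kernelOp (hS : IsPoissonKernel S B r) (hr : 0 < r)
    {f g : E → ℝ} (hf : MemLp f 2) (hg : MemLp g 2) :
    ∫ x, f x * kernelOp S g x = ∫ y, kernelOp (fun x y => S y x) f y * g y := by
  have h := hS.integrable_mul_mul hr hf hg
  calc ∫ x, f x * kernelOp S g x = ∫ x, ∫ y, S x y * (f x * g y) := by
        refine integral_congr_ae (Filter.Eventually.of_forall fun x => ?_)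
        simp only [kernelOp]
        rw [← integral_const_mul]
        exact integral_congr_ae (Filter.Eventually.of_forall fun y => by ring)
    _ = ∫ y, ∫ x, S x y * (f x * g y) := integral_integral_swap h
    _ = _ := by
        refine integral_congr_ae (Filter.Eventually.of_forall fun y => ?_)
        simp only [kernelOp]
        rw [← integral_mul_const]
        exact integral_congr_ae (Filter.Eventually.of_forall fun y => by ring)

/-- The convolution of the Poisson weight with the absolute value of a function. -/
def weightConv (r : ℝ) (f : E → ℝ) (x : E) : ℝ := ∫ y, poissonWeight r (x - y) * |f y|

theorem weightConv_nonneg {r : ℝ} (hr : 0 < r) (f : E → ℝ) (x : E) : 0 ≤ weightConv r f x :=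
  integral_nonneg fun _ => mul_nonneg (poissonWeight_nonneg hr _) (abs_nonneg _)

theorem memLp_weightConv {r : ℝ} (hr : 0 < r) {f : E → ℝ} (hf : MemLp f 2) :
    MemLp (weightConv r f) 2 :=
  (young_memLp (integrable_poissonWeight hr) (poissonWeight_nonneg hr) hf).1

theorem integral_weightConv_sq_le {r : ℝ} (hr : 0 < r) {f : E → ℝ} (hf : MemLp f 2) :
    ∫ x, weightConv r f x ^ 2 ≤ weightConst E ^ 2 * ∫ x, f x ^ 2 := by
  refine (young_memLp (integrable_poissonWeight hr) (poissonWeight_nonneg hr) hf).2.trans ?_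
  have h5 : 0 ≤ ∫ x, f x ^ 2 := integral_nonneg fun x => sq_nonneg _
  have h7 : 0 ≤ ∫ u : E, poissonWeight r u := integral_nonneg (poissonWeight_nonneg hr)
  have h8 : ∫ u : E, poissonWeight r u ≤ weightConst E := integral_poissonWeight_le hr
  gcongr

/-- Regularity of the kernel in its second variable becomes Hölder continuity of order `1/2` for the
adjoint applied to `h'`. The constant is an average of `|h'|`, which stays in `L²`. -/
theorem IsPoissonKernel.abs_adjoint_sub_adjoint_le (hR : 0 < R)
    (hS' : IsPoissonKernel S' B R)
    (hreg : ∀ z x y, |S' z y - S' z x| ≤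
      B * √(‖x - y‖ / R) * (poissonWeight R (z - y) + poissonWeight R (z - x)))
    {h' : E → ℝ} (hh' : MemLp h' 2) (x y : E) :
    |kernelOp (fun x y => S' y x) h' y - kernelOp (fun x y => S' y x) h' x| ≤
      B * √(‖x - y‖ / R) * (weightConv R h' y + weightConv R h' x) := by
  have hwint : ∀ x, Integrable fun y => poissonWeight R (x - y) * |h' y| := fun x =>
    MemLp.integrable_fun_mul (((memLp_two_poissonWeight hR).comp_measurePreserving
      (Measure.measurePreserving_sub_left volume x))) hh'.norm
  rw [kernelOp, kernelOp, ← integral_sub (hS'.flip.integrable_mul hR hh' y)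
    (hS'.flip.integrable_mul hR hh' x), weightConv, weightConv,
    ← integral_add (hwint y) (hwint x), ← integral_const_mul]
  refine abs_integral_le_of_abs_le (((hwint y).add (hwint x)).const_mul _)
    (Filter.Eventually.of_forall fun z => ?_)
  rw [← sub_mul, abs_mul, ← add_mul, ← mul_assoc]
  refine mul_le_mul_of_nonneg_right ?_ (abs_nonneg _)
  rw [poissonWeight_sub_comm R y z, poissonWeight_sub_comm R x z]
  exact hreg z x y

/-- Almost orthogonality of the adjoints of two kernels at scales `r` and `R`: the first one has
mean value zero and the second one is regular in the second variable. -/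
theorem abs_integral_adjoint_mul_adjoint_le (hr : 0 < r) (hR : 0 < R) (hB : 0 ≤ B)
    (hS : IsPoissonKernel S B r) (hS' : IsPoissonKernel S' B R)
    (hcanc : ∀ x, ∫ y, S x y = 0)
    (hreg : ∀ z x y, |S' z y - S' z x| ≤
      B * √(‖x - y‖ / R) * (poissonWeight R (z - y) + poissonWeight R (z - x)))
    {h h' : E → ℝ} (hh : MemLp h 2) (hh' : MemLp h' 2) :
    |∫ y, kernelOp (fun x y => S y x) h y * kernelOp (fun x y => S' y x) h' y| ≤
      2 * weightConst E * (1 + weightConst E ^ 2) * B ^ 2 * √(r / R) *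
        ((∫ x, h x ^ 2) + ∫ x, h' x ^ 2) := by
  set c := weightConst E
  have hc : 0 < c := weightConst_pos E
  set G' := kernelOp (fun x y => S' y x) h' with hG'
  have hG'2 : MemLp G' 2 := hS'.flip.memLp_kernelOp hR hh'
  set W : E → ℝ := weightConv R h'
  have hW2 : MemLp W 2 := memLp_weightConv hR hh'
  have hW0 : ∀ x, 0 ≤ W x := weightConv_nonneg hR h'
  have hGdiff : ∀ x y, |G' y - G' x| ≤ B * √(‖x - y‖ / R) * (W y + W x) :=
    hS'.abs_adjoint_sub_adjoint_le hR hreg hh'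
  set v : E → ℝ := fun u => poissonWeight r u * √(‖u‖ / R) with hv
  have hv0 : ∀ u, 0 ≤ v u := fun u => mul_nonneg (poissonWeight_nonneg hr u) (Real.sqrt_nonneg _)
  have hvi : Integrable v := integrable_poissonWeight_mul_sqrt_div hr hR
  have hvle : ∫ u, v u ≤ √(r / R) * c := integral_poissonWeight_mul_sqrt_div_le hr hR
  have hI1 := integrable_conv_mul hvi hv0 hh hW2
  have hhW : Integrable (fun x => |h x| * |W x|) := hh.norm.integrable_fun_mul hW2.norm
  have hI2 := integrable_conv_fst hvi hhW
  have hF : ∀ᵐ x, |h x * ∫ y, S x y * G' y| ≤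
      ∫ y, B ^ 2 * (v (x - y) * (|h x| * |W y|) + v (x - y) * (|h x| * |W x|)) := by
    filter_upwards [hI1.prod_right_ae, hI2.prod_right_ae] with x h1 h2
    -- Since `S x` has mean value zero, the constant `G' x` may be subtracted; only increments of
    -- `G'`, weighted at scale `r`, enter.
    have e : h x * ∫ y, S x y * G' y = ∫ y, h x * (S x y * (G' y - G' x)) := by
      rw [integral_const_mul]
      congr 1
      have : ∀ y, S x y * (G' y - G' x) = S x y * G' y - S x y * G' x := fun y => by ring
      simp_rw [this]
      rw [integral_sub (hS.integrable_mul hr hG'2 x) ((hS.integrable hr x).mul_const _),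
        integral_mul_const, hcanc, zero_mul, sub_zero]
    rw [e]
    refine abs_integral_le_of_abs_le ((h1.add h2).const_mul _)
      (Filter.Eventually.of_forall fun y => ?_)
    rw [abs_mul, abs_mul, abs_of_nonneg (hW0 x), abs_of_nonneg (hW0 y)]
    calc |h x| * (|S x y| * |G' y - G' x|)
        ≤ |h x| * ((B * poissonWeight r (x - y)) * (B * √(‖x - y‖ / R) * (W y + W x))) := by
          have := hS.size x y
          have := hGdiff x y
          have := poissonWeight_nonneg hr (x - y)
          gcongr
      _ = _ := by simp only [hv]; ring
  -- The adjoint of the first operator is moved to the other factor, which turns the form into `∫ h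
  -- · S G'`.
  have hswap := hS.integral_mul_kernelOp hr hh hG'2
  rw [← hswap]
  have hIsum := (hI1.add hI2).const_mul (B ^ 2)
  calc |∫ x, h x * kernelOp S G' x|
      ≤ ∫ x, ∫ y, B ^ 2 * (v (x - y) * (|h x| * |W y|) + v (x - y) * (|h x| * |W x|)) :=
        abs_integral_le_of_abs_le hIsum.integral_prod_left hF
    _ = B ^ 2 * ((∫ p : E × E, v (p.1 - p.2) * (|h p.1| * |W p.2|) ∂(volume.prod volume)) +
          (∫ u, v u) * ∫ x, |h x| * |W x|) := by
        rw [← integral_conv_fst hvi hhW, ← integral_add hI1 hI2, ← integral_const_mul]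
        exact (integral_prod _ hIsum).symm
    _ ≤ B ^ 2 * ((∫ u, v u) * ((∫ x, h x ^ 2) + ∫ x, W x ^ 2) +
          (∫ u, v u) * ((∫ x, h x ^ 2) + ∫ x, W x ^ 2)) := by
        have h1 := integral_conv_mul_le hvi hv0 hh hW2
        have h2 : ∫ x, |h x| * |W x| ≤ (∫ x, h x ^ 2) + ∫ x, W x ^ 2 := by
          rw [← integral_add hh.integrable_sq hW2.integrable_sq]
          refine integral_mono hhW (hh.integrable_sq.add hW2.integrable_sq) fun x => ?_
          simp only
          nlinarith [sq_nonneg (|h x| - |W x|), sq_abs (h x), sq_abs (W x), sq_nonneg (h x),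
            sq_nonneg (W x)]
        have h3 : 0 ≤ ∫ u, v u := integral_nonneg hv0
        gcongr
    _ ≤ B ^ 2 * ((√(r / R) * c) * ((∫ x, h x ^ 2) + c ^ 2 * ∫ x, h' x ^ 2) +
          (√(r / R) * c) * ((∫ x, h x ^ 2) + c ^ 2 * ∫ x, h' x ^ 2)) := by
        have h3 : 0 ≤ ∫ u, v u := integral_nonneg hv0
        have h4 : 0 ≤ ∫ x, h x ^ 2 := integral_nonneg fun x => sq_nonneg _
        have h5 : 0 ≤ ∫ x, h' x ^ 2 := integral_nonneg fun x => sq_nonneg _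
        have h6 : ∫ x, W x ^ 2 ≤ c ^ 2 * ∫ x, h' x ^ 2 := integral_weightConv_sq_le hR hh'
        have h9 : 0 ≤ ∫ x, W x ^ 2 := integral_nonneg fun x => sq_nonneg _
        gcongr
    _ ≤ _ := by
        have h4 : 0 ≤ ∫ x, h x ^ 2 := integral_nonneg fun x => sq_nonneg _
        have h5 : 0 ≤ ∫ x, h' x ^ 2 := integral_nonneg fun x => sq_nonneg _
        have h6 : (∫ x, h x ^ 2) + c ^ 2 * ∫ x, h' x ^ 2 ≤
          (1 + c ^ 2) * ((∫ x, h x ^ 2) + ∫ x, h' x ^ 2) := by nlinarith [sq_nonneg c]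
        have h7 : 0 ≤ B ^ 2 * (2 * (√(r / R) * c)) := by positivity
        nlinarith [mul_le_mul_of_nonneg_left h6 h7]

/-- Schur's test for the matrix `2 ^ (-|i - j|)`: every row sum is at most `4`, and by symmetry `a
i` and `a j` contribute equally. The exponent is `|i - j|` in natural subtraction. -/
theorem sum_geometric_abs_le (N : ℕ) (a : ℕ → ℝ) (ha : ∀ i, 0 ≤ a i) :
    ∑ i ∈ Finset.range N, ∑ j ∈ Finset.range N,
      (1 / 2 : ℝ) ^ (max i j - min i j) * (a i + a j) ≤ 8 * ∑ i ∈ Finset.range N, a i := by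
  have key : ∀ i, ∑ j ∈ Finset.range N, (1 / 2 : ℝ) ^ (max i j - min i j) ≤ 4 := by
    intro i
    have h1 : ∀ j, (1 / 2 : ℝ) ^ (max i j - min i j) ≤ (1 / 2) ^ (i - j) * (if j ≤ i then 1 else 0) +
        (1 / 2) ^ (j - i) * (if i ≤ j then 1 else 0) := by
      intro j
      rcases le_total i j with h | h
      · simp only [max_eq_right h, min_eq_left h, h, if_true, mul_one]
        split_ifs <;> simp
      · simp only [max_eq_left h, min_eq_right h, h, if_true, mul_one]
        split_ifs <;> simp
    have hs : ∀ m : ℕ, ∑ k ∈ Finset.range m, (1 / 2 : ℝ) ^ k ≤ 2 := fun m => by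
      have := Summable.sum_le_tsum (Finset.range m) (fun k _ => by positivity)
        (summable_geometric_two)
      rwa [tsum_geometric_two] at this
    refine (Finset.sum_le_sum fun j _ => h1 j).trans ?_
    rw [Finset.sum_add_distrib]
    have e1 : ∑ j ∈ Finset.range N, (1 / 2 : ℝ) ^ (i - j) * (if j ≤ i then 1 else 0) ≤ 2 := by
      simp only [mul_ite, mul_one, mul_zero]
      rw [← Finset.sum_filter]
      refine le_trans ?_ (hs (i + 1))
      have : ∑ j ∈ (Finset.range N).filter (· ≤ i), (1 / 2 : ℝ) ^ (i - j) ≤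
          ∑ j ∈ Finset.range (i + 1), (1 / 2 : ℝ) ^ (i - j) :=
        Finset.sum_le_sum_of_subset_of_nonneg (fun j hj => by
          simp only [Finset.mem_filter, Finset.mem_range] at hj ⊢; omega) fun _ _ _ => by positivity
      refine this.trans (le_of_eq ?_)
      exact Finset.sum_range_reflect (fun k => (1 / 2 : ℝ) ^ k) (i + 1) ▸ by simp
    have e2 : ∑ j ∈ Finset.range N, (1 / 2 : ℝ) ^ (j - i) * (if i ≤ j then 1 else 0) ≤ 2 := by
      simp only [mul_ite, mul_one, mul_zero]
      rw [← Finset.sum_filter]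
      refine le_trans ?_ (hs (N - i))
      have : (Finset.range N).filter (i ≤ ·) = Finset.Ico i N := by
        ext j; simp; omega
      rw [this, Finset.sum_Ico_eq_sum_range]
      simp
    linarith
  have hsym : ∑ i ∈ Finset.range N, ∑ j ∈ Finset.range N,
      (1 / 2 : ℝ) ^ (max i j - min i j) * a j = ∑ i ∈ Finset.range N, ∑ j ∈ Finset.range N,
      (1 / 2 : ℝ) ^ (max i j - min i j) * a i := by
    rw [Finset.sum_comm]
    simp_rw [max_comm, min_comm]
  simp_rw [mul_add, Finset.sum_add_distrib]
  rw [hsym]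
  have : ∑ i ∈ Finset.range N, ∑ j ∈ Finset.range N,
      (1 / 2 : ℝ) ^ (max i j - min i j) * a i ≤ 4 * ∑ i ∈ Finset.range N, a i := by
    rw [Finset.mul_sum]
    refine Finset.sum_le_sum fun i _ => ?_
    rw [← Finset.sum_mul]
    exact mul_le_mul_of_nonneg_right (key i) (ha i)
  linarith

variable (E) in
/-- Square function estimate for regular kernels of mean value zero at the scales `ρ 4ᵏ`. -/
theorem exists_sum_integral_kernelOp_sq_le :
    ∃ C : ℝ, 0 < C ∧ ∀ (ρ B : ℝ) (S : ℕ → E → E → ℝ), 0 < ρ → 0 < B →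
      (∀ k, IsPoissonKernel (S k) B (ρ * 4 ^ k)) → (∀ k x, ∫ y, S k x y = 0) →
      (∀ k z x y, |S k z y - S k z x| ≤ B * √(‖x - y‖ / (ρ * 4 ^ k)) *
        (poissonWeight (ρ * 4 ^ k) (z - y) + poissonWeight (ρ * 4 ^ k) (z - x))) →
      ∀ g : E → ℝ, MemLp g 2 → ∀ N : ℕ,
        ∑ k ∈ Finset.range N, ∫ x, kernelOp (S k) g x ^ 2 ≤ C * B ^ 2 * ∫ x, g x ^ 2 := by
  set c := weightConst E
  have hc : 0 < c := weightConst_pos E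
  refine ⟨16 * c * (1 + c ^ 2), by positivity, ?_⟩
  intro ρ B S hρ hB hS hcanc hreg g hg N
  have hr : ∀ k : ℕ, 0 < ρ * 4 ^ k := fun k => by positivity
  set h : ℕ → E → ℝ := fun k => kernelOp (S k) g with hh
  have hh2 : ∀ k, MemLp (h k) 2 := fun k => (hS k).memLp_kernelOp (hr k) hg
  set G : ℕ → E → ℝ := fun k => kernelOp (fun x y => S k y x) (h k) with hG
  have hG2 : ∀ k, MemLp (G k) 2 := fun k => (hS k).flip.memLp_kernelOp (hr k) (hh2 k)
  set Q := ∑ k ∈ Finset.range N, ∫ x, h k x ^ 2 with hQ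
  -- With `T_k` the operator of kernel `S k`, the sum of the `‖T_k g‖²` is the pairing of `∑ T_k*
  -- T_k g` with `g`.
  have hQ1 : Q = ∫ y, (∑ k ∈ Finset.range N, G k y) * g y := by
    simp_rw [Finset.sum_mul]
    rw [integral_finsetSum _ fun k _ => (hG2 k).integrable_fun_mul hg]
    refine Finset.sum_congr rfl fun k _ => ?_
    rw [← (hS k).integral_mul_kernelOp (hr k) (hh2 k) hg]
    simp_rw [sq]
    rfl
  -- The ratio `4` of successive scales makes the square root a power of `1 / 2`.
  have hratio : ∀ i j, j ≤ i → √(ρ * 4 ^ j / (ρ * 4 ^ i)) = (1 / 2 : ℝ) ^ (i - j) := by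
    intro i j hij
    obtain ⟨m, rfl⟩ := Nat.exists_eq_add_of_le hij
    have e : ρ * 4 ^ j / (ρ * 4 ^ (j + m)) = ((1 / 2 : ℝ) ^ m) ^ 2 := by
      have h1 : (4 : ℝ) ^ m ≠ 0 := by positivity
      rw [pow_add, ← pow_mul, mul_comm m 2, pow_mul, one_div, inv_pow, inv_pow]
      norm_num
      field_simp
    rw [Nat.add_sub_cancel_left, e, Real.sqrt_sq (by positivity)]
  -- The kernel at the smaller scale supplies the cancellation, the one at the larger scale the
  -- regularity.
  have hcross : ∀ i j, ∫ y, G i y * G j y ≤ 2 * c * (1 + c ^ 2) * B ^ 2 *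
      ((1 / 2 : ℝ) ^ (max i j - min i j) * ((∫ x, h i x ^ 2) + ∫ x, h j x ^ 2)) := by
    intro i j
    rcases le_total i j with hij | hij
    · have := abs_integral_adjoint_mul_adjoint_le (hr i) (hr j) hB.le (hS i) (hS j) (hcanc i)
        (hreg j) (hh2 i) (hh2 j)
      rw [hratio j i hij] at this
      rw [max_eq_right hij, min_eq_left hij]
      refine (le_abs_self _).trans (this.trans (le_of_eq ?_))
      ring
    · have := abs_integral_adjoint_mul_adjoint_le (hr j) (hr i) hB.le (hS j) (hS i) (hcanc j)
        (hreg i) (hh2 j) (hh2 i)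
      rw [hratio i j hij] at this
      rw [max_eq_left hij, min_eq_right hij]
      simp_rw [mul_comm (G i _)]
      refine (le_abs_self _).trans (this.trans (le_of_eq ?_))
      ring
  have hQ0 : ∀ k, 0 ≤ ∫ x, h k x ^ 2 := fun k => integral_nonneg fun x => sq_nonneg _
  have hG3 : MemLp (fun y => ∑ k ∈ Finset.range N, G k y) 2 :=
    memLp_finsetSum _ fun k _ => hG2 k
  have hGsq : ∫ y, (∑ k ∈ Finset.range N, G k y) ^ 2 ≤ 16 * c * (1 + c ^ 2) * B ^ 2 * Q := by
    have e : ∀ y, (∑ k ∈ Finset.range N, G k y) ^ 2 =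
        ∑ i ∈ Finset.range N, ∑ j ∈ Finset.range N, G i y * G j y := fun y => by
      rw [sq, Finset.sum_mul_sum]
    simp_rw [e]
    rw [integral_finsetSum _ fun i _ => integrable_finsetSum _ fun j _ =>
      (hG2 i).integrable_fun_mul (hG2 j)]
    have : ∀ i ∈ Finset.range N, ∫ y, ∑ j ∈ Finset.range N, G i y * G j y =
        ∑ j ∈ Finset.range N, ∫ y, G i y * G j y := fun i _ =>
      integral_finsetSum _ fun j _ => (hG2 i).integrable_fun_mul (hG2 j)
    rw [Finset.sum_congr rfl this]
    refine (Finset.sum_le_sum fun i _ => Finset.sum_le_sum fun j _ => hcross i j).trans ?_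
    simp_rw [← Finset.mul_sum]
    have := sum_geometric_abs_le N (fun k => ∫ x, h k x ^ 2) hQ0
    calc _ ≤ 2 * c * (1 + c ^ 2) * B ^ 2 * (8 * ∑ i ∈ Finset.range N, ∫ x, h i x ^ 2) := by
          gcongr
      _ = _ := by ring
  set D := 16 * c * (1 + c ^ 2) * B ^ 2 with hD
  have hDpos : 0 < D := by positivity
  -- AM–GM with parameter `D`. By `hGsq` the second term is at most `Q / 2` and is absorbed, which
  -- leaves `Q ≤ D ∫ g²`.
  have h5 : Q ≤ 1 / 2 * (D * (∫ x, g x ^ 2) + D⁻¹ * ∫ y, (∑ k ∈ Finset.range N, G k y) ^ 2) := by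
    rw [hQ1, ← integral_const_mul, ← integral_const_mul, ← integral_add
      (hg.integrable_sq.const_mul _) (hG3.integrable_sq.const_mul _), ← integral_const_mul]
    refine integral_mono (hG3.integrable_fun_mul hg) (((hg.integrable_sq.const_mul _).add
      (hG3.integrable_sq.const_mul _)).const_mul _) fun y => ?_
    simp only
    set s := ∑ k ∈ Finset.range N, G k y
    have : 0 ≤ D⁻¹ * (D * g y - s) ^ 2 := by positivity
    have e : D⁻¹ * (D * g y - s) ^ 2 = D * g y ^ 2 + D⁻¹ * s ^ 2 - 2 * (s * g y) := by
      field_simp; ring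
    linarith
  have h6 : D⁻¹ * ∫ y, (∑ k ∈ Finset.range N, G k y) ^ 2 ≤ Q := by
    rw [inv_mul_le_iff₀ hDpos]; exact hGsq
  linarith

end AlmostOrthogonality

/-! ### Averages over probability measures and the one-step energy inequality -/

section Averages

variable {E : Type*} [NormedAddCommGroup E] [MeasurableSpace E]
variable {F : Type*} [NormedAddCommGroup F] [InnerProductSpace ℝ F] [CompleteSpace F]

/-- The average of the translates of `f` by a measure. -/
def avg (μ : Measure E) (f : E → F) (x : E) : F := ∫ h, f (x + h) ∂μ

/-- The mean square oscillation of `f` around its average. -/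
def oscSq (μ : Measure E) (f : E → F) (x : E) : ℝ := ∫ h, ‖f (x + h) - avg μ f x‖ ^ 2 ∂μ

/-- A probability measure carried by the closed ball of radius `R` around the origin. -/
class IsBallProbability (μ : Measure E) (R : outParam ℝ) : Prop extends
    IsProbabilityMeasure μ where
  compl_closedBall : μ (Metric.closedBall 0 R)ᶜ = 0

variable [InnerProductSpace ℝ E] [FiniteDimensional ℝ E] [BorelSpace E]
variable {μ ν : Measure E} {R R' : ℝ} [hμ : IsBallProbability μ R] [hν : IsBallProbability ν R']

theorem ae_norm_le (μ : Measure E) [hμ : IsBallProbability μ R] : ∀ᵐ h ∂μ, ‖h‖ ≤ R := by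
  have := hμ.compl_closedBall
  rw [← mem_ae_iff] at this
  filter_upwards [this] with h hh
  simpa using hh

theorem restrict_closedBall_eq (μ : Measure E) [hμ : IsBallProbability μ R] :
    μ.restrict (Metric.closedBall 0 R) = μ :=
  Measure.restrict_eq_self_of_ae_mem (by
    filter_upwards [ae_norm_le μ] with h hh
    simpa using hh)

theorem integrable_of_ball {G : Type*} [NormedAddCommGroup G] {φ : E → G} (hφ : Continuous φ) (μ : Measure E)
    [hμ : IsBallProbability μ R] : Integrable φ μ := by
  have : IntegrableOn φ (Metric.closedBall 0 R) μ :=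
    hφ.continuousOn.integrableOn_compact (isCompact_closedBall 0 R)
  rwa [IntegrableOn, restrict_closedBall_eq μ] at this

theorem integrable_translate {f : E → F} (hf : Continuous f) (μ : Measure E)
    [hμ : IsBallProbability μ R] (x : E) : Integrable (fun h => f (x + h)) μ :=
  integrable_of_ball (by fun_prop) μ

theorem continuous_avg {f : E → F} (hf : Continuous f) (μ : Measure E)
    [hμ : IsBallProbability μ R] : Continuous (avg μ f) := by
  have h := continuous_parametric_integral_of_continuous (μ := μ) (f := fun x h => f (x + h))
    (by fun_prop) (isCompact_closedBall (0 : E) R)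
  rwa [restrict_closedBall_eq μ] at h

theorem norm_avg_le {f : E → F} {L : ℝ} (hf : ∀ x, ‖f x‖ ≤ L) (μ : Measure E)
    [hμ : IsProbabilityMeasure μ] (x : E) : ‖avg μ f x‖ ≤ L := by
  have := norm_integral_le_of_norm_le_const (μ := μ) (f := fun h => f (x + h)) (C := L)
    (Filter.Eventually.of_forall fun h => hf _)
  simpa [avg] using this

theorem avg_nonneg {f : E → ℝ} (hf : ∀ x, 0 ≤ f x) (μ : Measure E) (x : E) : 0 ≤ avg μ f x :=
  integral_nonneg fun _ => hf _

theorem norm_avg_sub_le {f : E → F} (hf : Continuous f) (μ : Measure E)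
    [hμ : IsBallProbability μ R] {x : E} {c : F} {D : ℝ}
    (h : ∀ y, ‖y - x‖ ≤ R → ‖f y - c‖ ≤ D) : ‖avg μ f x - c‖ ≤ D := by
  have e : avg μ f x - c = ∫ h, (f (x + h) - c) ∂μ := by
    rw [integral_sub (integrable_translate hf μ x) (integrable_const _)]
    simp [avg]
  rw [e]
  have := norm_integral_le_of_norm_le_const (μ := μ) (f := fun h => f (x + h) - c) (C := D) (by
    filter_upwards [ae_norm_le μ] with u hu
    exact h _ (by simpa using hu))
  simpa using this

theorem hasCompactSupport_avg {f : E → F} (hf : HasCompactSupport f) (μ : Measure E)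
    [hμ : IsBallProbability μ R] : HasCompactSupport (avg μ f) := by
  obtain ⟨D, hD⟩ := hf.isCompact.isBounded.subset_closedBall 0
  refine HasCompactSupport.intro (isCompact_closedBall (0 : E) (D + R)) fun x hx => ?_
  refine integral_eq_zero_of_ae ?_
  filter_upwards [ae_norm_le μ] with h hh
  by_contra hne
  have h1 := hD (subset_closure (show x + h ∈ Function.support f from hne))
  simp only [Metric.mem_closedBall, dist_zero_right, not_le] at h1 hx
  have := norm_sub_le (x + h) h
  simp at this
  linarith

theorem integral_avg {f : E → ℝ} (hf : Integrable f) (μ : Measure E)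
    [hμ : IsProbabilityMeasure μ] : Integrable (avg μ f) ∧ ∫ x, avg μ f x = ∫ x, f x := by
  have hint : Integrable (fun p : E × E => f (p.1 + p.2)) (volume.prod μ) := by
    have mp : MeasurePreserving (fun p : E × E => (p.1 + p.2, p.2)) (volume.prod μ)
        (volume.prod μ) := by
      have h := MeasurePreserving.skew_product (μa := μ) (μb := μ) (μc := (volume : Measure E))
        (μd := (volume : Measure E)) (f := id) (g := fun a x => x + a) (MeasurePreserving.id μ)
        (by fun_prop) (Filter.Eventually.of_forall fun a => map_add_right_eq_self volume a)
      exact (Measure.measurePreserving_swap.comp h).comp Measure.measurePreserving_swap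
    have h2 := hf.comp_fst μ
    exact mp.integrable_comp_of_integrable h2
  refine ⟨hint.integral_prod_left, ?_⟩
  simp only [avg]
  rw [integral_integral_swap hint]
  simp_rw [integral_add_right_eq_self f, integral_const]
  simp

/-- Variance is mean square minus squared mean. This identity is what makes oscillations telescope
along successive averages. -/
theorem oscSq_eq {f : E → F} (hf : Continuous f) (μ : Measure E)
    [hμ : IsBallProbability μ R] (x : E) :
    oscSq μ f x = avg μ (fun y => ‖f y‖ ^ 2) x - ‖avg μ f x‖ ^ 2 := by
  have e : ∀ h, ‖f (x + h) - avg μ f x‖ ^ 2 = ‖f (x + h)‖ ^ 2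
      - 2 * inner ℝ (avg μ f x) (f (x + h)) + ‖avg μ f x‖ ^ 2 := fun h => by
    rw [norm_sub_sq_real, real_inner_comm]
  have i1 : Integrable (fun h => ‖f (x + h)‖ ^ 2) μ :=
    integrable_translate (f := fun y => ‖f y‖ ^ 2) (by fun_prop) μ x
  have i2 : Integrable (fun h => 2 * inner ℝ (avg μ f x) (f (x + h))) μ :=
    integrable_translate (f := fun y => 2 * inner ℝ (avg μ f x) (f y)) (by fun_prop) μ x
  simp only [oscSq]
  simp_rw [e]
  have i3 : Integrable (fun h => ‖f (x + h)‖ ^ 2 - 2 * inner ℝ (avg μ f x) (f (x + h))) μ :=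
    i1.sub i2
  rw [integral_add i3 (integrable_const _), integral_sub i1 i2, integral_const_mul,
    integral_inner (integrable_translate hf μ x)]
  have : ∫ h, f (x + h) ∂μ = avg μ f x := rfl
  rw [this, real_inner_self_eq_norm_sq]
  simp [avg]
  ring

theorem oscSq_nonneg (μ : Measure E) (f : E → F) (x : E) : 0 ≤ oscSq μ f x :=
  integral_nonneg fun _ => sq_nonneg _

theorem continuous_oscSq {f : E → F} (hf : Continuous f) (μ : Measure E)
    [hμ : IsBallProbability μ R] : Continuous (oscSq μ f) := by
  rw [funext (oscSq_eq hf μ)]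
  exact (continuous_avg (by fun_prop) μ).sub ((continuous_avg hf μ).norm.pow 2)

/-- The average of `g` squared is at most the mean square. -/
theorem sq_avg_le {g : E → ℝ} (hg : Continuous g) (μ : Measure E)
    [hμ : IsBallProbability μ R] (x : E) : avg μ g x ^ 2 ≤ avg μ (fun y => g y ^ 2) x := by
  have h := oscSq_eq hg μ x
  have h0 := oscSq_nonneg μ g x
  simp only [Real.norm_eq_abs, sq_abs] at h
  linarith

theorem norm_avg_sub_sq_le {g : E → F} (hg : Continuous g) (μ : Measure E)
    [hμ : IsBallProbability μ R] (x : E) (c : F) :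
    ‖avg μ g x - c‖ ^ 2 ≤ avg μ (fun y => ‖g y - c‖ ^ 2) x := by
  have h1 : ‖avg μ g x - c‖ ≤ avg μ (fun y => ‖g y - c‖) x := by
    have e : avg μ g x - c = ∫ h, (g (x + h) - c) ∂μ := by
      rw [integral_sub (integrable_translate hg μ x) (integrable_const _)]
      simp [avg]
    rw [e]
    exact norm_integral_le_integral_norm _
  calc _ ≤ avg μ (fun y => ‖g y - c‖) x ^ 2 := by gcongr
    _ ≤ _ := sq_avg_le (by fun_prop) μ x

instance isBallProbability_conv : IsBallProbability (μ.conv ν) (R + R') where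
  toIsProbabilityMeasure := inferInstance
  compl_closedBall := by
    rw [Measure.conv, Measure.map_apply (by fun_prop) Metric.isClosed_closedBall.measurableSet.compl]
    have h1 : ∀ᵐ p ∂(μ.prod ν), ‖p.1‖ ≤ R := Measure.quasiMeasurePreserving_fst.ae (ae_norm_le μ)
    have h2 : ∀ᵐ p ∂(μ.prod ν), ‖p.2‖ ≤ R' := Measure.quasiMeasurePreserving_snd.ae (ae_norm_le ν)
    have : ∀ᵐ p ∂(μ.prod ν), p ∉ ((fun x : E × E => x.1 + x.2) ⁻¹' (Metric.closedBall 0 (R + R'))ᶜ) := by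
      filter_upwards [h1, h2] with p hp1 hp2
      simp only [Set.mem_preimage, Set.mem_compl_iff, Metric.mem_closedBall, dist_zero_right,
        not_not]
      exact (norm_add_le _ _).trans (add_le_add hp1 hp2)
    exact measure_eq_zero_iff_ae_notMem.2 this

instance isBallProbability_dirac : IsBallProbability (Measure.dirac (0 : E)) 0 where
  toIsProbabilityMeasure := inferInstance
  compl_closedBall := by
    rw [Measure.dirac_apply' _ Metric.isClosed_closedBall.measurableSet.compl]
    simp

theorem avg_conv {f : E → F} (hf : Continuous f) (μ ν : Measure E)
    [hμ : IsBallProbability μ R] [hν : IsBallProbability ν R'] (x : E) :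
    avg (μ.conv ν) f x = avg ν (avg μ f) x := by
  have hint : Integrable (fun p : E × E => f (x + (p.1 + p.2))) (μ.prod ν) := by
    have h := integrable_translate hf (μ.conv ν) x
    rw [Measure.conv] at h
    exact h.comp_measurable (by fun_prop)
  have h := integral_map (μ := μ.prod ν) (φ := fun p : E × E => p.1 + p.2)
    (f := fun h => f (x + h)) (by fun_prop) (by
      rw [← Measure.conv]
      exact (integrable_translate hf (μ.conv ν) x).aestronglyMeasurable)
  simp only [avg]
  rw [Measure.conv, h, integral_prod_symm _ hint]
  refine integral_congr_ae (Filter.Eventually.of_forall fun a => ?_)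
  refine integral_congr_ae (Filter.Eventually.of_forall fun b => ?_)
  simp only
  congr 1
  abel

/-- A weighted energy estimate for one step of a random walk, which replaces the Carleson
embedding theorem for bounded functions. -/
theorem mul_sq_avg_le {b : E → F} {f : E → ℝ} {L : ℝ} (hb : Continuous b)
    (hf : Continuous f) (hL : ∀ x, ‖b x‖ ≤ L) (μ : Measure E) [hμ : IsBallProbability μ R] (x : E) :
    ‖avg μ b x‖ ^ 2 * avg μ f x ^ 2 + 1 / 2 * (oscSq μ b x * avg μ f x ^ 2)
      - 8 * L ^ 2 * oscSq μ f x ≤ avg μ (fun y => ‖b y‖ ^ 2 * f y ^ 2) x := by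
  set β := avg μ b x with hβ
  set φ := avg μ f x with hφ
  have hβL : ‖β‖ ≤ L := norm_avg_le hL μ x
  -- Write `f = φ + δ` and replace `‖b‖²` by `‖β‖²` in the cross term, whose average then vanishes.
  -- With `D = ‖b - β‖` the error is at most `4 L D |φ| |δ|`, hence at most `φ² D² / 2 + 8 L² δ²`.
  have hpt : ∀ h, ‖b (x + h)‖ ^ 2 * φ ^ 2 + 2 * ‖β‖ ^ 2 * φ * (f (x + h) - φ)
      - 1 / 2 * φ ^ 2 * ‖b (x + h) - β‖ ^ 2 - 8 * L ^ 2 * ‖f (x + h) - φ‖ ^ 2 ≤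
      ‖b (x + h)‖ ^ 2 * f (x + h) ^ 2 := by
    intro h
    set B := ‖b (x + h)‖
    set δ := f (x + h) - φ with hδ
    set D := ‖b (x + h) - β‖
    have h1 : |B - ‖β‖| ≤ D := abs_norm_sub_norm_le _ _
    have hB : B ≤ L := hL _
    have hB0 : 0 ≤ B := norm_nonneg _
    have hβ0 : 0 ≤ ‖β‖ := norm_nonneg _
    have hD0 : 0 ≤ D := norm_nonneg _
    have h2 : |B ^ 2 - ‖β‖ ^ 2| ≤ 2 * L * D := by
      have : B ^ 2 - ‖β‖ ^ 2 = (B + ‖β‖) * (B - ‖β‖) := by ring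
      rw [this, abs_mul, abs_of_nonneg (add_nonneg hB0 hβ0)]
      have := abs_nonneg (B - ‖β‖)
      calc (B + ‖β‖) * |B - ‖β‖| ≤ (L + L) * D := by gcongr; linarith
        _ = _ := by ring
    have h3 : |2 * (B ^ 2 - ‖β‖ ^ 2) * (φ * δ)| ≤ 4 * L * D * (|φ| * |δ|) := by
      rw [abs_mul, abs_mul, abs_mul φ, abs_two]
      have := mul_nonneg (abs_nonneg φ) (abs_nonneg δ)
      nlinarith
    have h4 := (abs_le.1 h3).1
    have e : f (x + h) = φ + δ := by rw [hδ]; ring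
    rw [e, Real.norm_eq_abs, sq_abs]
    have h5 : 0 ≤ 1 / 2 * (D * |φ| - 4 * L * |δ|) ^ 2 := by positivity
    have h6 : 1 / 2 * (D * |φ| - 4 * L * |δ|) ^ 2 =
      1 / 2 * φ ^ 2 * D ^ 2 - 4 * L * D * (|φ| * |δ|) + 8 * L ^ 2 * δ ^ 2 := by
      rw [← sq_abs φ, ← sq_abs δ]; ring
    have h7 : 0 ≤ B ^ 2 * δ ^ 2 := by positivity
    nlinarith
  have i1 : Integrable (fun h => ‖b (x + h)‖ ^ 2 * φ ^ 2) μ :=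
    integrable_of_ball (by fun_prop) μ
  have i2 : Integrable (fun h => 2 * ‖β‖ ^ 2 * φ * (f (x + h) - φ)) μ :=
    integrable_of_ball (by fun_prop) μ
  have i3 : Integrable (fun h => 1 / 2 * φ ^ 2 * ‖b (x + h) - β‖ ^ 2) μ :=
    integrable_of_ball (by fun_prop) μ
  have i4 : Integrable (fun h => 8 * L ^ 2 * ‖f (x + h) - φ‖ ^ 2) μ :=
    integrable_of_ball (by fun_prop) μ
  have i5 : Integrable (fun h => ‖b (x + h)‖ ^ 2 * f (x + h) ^ 2) μ :=
    integrable_of_ball (by fun_prop) μ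
  have i12 : Integrable (fun h => ‖b (x + h)‖ ^ 2 * φ ^ 2 +
      2 * ‖β‖ ^ 2 * φ * (f (x + h) - φ)) μ := i1.add i2
  have i123 : Integrable (fun h => ‖b (x + h)‖ ^ 2 * φ ^ 2 +
      2 * ‖β‖ ^ 2 * φ * (f (x + h) - φ) - 1 / 2 * φ ^ 2 * ‖b (x + h) - β‖ ^ 2) μ := i12.sub i3
  have hmono := integral_mono (i123.sub i4) i5 hpt
  simp only [Pi.sub_apply] at hmono
  rw [integral_sub i123 i4, integral_sub i12 i3, integral_add i1 i2,
    integral_const_mul, integral_const_mul, integral_const_mul, integral_mul_const] at hmono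
  have z : ∫ h, (f (x + h) - φ) ∂μ = 0 := by
    rw [integral_sub (integrable_translate hf μ x) (integrable_const _)]
    simp [hφ, avg]
  have o1 : ∫ h, ‖b (x + h) - β‖ ^ 2 ∂μ = oscSq μ b x := rfl
  have o2 : ∫ h, ‖f (x + h) - φ‖ ^ 2 ∂μ = oscSq μ f x := rfl
  -- The mean of `‖b‖²` contains a full `oscSq μ b x`, half of which pays for the error above.
  have o3 : ∫ h, ‖b (x + h)‖ ^ 2 ∂μ = oscSq μ b x + ‖β‖ ^ 2 := by
    rw [oscSq_eq hb μ x, hβ]; simp [avg]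
  rw [z, o1, o2, o3] at hmono
  have e6 : avg μ (fun y => ‖b y‖ ^ 2 * f y ^ 2) x = ∫ h, ‖b (x + h)‖ ^ 2 * f (x + h) ^ 2 ∂μ := rfl
  rw [e6]
  linarith

theorem integrable_mul_of_compact {φ ψ : E → ℝ} (hφ : Continuous φ) (hψ : Continuous ψ)
    (hc : HasCompactSupport ψ) : Integrable (fun x => φ x * ψ x) :=
  (hφ.mul hψ).integrable_of_hasCompactSupport hc.mul_left

theorem HasCompactSupport.sq' {ψ : E → ℝ} (hc : HasCompactSupport ψ) :
    HasCompactSupport (fun x => ψ x ^ 2) :=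
  hc.comp_left (g := fun t : ℝ => t ^ 2) (by norm_num)

theorem integrable_mul_sq {φ ψ : E → ℝ} (hφ : Continuous φ) (hψ : Continuous ψ)
    (hc : HasCompactSupport ψ) : Integrable (fun x => φ x * ψ x ^ 2) :=
  integrable_mul_of_compact hφ (hψ.pow 2) hc.sq'

theorem integrable_sq_of_compact {ψ : E → ℝ} (hψ : Continuous ψ)
    (hc : HasCompactSupport ψ) : Integrable (fun x => ψ x ^ 2) :=
  (hψ.pow 2).integrable_of_hasCompactSupport hc.sq'

theorem integral_oscSq {f : E → ℝ} (hf : Continuous f) (hc : HasCompactSupport f)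
    (μ : Measure E) [hμ : IsBallProbability μ R] :
    Integrable (oscSq μ f) ∧ ∫ x, oscSq μ f x = (∫ x, f x ^ 2) - ∫ x, avg μ f x ^ 2 := by
  have h1 := integral_avg (integrable_sq_of_compact hf hc) μ
  have h2 := integrable_sq_of_compact (continuous_avg hf μ) (hasCompactSupport_avg hc μ)
  have e : ∀ x, oscSq μ f x = avg μ (fun y => f y ^ 2) x - avg μ f x ^ 2 := fun x => by
    have := oscSq_eq hf μ x
    simpa only [Real.norm_eq_abs, sq_abs] using this
  simp_rw [funext e]
  exact ⟨h1.1.sub h2, by rw [integral_sub h1.1 h2, h1.2]⟩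

/-- The integrated form of `mul_sq_avg_le`. -/
theorem integral_oscSq_mul_le {b : E → F} {f : E → ℝ} {L : ℝ}
    (hb : Continuous b) (hf : Continuous f) (hc : HasCompactSupport f) (hL : ∀ x, ‖b x‖ ≤ L)
    (μ : Measure E) [hμ : IsBallProbability μ R] :
    ∫ x, oscSq μ b x * avg μ f x ^ 2 ≤
      2 * ((∫ x, ‖b x‖ ^ 2 * f x ^ 2) - ∫ x, ‖avg μ b x‖ ^ 2 * avg μ f x ^ 2) +
        16 * L ^ 2 * ((∫ x, f x ^ 2) - ∫ x, avg μ f x ^ 2) := by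
  have hA := continuous_avg hf μ
  have hAc := hasCompactSupport_avg hc μ
  have i1 : Integrable (fun x => ‖avg μ b x‖ ^ 2 * avg μ f x ^ 2) :=
    integrable_mul_sq ((continuous_avg hb μ).norm.pow 2) hA hAc
  have i2 : Integrable (fun x => 1 / 2 * (oscSq μ b x * avg μ f x ^ 2)) :=
    (integrable_mul_sq (continuous_oscSq hb μ) hA hAc).const_mul _
  obtain ⟨i3, e3⟩ := integral_oscSq hf hc μ
  have i4 : Integrable (fun x => ‖b x‖ ^ 2 * f x ^ 2) := integrable_mul_sq (by fun_prop) hf hc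
  obtain ⟨i5, e5⟩ := integral_avg i4 μ
  have i12 : Integrable (fun x => ‖avg μ b x‖ ^ 2 * avg μ f x ^ 2 +
      1 / 2 * (oscSq μ b x * avg μ f x ^ 2)) := i1.add i2
  have hmono := integral_mono (i12.sub (i3.const_mul (8 * L ^ 2))) i5 (mul_sq_avg_le hb hf hL μ)
  simp only [Pi.sub_apply] at hmono
  rw [integral_sub i12 (i3.const_mul _), integral_add i1 i2, integral_const_mul,
    integral_const_mul, e3, e5] at hmono
  linarith

end Averages

/-! ### A random walk with steps of geometrically growing size -/

section Walk

variable {E : Type*} [NormedAddCommGroup E] [InnerProductSpace ℝ E] [FiniteDimensional ℝ E]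
  [MeasurableSpace E] [BorelSpace E]
variable {F : Type*} [NormedAddCommGroup F] [InnerProductSpace ℝ F] [CompleteSpace F]

variable (E) in
/-- The uniform probability measure on the closed ball of radius `r`. -/
def ballMeasure (r : ℝ) : Measure E := ProbabilityTheory.cond volume (Metric.closedBall 0 r)

theorem volume_real_closedBall_pos (x : E) {r : ℝ} (hr : 0 < r) :
    0 < volume.real (Metric.closedBall x r) :=
  ENNReal.toReal_pos (Metric.measure_closedBall_pos volume x hr).ne' measure_closedBall_lt_top.ne

instance isBallProbability_ballMeasure {r : ℝ} [hr : Fact (0 < r)] :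
    IsBallProbability (ballMeasure E r) r where
  toIsProbabilityMeasure := ProbabilityTheory.cond_isProbabilityMeasure_of_finite
    (Metric.measure_closedBall_pos volume 0 hr.out).ne' measure_closedBall_lt_top.ne
  compl_closedBall := by
    rw [ballMeasure, ProbabilityTheory.cond_apply Metric.isClosed_closedBall.measurableSet]
    simp

theorem avg_ballMeasure_eq (f : E → ℝ) (r : ℝ) (x : E) :
    avg (ballMeasure E r) f x =
      (volume.real (Metric.closedBall (0 : E) r))⁻¹ * ∫ y in Metric.closedBall x r, f y := by
  have h : ∫ h in Metric.closedBall (0 : E) r, f (x + h) = ∫ y in Metric.closedBall x r, f y := by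
    have := (measurePreserving_add_left (volume : Measure E) x).setIntegral_preimage_emb
      (measurableEmbedding_addLeft x) f (Metric.closedBall x r)
    rw [← this]
    congr 2
    ext u
    simp
  rw [avg, ballMeasure, ProbabilityTheory.cond, integral_smul_measure, h, smul_eq_mul]
  simp [Measure.real]

/-- A translate of the ball of radius `S` by a vector of norm at most `R` still contains the ball of
radius `S - R` around `x`; this is averaged over the translations. -/
theorem setIntegral_le_setIntegral_avg {f : E → ℝ} (hf : Continuous f) (hf0 : ∀ x, 0 ≤ f x)
    (μ : Measure E) {R : ℝ} [hμ : IsBallProbability μ R] (x : E) (S : ℝ) :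
    ∫ y in Metric.closedBall x (S - R), f y ≤ ∫ y in Metric.closedBall x S, avg μ f y := by
  have hint : Integrable (fun p : E × E => f (p.1 + p.2))
      ((volume.restrict (Metric.closedBall x S)).prod μ) := by
    rw [← restrict_closedBall_eq μ, Measure.prod_restrict]
    exact (Continuous.continuousOn (by fun_prop)).integrableOn_compact
      ((isCompact_closedBall x S).prod (isCompact_closedBall 0 R))
  simp only [avg]
  rw [integral_integral_swap hint]
  have h1 : ∀ᵐ h ∂μ, ∫ y in Metric.closedBall x (S - R), f y ≤
      ∫ y in Metric.closedBall x S, f (y + h) := by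
    filter_upwards [ae_norm_le μ] with h hh
    have := (measurePreserving_add_right (volume : Measure E) h).setIntegral_preimage_emb
      (measurableEmbedding_addRight h) f (Metric.closedBall (x + h) S)
    have e : (fun y => y + h) ⁻¹' Metric.closedBall (x + h) S = Metric.closedBall x S := by
      ext u; simp
    rw [e] at this
    rw [this]
    refine setIntegral_mono_set (hf.continuousOn.integrableOn_compact (isCompact_closedBall _ _))
      (Filter.Eventually.of_forall fun y => hf0 y) (LE.le.eventuallyLE ?_)
    refine Metric.closedBall_subset_closedBall' ?_
    simp only [dist_self_add_right]
    linarith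
  have h2 := integral_mono_ae (integrable_const _) hint.integral_prod_right h1
  simpa using h2

/-- The radii `ρ 4ᵏ`. -/
def scale (ρ : ℝ) (k : ℕ) : ℝ := ρ * 4 ^ k

theorem scale_succ (ρ : ℝ) (k : ℕ) : scale ρ (k + 1) = 4 * scale ρ k := by
  rw [scale, scale, pow_succ]; ring

variable (ρ : ℝ) [hρ : Fact (0 < ρ)]

theorem scale_pos (k : ℕ) : 0 < scale ρ k := by
  have := hρ.out
  unfold scale; positivity

instance fact_scale_pos (k : ℕ) : Fact (0 < scale ρ k) := ⟨scale_pos ρ k⟩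

variable (E) in
/-- The law at time `k` of the random walk whose steps are uniform in the balls of radii
`scale ρ 0`, `scale ρ 1`, ... -/
def walk : ℕ → Measure E
  | 0 => Measure.dirac 0
  | k + 1 => (walk k).conv (ballMeasure E (scale ρ k))

/-- The maximal distance travelled by `walk`. -/
def walkRadius : ℕ → ℝ
  | 0 => 0
  | k + 1 => walkRadius k + scale ρ k

/-- A geometric series: the whole past of the walk covers at most a third of the radius of the next
step. -/
theorem walkRadius_le (k : ℕ) : walkRadius ρ k ≤ scale ρ k / 3 := by
  induction k with
  | zero => have := scale_pos ρ 0; simp only [walkRadius]; linarith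
  | succ k ih => rw [scale_succ, walkRadius]; linarith

instance isBallProbability_walk (k : ℕ) : IsBallProbability (walk E ρ k) (walkRadius ρ k) := by
  induction k with
  | zero => exact isBallProbability_dirac
  | succ k ih => exact isBallProbability_conv

variable (E) in
/-- The law of three consecutive steps of the random walk. -/
def stepLaw (k : ℕ) : Measure E :=
  ((ballMeasure E (scale ρ k)).conv (ballMeasure E (scale ρ (k + 1)))).conv
    (ballMeasure E (scale ρ (k + 2)))

instance isBallProbability_stepLaw (k : ℕ) :
    IsBallProbability (stepLaw E ρ k) (scale ρ k + scale ρ (k + 1) + scale ρ (k + 2)) :=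
  isBallProbability_conv

/-- The average of `f` along the random walk up to time `k`. -/
def smooth (k : ℕ) (f : E → F) : E → F := avg (walk E ρ k) f

theorem continuous_smooth {f : E → F} (hf : Continuous f) (k : ℕ) : Continuous (smooth ρ k f) :=
  continuous_avg hf _

theorem smooth_succ {f : E → F} (hf : Continuous f) (k : ℕ) :
    smooth ρ (k + 1) f = avg (ballMeasure E (scale ρ k)) (smooth ρ k f) :=
  funext fun x => avg_conv hf _ _ x

theorem smooth_add_three {f : E → F} (hf : Continuous f) (k : ℕ) :
    smooth ρ (k + 3) f = avg (stepLaw E ρ k) (smooth ρ k f) := by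
  have hk := continuous_smooth ρ hf k
  rw [smooth_succ ρ hf, smooth_succ ρ hf, smooth_succ ρ hf, stepLaw]
  ext x
  rw [avg_conv hk, ← funext (avg_conv hk (ballMeasure E (scale ρ k)) _)]

theorem norm_smooth_le {f : E → F} {L : ℝ} (hf : ∀ x, ‖f x‖ ≤ L) (k : ℕ) (x : E) :
    ‖smooth ρ k f x‖ ≤ L := norm_avg_le hf _ x

theorem smooth_nonneg {f : E → ℝ} (hf : ∀ x, 0 ≤ f x) (k : ℕ) (x : E) : 0 ≤ smooth ρ k f x :=
  avg_nonneg hf _ x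

theorem hasCompactSupport_smooth {f : E → F} (hf : HasCompactSupport f) (k : ℕ) :
    HasCompactSupport (smooth ρ k f) := hasCompactSupport_avg hf _

theorem volume_real_closedBall_mul (x : E) {c r : ℝ} (hc : 0 ≤ c) (hr : 0 ≤ r) :
    volume.real (Metric.closedBall x (c * r)) =
      c ^ Module.finrank ℝ E * volume.real (Metric.closedBall (0 : E) r) := by
  rw [Measure.real, Measure.addHaar_closedBall_mul _ _ hc hr, ENNReal.toReal_mul,
    ENNReal.toReal_ofReal (by positivity), Measure.real]

/-- Three steps of the walk dominate the uniform average over any ball nearby. -/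
theorem avg_ballMeasure_le_avg_stepLaw {f : E → ℝ} (hf : Continuous f) (hf0 : ∀ x, 0 ≤ f x)
    (k : ℕ) {x y : E} (hxy : ‖y - x‖ ≤ 10 * scale ρ k) :
    avg (ballMeasure E (scale ρ k)) f y ≤
      16 ^ Module.finrank ℝ E * avg (stepLaw E ρ k) f x := by
  have hr := scale_pos ρ k
  set r := scale ρ k with hrdef
  have h1 : scale ρ (k + 1) = 4 * r := scale_succ ρ k
  have h2 : scale ρ (k + 2) = 16 * r := by rw [scale_succ, h1]; ring
  rw [stepLaw, avg_conv hf, avg_ballMeasure_eq, avg_ballMeasure_eq, h2,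
    volume_real_closedBall_mul 0 (by norm_num) hr.le, mul_inv, ← mul_assoc, ← mul_assoc,
    mul_inv_cancel₀ (by positivity), one_mul]
  have hv : 0 < volume.real (Metric.closedBall (0 : E) r) := volume_real_closedBall_pos 0 hr
  refine mul_le_mul_of_nonneg_left ?_ (by positivity)
  -- The last ball has radius `16 r` and the first two steps move by at most `r + 4 r`. The
  -- remaining `11 r = 10 r + r` is just enough to contain the ball of radius `r` around `y`.
  refine le_trans ?_ (setIntegral_le_setIntegral_avg hf hf0 _ x (16 * r))
  refine setIntegral_mono_set (hf.continuousOn.integrableOn_compact (isCompact_closedBall _ _))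
    (Filter.Eventually.of_forall fun y => hf0 y) (LE.le.eventuallyLE ?_)
  refine Metric.closedBall_subset_closedBall' ?_
  rw [dist_eq_norm, h1, ← hrdef]
  linarith

/-- The root mean square oscillation of `smooth ρ k f` over three steps of the walk. -/
def osc (k : ℕ) (f : E → F) (x : E) : ℝ := √(oscSq (stepLaw E ρ k) (smooth ρ k f) x)

theorem osc_nonneg (k : ℕ) (f : E → F) (x : E) : 0 ≤ osc ρ k f x := Real.sqrt_nonneg _

theorem sq_osc (k : ℕ) (f : E → F) (x : E) :
    osc ρ k f x ^ 2 = oscSq (stepLaw E ρ k) (smooth ρ k f) x := Real.sq_sqrt (oscSq_nonneg _ _ _)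

theorem continuous_osc {f : E → F} (hf : Continuous f) (k : ℕ) : Continuous (osc ρ k f) :=
  (continuous_oscSq (continuous_smooth ρ hf k) _).sqrt

theorem osc_le {f : E → F} {L : ℝ} (hf : Continuous f) (hL : ∀ x, ‖f x‖ ≤ L) (k : ℕ) (x : E) :
    osc ρ k f x ≤ L := by
  have hL0 : 0 ≤ L := (norm_nonneg _).trans (hL 0)
  rw [osc, Real.sqrt_le_left hL0, oscSq_eq (continuous_smooth ρ hf k)]
  have h1 : avg (stepLaw E ρ k) (fun y => ‖smooth ρ k f y‖ ^ 2) x ≤ L ^ 2 := by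
    refine (le_abs_self _).trans (norm_avg_le (f := fun y => ‖smooth ρ k f y‖ ^ 2) (fun y => ?_) _ x)
    rw [Real.norm_of_nonneg (sq_nonneg _)]
    have := norm_smooth_le ρ hL k y
    gcongr
  nlinarith [sq_nonneg ‖avg (stepLaw E ρ k) (smooth ρ k f) x‖]

/-- Jensen's inequality, then domination of the nearby ball by three steps of the walk, applied to
`‖smooth ρ k f - c‖²` with `c = smooth ρ (k + 3) f x`. The square root turns `16 ^ d` into `4 ^ d`.
-/
theorem norm_smooth_succ_sub_le {f : E → F} (hf : Continuous f) (k : ℕ) {x y : E}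
    (hxy : ‖y - x‖ ≤ 10 * scale ρ k) :
    ‖smooth ρ (k + 1) f y - smooth ρ (k + 3) f x‖ ≤ 4 ^ Module.finrank ℝ E * osc ρ k f x := by
  have hk := continuous_smooth ρ hf k
  refine abs_le_of_sq_le_sq' ?_ (mul_nonneg (by positivity) (osc_nonneg ρ k f x)) |>.2
  rw [smooth_succ ρ hf, mul_pow, sq_osc, ← pow_mul, mul_comm _ 2, pow_mul]
  refine (norm_avg_sub_sq_le hk _ y _).trans ?_
  have := avg_ballMeasure_le_avg_stepLaw ρ (f := fun z => ‖smooth ρ k f z - smooth ρ (k + 3) f x‖ ^ 2)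
    (by fun_prop) (fun _ => sq_nonneg _) k hxy
  refine this.trans (le_of_eq ?_)
  rw [smooth_add_three ρ hf]
  norm_num [oscSq, avg]

theorem norm_smooth_add_two_sub_le {f : E → F} (hf : Continuous f) (k : ℕ) (x : E) :
    ‖smooth ρ (k + 2) f x - smooth ρ (k + 3) f x‖ ≤ 4 ^ Module.finrank ℝ E * osc ρ k f x := by
  rw [smooth_succ ρ hf (k + 1)]
  refine norm_avg_sub_le (continuous_smooth ρ hf _) _ fun y hy => ?_
  refine norm_smooth_succ_sub_le ρ hf k (hy.trans ?_)
  rw [scale_succ]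
  linarith [scale_pos ρ k]

/-- A Harnack-type inequality: two further steps of the walk compensate for moving the base point.
-/
theorem smooth_succ_le_smooth {g : E → ℝ} (hg : Continuous g) (hg0 : ∀ x, 0 ≤ g x) (k : ℕ)
    {x y : E} (hxy : ‖y - x‖ ≤ 10 * scale ρ k) :
    smooth ρ (k + 1) g y ≤ 16 ^ Module.finrank ℝ E * smooth ρ (k + 3) g x := by
  rw [smooth_succ ρ hg, smooth_add_three ρ hg]
  exact avg_ballMeasure_le_avg_stepLaw ρ (continuous_smooth ρ hg k) (smooth_nonneg ρ hg0 k) k hxy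

/-- During its first `k` steps the walk moves by at most a third of `scale ρ k`, so the next step,
uniform in the ball of that radius, accounts for all the mass of the half ball. The support of
`bump` is fitted to this half ball. -/
theorem setIntegral_closedBall_le_smooth {g : E → ℝ} (hg : Continuous g) (hg0 : ∀ x, 0 ≤ g x)
    (k : ℕ) (x : E) :
    ∫ y in Metric.closedBall x (scale ρ k / 2), g y ≤
      volume.real (Metric.closedBall (0 : E) (scale ρ k)) * smooth ρ (k + 1) g x := by
  have hv : 0 < volume.real (Metric.closedBall (0 : E) (scale ρ k)) :=
    volume_real_closedBall_pos 0 (scale_pos ρ k)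
  rw [smooth_succ ρ hg, avg_ballMeasure_eq, mul_inv_cancel_left₀ hv.ne']
  refine le_trans ?_ (setIntegral_le_setIntegral_avg hg hg0 (walk E ρ k) x (scale ρ k))
  refine setIntegral_mono_set (hg.continuousOn.integrableOn_compact (isCompact_closedBall _ _))
    (Filter.Eventually.of_forall fun y => hg0 y) (LE.le.eventuallyLE ?_)
  refine Metric.closedBall_subset_closedBall ?_
  have := walkRadius_le ρ k
  linarith [scale_pos ρ k]

end Walk

/-! ### Square functions along the walk and Taylor expansion of averages -/

section Geometric

variable {E : Type*} [NormedAddCommGroup E] [InnerProductSpace ℝ E] [FiniteDimensional ℝ E]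
  [MeasurableSpace E] [BorelSpace E]
variable {F : Type*} [NormedAddCommGroup F] [InnerProductSpace ℝ F] [CompleteSpace F]

/-- A continuous nonnegative function of compact support. -/
structure IsTestFunction (g : E → ℝ) : Prop where
  continuous : Continuous g
  hasCompactSupport : HasCompactSupport g
  nonneg : ∀ x, 0 ≤ g x

/-- `A` is continuously differentiable with gradient `a`, bounded by `L`. -/
structure HasBoundedGradient (A : E → ℝ) (a : E → E) (L : ℝ) : Prop where
  continuous : Continuous a
  norm_le : ∀ x, ‖a x‖ ≤ L
  hasFDerivAt : ∀ x, HasFDerivAt A (innerSL ℝ (a x)) x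

/-- Telescoping with gap three, the number of steps grouped in `stepLaw`. -/
theorem sum_range_sub_add_three_le {s : ℕ → ℝ} {c : ℝ} (h0 : ∀ k, 0 ≤ s k) (hc : ∀ k, s k ≤ c)
    (N : ℕ) : ∑ k ∈ Finset.range N, (s k - s (k + 3)) ≤ 3 * c := by
  have key : ∑ k ∈ Finset.range N, (s k - s (k + 3)) =
      s 0 + s 1 + s 2 - (s N + s (N + 1) + s (N + 2)) := by
    induction N with
    | zero => simp
    | succ N ih => rw [Finset.sum_range_succ, ih]; ring
  rw [key]
  linarith [h0 N, h0 (N + 1), h0 (N + 2), hc 0, hc 1, hc 2]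

/-- For quantities passed on from fine to coarse scales; the boundary term sits at the finest scale,
and `4 / 3` is the sum of the geometric series of ratio `1 / 4`. -/
theorem sum_le_of_forward_recursion {Y Z : ℕ → ℝ} (hY : ∀ k, 0 ≤ Y k)
    (h : ∀ k, Y (k + 1) ≤ 1 / 4 * Y k + Z k) (N : ℕ) :
    ∑ k ∈ Finset.range N, Y k ≤ 4 / 3 * (Y 0 + ∑ k ∈ Finset.range N, Z k) := by
  have key : ∑ k ∈ Finset.range N, Y k + 4 / 3 * Y N ≤
      4 / 3 * (Y 0 + ∑ k ∈ Finset.range N, Z k) := by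
    induction N with
    | zero => simp
    | succ N ih => rw [Finset.sum_range_succ, Finset.sum_range_succ]; linarith [h N]
  linarith [hY N]

/-- For tails, which are controlled by the next coarser scale; the boundary term sits at the
coarsest scale. -/
theorem sum_le_of_backward_recursion {X Z : ℕ → ℝ} (hX : ∀ k, 0 ≤ X k)
    (h : ∀ k, X k ≤ 1 / 4 * X (k + 1) + Z k) (N : ℕ) :
    ∑ k ∈ Finset.range N, X k ≤ 4 / 3 * (X N + ∑ k ∈ Finset.range N, Z k) := by
  have h1 : ∑ k ∈ Finset.range N, X k ≤
      1 / 4 * ∑ k ∈ Finset.range N, X (k + 1) + ∑ k ∈ Finset.range N, Z k := by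
    rw [Finset.mul_sum, ← Finset.sum_add_distrib]
    exact Finset.sum_le_sum fun k _ => h k
  have h2 := Finset.sum_range_succ X N
  rw [Finset.sum_range_succ'] at h2
  linarith [hX 0, hX N]

variable (ρ : ℝ) [hρ : Fact (0 < ρ)] {g : E → ℝ} {A : E → ℝ} {a : E → E} {L : ℝ}

theorem IsTestFunction.smoothed (hg : IsTestFunction g) (k : ℕ) : IsTestFunction (smooth ρ k g) where
  continuous := continuous_smooth ρ hg.continuous k
  hasCompactSupport := hasCompactSupport_smooth ρ hg.hasCompactSupport k
  nonneg := smooth_nonneg ρ hg.nonneg k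

theorem IsTestFunction.integrable_mul_sq (hg : IsTestFunction g) {φ : E → ℝ} (hφ : Continuous φ) :
    Integrable (fun x => φ x * g x ^ 2) :=
  _root_.integrable_mul_sq hφ hg.continuous hg.hasCompactSupport

theorem IsTestFunction.integrable_sq (hg : IsTestFunction g) : Integrable (fun x => g x ^ 2) :=
  integrable_sq_of_compact hg.continuous hg.hasCompactSupport

theorem IsTestFunction.integral_smooth_sq_le (hg : IsTestFunction g) (k : ℕ) :
    ∫ x, smooth ρ k g x ^ 2 ≤ ∫ x, g x ^ 2 := by
  obtain ⟨h1, h2⟩ := integral_avg hg.integrable_sq (walk E ρ k)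
  rw [← h2]
  exact integral_mono (hg.smoothed ρ k).integrable_sq h1 fun x => sq_avg_le hg.continuous _ x

theorem IsTestFunction.integral_mul_smooth_sq_le (hg : IsTestFunction g) (k : ℕ) {φ : E → ℝ}
    (hφ : Continuous φ) {c : ℝ} (hφc : ∀ x, φ x ≤ c) (hc : 0 ≤ c) :
    ∫ x, φ x * smooth ρ k g x ^ 2 ≤ c * ∫ x, g x ^ 2 := by
  calc _ ≤ ∫ x, c * smooth ρ k g x ^ 2 :=
        integral_mono ((hg.smoothed ρ k).integrable_mul_sq hφ)
          ((hg.smoothed ρ k).integrable_sq.const_mul c) fun x => by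
            have := hφc x
            simp only
            gcongr
    _ ≤ _ := by
        rw [integral_const_mul]
        have := hg.integral_smooth_sq_le ρ k
        gcongr

/-- The weighted square function of a bounded function. -/
theorem IsTestFunction.sum_integral_osc_sq_mul_le (hg : IsTestFunction g) {b : E → F} {L : ℝ}
    (hb : Continuous b) (hL : ∀ x, ‖b x‖ ≤ L) (N : ℕ) :
    ∑ k ∈ Finset.range N, ∫ x, osc ρ k b x ^ 2 * smooth ρ (k + 3) g x ^ 2 ≤
      54 * L ^ 2 * ∫ x, g x ^ 2 := by
  set s : ℕ → ℝ := fun k => ∫ x, ‖smooth ρ k b x‖ ^ 2 * smooth ρ k g x ^ 2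
  set t : ℕ → ℝ := fun k => ∫ x, smooth ρ k g x ^ 2
  have h1 : ∀ k, ∫ x, osc ρ k b x ^ 2 * smooth ρ (k + 3) g x ^ 2 ≤
      2 * (s k - s (k + 3)) + 16 * L ^ 2 * (t k - t (k + 3)) := by
    intro k
    have := integral_oscSq_mul_le (continuous_smooth ρ hb k) (hg.smoothed ρ k).continuous
      (hg.smoothed ρ k).hasCompactSupport (norm_smooth_le ρ hL k) (stepLaw E ρ k)
    rw [← smooth_add_three ρ hb, ← smooth_add_three ρ hg.continuous] at this
    simp_rw [sq_osc]
    exact this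
  -- Both differences telescope, with total constant `2 · 3 + 16 · 3 = 54`.
  refine (Finset.sum_le_sum fun k _ => h1 k).trans ?_
  rw [Finset.sum_add_distrib, ← Finset.mul_sum, ← Finset.mul_sum]
  have h2 : ∑ k ∈ Finset.range N, (s k - s (k + 3)) ≤ 3 * (L ^ 2 * ∫ x, g x ^ 2) := by
    refine sum_range_sub_add_three_le (fun k => integral_nonneg fun x => by positivity)
      (fun k => ?_) N
    refine hg.integral_mul_smooth_sq_le ρ k ((continuous_smooth ρ hb k).norm.pow 2) (fun x => ?_)
      (sq_nonneg L)
    exact pow_le_pow_left₀ (norm_nonneg _) (norm_smooth_le ρ hL k x) 2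
  have h3 : ∑ k ∈ Finset.range N, (t k - t (k + 3)) ≤ 3 * ∫ x, g x ^ 2 :=
    sum_range_sub_add_three_le (fun k => integral_nonneg fun x => sq_nonneg _)
      (fun k => hg.integral_smooth_sq_le ρ k) N
  have h4 := mul_le_mul_of_nonneg_left h3 (by positivity : 0 ≤ 16 * L ^ 2)
  linarith

theorem IsTestFunction.integrable_osc_sq (hg : IsTestFunction g) (k : ℕ) :
    Integrable (fun x => osc ρ k g x ^ 2) := by
  simp_rw [sq_osc]
  exact (integral_oscSq (hg.smoothed ρ k).continuous (hg.smoothed ρ k).hasCompactSupport _).1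

/-- Without a weight, the integrated variance identity is an equality and telescopes directly. -/
theorem IsTestFunction.sum_integral_osc_sq_le (hg : IsTestFunction g) (N : ℕ) :
    ∑ k ∈ Finset.range N, ∫ x, osc ρ k g x ^ 2 ≤ 3 * ∫ x, g x ^ 2 := by
  have h1 : ∀ k, ∫ x, osc ρ k g x ^ 2 =
      (∫ x, smooth ρ k g x ^ 2) - ∫ x, smooth ρ (k + 3) g x ^ 2 := by
    intro k
    have := (integral_oscSq (hg.smoothed ρ k).continuous (hg.smoothed ρ k).hasCompactSupport
      (stepLaw E ρ k)).2
    rw [← smooth_add_three ρ hg.continuous] at this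
    simp_rw [sq_osc]
    exact this
  simp_rw [h1]
  exact sum_range_sub_add_three_le (fun k => integral_nonneg fun x => sq_nonneg _)
      (fun k => hg.integral_smooth_sq_le ρ k) N

/-- The increment of the smoothed weight. -/
def increment (g : E → ℝ) (k : ℕ) (x : E) : ℝ := smooth ρ (k + 3) g x - smooth ρ (k + 4) g x

theorem IsTestFunction.continuous_increment (hg : IsTestFunction g) (k : ℕ) :
    Continuous (increment ρ g k) :=
  (hg.smoothed ρ _).continuous.sub (hg.smoothed ρ _).continuous

theorem IsTestFunction.hasCompactSupport_increment (hg : IsTestFunction g) (k : ℕ) :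
    HasCompactSupport (increment ρ g k) :=
  (hg.smoothed ρ _).hasCompactSupport.sub (hg.smoothed ρ _).hasCompactSupport

/-- An increment is at most `4 ^ d` times the oscillation of `g` at scale `k + 1`. These sums pay
for every change of the weight from one scale to a neighbouring one. -/
theorem IsTestFunction.sum_integral_increment_sq_le (hg : IsTestFunction g) (N : ℕ) :
    ∑ k ∈ Finset.range N, ∫ x, increment ρ g k x ^ 2 ≤
      3 * 16 ^ Module.finrank ℝ E * ∫ x, g x ^ 2 := by
  have h1 : ∀ k, ∫ x, increment ρ g k x ^ 2 ≤
      16 ^ Module.finrank ℝ E * ∫ x, osc ρ (k + 1) g x ^ 2 := by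
    intro k
    rw [← integral_const_mul]
    refine integral_mono (integrable_sq_of_compact (hg.continuous_increment ρ k)
      (hg.hasCompactSupport_increment ρ k)) ((hg.integrable_osc_sq ρ _).const_mul _) fun x => ?_
    have h := norm_smooth_add_two_sub_le ρ hg.continuous (k + 1) x
    have e : (16 : ℝ) ^ Module.finrank ℝ E = (4 ^ Module.finrank ℝ E) ^ 2 := by
      rw [← pow_mul, mul_comm, pow_mul]; norm_num
    simp only
    rw [e, ← mul_pow, ← sq_abs, increment]
    have h' : |smooth ρ (k + 3) g x - smooth ρ (k + 4) g x| ≤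
      4 ^ Module.finrank ℝ E * osc ρ (k + 1) g x := h
    gcongr
  refine (Finset.sum_le_sum fun k _ => h1 k).trans ?_
  rw [← Finset.mul_sum]
  have h2 := hg.sum_integral_osc_sq_le ρ (N + 1)
  rw [Finset.sum_range_succ'] at h2
  have h3 : 0 ≤ ∫ x, osc ρ 0 g x ^ 2 := integral_nonneg fun x => sq_nonneg _
  have h4 : ∑ k ∈ Finset.range N, ∫ x, osc ρ (k + 1) g x ^ 2 ≤ 3 * ∫ x, g x ^ 2 := by linarith
  have := mul_le_mul_of_nonneg_left h4 (by positivity : (0 : ℝ) ≤ 16 ^ Module.finrank ℝ E)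
  linarith

/-! ### Approximation of a Lipschitz function by its averages -/

theorem HasBoundedGradient.continuous_fun (hA : HasBoundedGradient A a L) : Continuous A :=
  continuous_iff_continuousAt.2 fun x => (hA.hasFDerivAt x).continuousAt

theorem HasBoundedGradient.nonneg (hA : HasBoundedGradient A a L) : 0 ≤ L :=
  (norm_nonneg _).trans (hA.norm_le 0)

theorem HasBoundedGradient.abs_sub_le_mul (hA : HasBoundedGradient A a L) (x y : E) :
    |A y - A x| ≤ L * ‖y - x‖ :=
  Convex.norm_image_sub_le_of_norm_hasFDerivWithin_le (s := Set.univ) (f := A)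
    (f' := fun x => innerSL ℝ (a x)) (fun x _ => (hA.hasFDerivAt x).hasFDerivWithinAt)
    (fun x _ => by rw [innerSL_apply_norm]; exact hA.norm_le x) convex_univ trivial trivial

theorem HasBoundedGradient.averaged (hA : HasBoundedGradient A a L) (μ : Measure E) {R : ℝ}
    [hμ : IsBallProbability μ R] : HasBoundedGradient (avg μ A) (avg μ a) L where
  continuous := continuous_avg hA.continuous μ
  norm_le := norm_avg_le hA.norm_le μ
  hasFDerivAt x := by
    have hAc := hA.continuous_fun
    have hac := hA.continuous
    have h := hasFDerivAt_integral_of_dominated_of_fderiv_le (𝕜 := ℝ) (μ := μ)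
      (F := fun x h => A (x + h)) (F' := fun x h => innerSL ℝ (a (x + h))) (x₀ := x)
      (bound := fun _ => L) (s := Set.univ) Filter.univ_mem
      (Filter.Eventually.of_forall fun y =>
        (integrable_translate hAc μ y).aestronglyMeasurable)
      (integrable_translate hAc μ x)
      (integrable_of_ball ((innerSL ℝ).continuous.comp (by fun_prop)) μ).aestronglyMeasurable
      (Filter.Eventually.of_forall fun h y _ => by
        rw [innerSL_apply_norm]; exact hA.norm_le _)
      (integrable_const _)
      (Filter.Eventually.of_forall fun h y _ => by
        exact (hasFDerivAt_comp_add_right h).2 (hA.hasFDerivAt (y + h)))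
    have e : ∫ h, innerSL ℝ (a (x + h)) ∂μ = innerSL ℝ (avg μ a x) :=
      (innerSL ℝ).integral_comp_comm (integrable_translate hac μ x)
    rw [e] at h
    exact h

theorem HasBoundedGradient.smoothed (hA : HasBoundedGradient A a L) (k : ℕ) :
    HasBoundedGradient (smooth ρ k A) (smooth ρ k a) L := hA.averaged _

/-- Mean value inequality on the ball of radius `10 * scale ρ k`, where the gradient `smooth ρ (k +
1) a` differs from `smooth ρ (k + 3) a x` by at most `4 ^ d` times the oscillation at `x`. -/
theorem HasBoundedGradient.taylor (hA : HasBoundedGradient A a L) (k : ℕ) {x y : E}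
    (hxy : ‖y - x‖ ≤ 10 * scale ρ k) :
    |smooth ρ (k + 1) A y - smooth ρ (k + 1) A x
        - inner ℝ (smooth ρ (k + 3) a x) (y - x)| ≤
      4 ^ Module.finrank ℝ E * osc ρ k a x * ‖y - x‖ := by
  have h := Convex.norm_image_sub_le_of_norm_hasFDerivWithin_le'
    (s := Metric.closedBall x (10 * scale ρ k)) (f := smooth ρ (k + 1) A)
    (f' := fun z => innerSL ℝ (smooth ρ (k + 1) a z))
    (φ := innerSL ℝ (smooth ρ (k + 3) a x))
    (C := 4 ^ Module.finrank ℝ E * osc ρ k a x) (x := x) (y := y)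
    (fun z _ => ((hA.smoothed ρ (k + 1)).hasFDerivAt z).hasFDerivWithinAt)
    (fun z hz => by
      rw [← map_sub, innerSL_apply_norm]
      exact norm_smooth_succ_sub_le ρ hA.continuous k (by simpa [dist_eq_norm] using hz))
    (convex_closedBall _ _) (Metric.mem_closedBall_self (by have := scale_pos ρ k; positivity))
    (by simpa [dist_eq_norm] using hxy)
  simpa using h

theorem avg_ballMeasure_inner (r : ℝ) (c : E) : ∫ h, (inner ℝ c h : ℝ) ∂(ballMeasure E r) = 0 := by
  rw [ballMeasure, ProbabilityTheory.cond, integral_smul_measure]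
  have := (Measure.measurePreserving_neg (volume : Measure E)).setIntegral_preimage_emb
    (MeasurableEquiv.neg E).measurableEmbedding (fun h => (inner ℝ c h : ℝ))
    (Metric.closedBall 0 r)
  have e : Neg.neg ⁻¹' Metric.closedBall (0 : E) r = Metric.closedBall 0 r := by ext; simp
  rw [e] at this
  simp only [inner_neg_right, integral_neg] at this
  have h0 : ∫ h in Metric.closedBall (0 : E) r, (inner ℝ c h : ℝ) = 0 := by linarith
  rw [h0, smul_zero]

/-- The next step averages over a centred ball of radius `4 * scale ρ k`, which kills the linear
term of the Taylor expansion and leaves its remainder. -/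
theorem HasBoundedGradient.abs_smooth_add_two_sub_le (hA : HasBoundedGradient A a L) (k : ℕ)
    (x : E) : |smooth ρ (k + 2) A x - smooth ρ (k + 1) A x| ≤
      4 ^ Module.finrank ℝ E * osc ρ k a x * (4 * scale ρ k) := by
  have hAc := continuous_smooth ρ hA.continuous_fun (k + 1)
  set c := smooth ρ (k + 3) a x
  set ν := ballMeasure E (scale ρ (k + 1))
  have i1 : Integrable (fun h => smooth ρ (k + 1) A (x + h)) ν :=
    integrable_translate hAc ν x
  have i2 : Integrable (fun h => (inner ℝ c h : ℝ)) ν := integrable_of_ball (by fun_prop) ν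
  have i3 : Integrable (fun h => smooth ρ (k + 1) A (x + h) -
    smooth ρ (k + 1) A x) ν := i1.sub (integrable_const _)
  have e : smooth ρ (k + 2) A x - smooth ρ (k + 1) A x =
      ∫ h, (smooth ρ (k + 1) A (x + h) - smooth ρ (k + 1) A x - inner ℝ c h) ∂ν := by
    rw [integral_sub i3 i2, integral_sub i1 (integrable_const _),
      avg_ballMeasure_inner, smooth_succ ρ hA.continuous_fun (k + 1)]
    simp [avg, ν]
  rw [e]
  have := norm_integral_le_of_norm_le_const (μ := ν) (f := fun h => smooth ρ (k + 1) A (x + h)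
    - smooth ρ (k + 1) A x - inner ℝ c h)
    (C := 4 ^ Module.finrank ℝ E * osc ρ k a x * (4 * scale ρ k)) (by
      filter_upwards [ae_norm_le ν] with h hh
      rw [scale_succ] at hh
      have h2 := hA.taylor ρ k (x := x) (y := x + h) (by
        rw [add_sub_cancel_left]; linarith [scale_pos ρ k])
      rw [add_sub_cancel_left] at h2
      refine h2.trans ?_
      have := osc_nonneg ρ k a x
      gcongr)
  simpa using this

/-- The normalized distance of `A` to its average at scale `k`. -/
def smoothError (A : E → ℝ) (k : ℕ) (x : E) : ℝ := |A x - smooth ρ (k + 1) A x| / scale ρ k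

theorem smoothError_nonneg (A : E → ℝ) (k : ℕ) (x : E) : 0 ≤ smoothError ρ A k x :=
  div_nonneg (abs_nonneg _) (scale_pos ρ k).le

theorem HasBoundedGradient.continuous_smoothError (hA : HasBoundedGradient A a L) (k : ℕ) :
    Continuous (smoothError ρ A k) :=
  ((hA.continuous_fun.sub (continuous_smooth ρ hA.continuous_fun _)).abs).div_const _

theorem HasBoundedGradient.smoothError_le (hA : HasBoundedGradient A a L) (k : ℕ) (x : E) :
    smoothError ρ A k x ≤ 2 * L := by
  have hr := scale_pos ρ k
  rw [smoothError, div_le_iff₀ hr, abs_sub_comm]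
  have h1 := norm_avg_sub_le (f := A) hA.continuous_fun (walk E ρ (k + 1)) (x := x) (c := A x)
    (D := L * walkRadius ρ (k + 1)) fun y hy => by
      refine (hA.abs_sub_le_mul x y).trans ?_
      have := hA.nonneg
      gcongr
  have h2 := walkRadius_le ρ (k + 1)
  rw [scale_succ] at h2
  refine h1.trans ?_
  have := hA.nonneg
  calc L * walkRadius ρ (k + 1) ≤ L * (2 * scale ρ k) := by gcongr; linarith
    _ = _ := by ring

/-- The unnormalized distance grows by one increment of the averages only, while the normalizing
scale is multiplied by `4`: hence the contraction factor `1 / 4`. -/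
theorem HasBoundedGradient.smoothError_succ_le (hA : HasBoundedGradient A a L) (k : ℕ) (x : E) :
    smoothError ρ A (k + 1) x ≤
      1 / 4 * (smoothError ρ A k x + 4 * 4 ^ Module.finrank ℝ E * osc ρ k a x) := by
  have hr := scale_pos ρ k
  have h := hA.abs_smooth_add_two_sub_le ρ k x
  have h1 := abs_sub_le (A x) (smooth ρ (k + 1) A x) (smooth ρ (k + 2) A x)
  rw [abs_sub_comm (smooth ρ (k + 1) A x)] at h1
  rw [smoothError, scale_succ, div_le_iff₀ (by positivity), smoothError]
  have e : 1 / 4 * (|A x - smooth ρ (k + 1) A x| / scale ρ k +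
      4 * 4 ^ Module.finrank ℝ E * osc ρ k a x) * (4 * scale ρ k) =
      |A x - smooth ρ (k + 1) A x| +
        4 ^ Module.finrank ℝ E * osc ρ k a x * (4 * scale ρ k) := by
    field_simp
  rw [e]
  linarith

end Geometric

/-! ### Sums of approximation errors, and weighted deviations from affine functions -/

section GeometricSums

variable {E : Type*} [NormedAddCommGroup E] [InnerProductSpace ℝ E] [FiniteDimensional ℝ E]
  [MeasurableSpace E] [BorelSpace E]
variable (ρ : ℝ) [hρ : Fact (0 < ρ)] {g : E → ℝ} {A : E → ℝ} {a : E → E} {L : ℝ}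

theorem HasBoundedGradient.continuous_osc (hA : HasBoundedGradient A a L) (k : ℕ) :
    Continuous (osc ρ k a) := _root_.continuous_osc ρ hA.continuous k

/-- Changing the weight from `smooth ρ (k + 4) g` to `smooth ρ (k + 3) g`. -/
theorem IsTestFunction.integral_mul_next_le (hg : IsTestFunction g) (k : ℕ) {φ : E → ℝ}
    (hφ : Continuous φ) (hφ0 : ∀ x, 0 ≤ φ x) {c : ℝ} (hφc : ∀ x, φ x ≤ c) :
    ∫ x, φ x * smooth ρ (k + 4) g x ^ 2 ≤ 2 * (∫ x, φ x * smooth ρ (k + 3) g x ^ 2) +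
      2 * c * ∫ x, increment ρ g k x ^ 2 := by
  have i1 := ((hg.smoothed ρ (k + 3)).integrable_mul_sq hφ).const_mul 2
  have i2 := (integrable_sq_of_compact (hg.continuous_increment ρ k)
      (hg.hasCompactSupport_increment ρ k)).const_mul (2 * c)
  rw [← integral_const_mul, ← integral_const_mul, ← integral_add i1 i2]
  refine integral_mono ((hg.smoothed ρ (k + 4)).integrable_mul_sq hφ) (i1.add i2) fun x => ?_
  simp only
  have e : smooth ρ (k + 4) g x = smooth ρ (k + 3) g x - increment ρ g k x := by
    rw [increment]; ring
  rw [e]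
  set s := smooth ρ (k + 3) g x
  set δ := increment ρ g k x
  have h1 : (s - δ) ^ 2 ≤ 2 * s ^ 2 + 2 * δ ^ 2 := by nlinarith [sq_nonneg (s + δ)]
  have h2 := mul_le_mul_of_nonneg_left h1 (hφ0 x)
  have h3 := mul_le_mul_of_nonneg_right (hφc x) (sq_nonneg δ)
  nlinarith

/-- Changing the weight from `smooth ρ (k + 3) g` to `smooth ρ (k + 4) g`. -/
theorem IsTestFunction.integral_mul_prev_le (hg : IsTestFunction g) (k : ℕ) {φ : E → ℝ}
    (hφ : Continuous φ) (hφ0 : ∀ x, 0 ≤ φ x) {c : ℝ} (hφc : ∀ x, φ x ≤ c) :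
    ∫ x, φ x * smooth ρ (k + 3) g x ^ 2 ≤ 2 * (∫ x, φ x * smooth ρ (k + 4) g x ^ 2) +
      2 * c * ∫ x, increment ρ g k x ^ 2 := by
  have i1 := ((hg.smoothed ρ (k + 4)).integrable_mul_sq hφ).const_mul 2
  have i2 := (integrable_sq_of_compact (hg.continuous_increment ρ k)
      (hg.hasCompactSupport_increment ρ k)).const_mul (2 * c)
  rw [← integral_const_mul, ← integral_const_mul, ← integral_add i1 i2]
  refine integral_mono ((hg.smoothed ρ (k + 3)).integrable_mul_sq hφ) (i1.add i2) fun x => ?_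
  simp only
  have e : smooth ρ (k + 3) g x = smooth ρ (k + 4) g x + increment ρ g k x := by
    rw [increment]; ring
  rw [e]
  set s := smooth ρ (k + 4) g x
  set δ := increment ρ g k x
  have h1 : (s + δ) ^ 2 ≤ 2 * s ^ 2 + 2 * δ ^ 2 := by nlinarith [sq_nonneg (s - δ)]
  have h2 := mul_le_mul_of_nonneg_left h1 (hφ0 x)
  have h3 := mul_le_mul_of_nonneg_right (hφc x) (sq_nonneg δ)
  nlinarith

variable (E) in
-- Forward recursion, started at scale `0` by the trivial bound `2 * L`. Squaring
-- `smoothError_succ_le` gives the factor `1 / 8`; changing the weight from index `k + 4` to `k + 3`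
-- doubles it to `1 / 4`, still a contraction.
theorem exists_sum_smoothError_sq_le :
    ∃ C : ℝ, 0 < C ∧ ∀ (ρ : ℝ) [Fact (0 < ρ)] (A : E → ℝ) (a : E → E) (L : ℝ) (g : E → ℝ),
      HasBoundedGradient A a L → IsTestFunction g → ∀ N : ℕ,
        ∑ k ∈ Finset.range N, ∫ x, smoothError ρ A k x ^ 2 * smooth ρ (k + 3) g x ^ 2 ≤
          C * L ^ 2 * ∫ x, g x ^ 2 := by
  set q : ℝ := 4 * 4 ^ Module.finrank ℝ E with hq
  have hq0 : 0 < q := by positivity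
  refine ⟨4 / 3 * (4 + (1 / 4 * q ^ 2 * 54 +
    (1 / 4) * (4 + q ^ 2) * (3 * 16 ^ Module.finrank ℝ E))), by positivity, ?_⟩
  intro ρ hρ A a L g hA hg N
  set G := ∫ x, g x ^ 2
  have hG : 0 ≤ G := integral_nonneg fun x => sq_nonneg _
  set X : ℕ → ℝ := fun k => ∫ x, osc ρ k a x ^ 2 * smooth ρ (k + 3) g x ^ 2 with hX
  set D : ℕ → ℝ := fun k => ∫ x, increment ρ g k x ^ 2 with hD
  set Y : ℕ → ℝ := fun k => ∫ x, smoothError ρ A k x ^ 2 * smooth ρ (k + 3) g x ^ 2 with hY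
  have hXs : ∑ k ∈ Finset.range N, X k ≤ 54 * L ^ 2 * G :=
    hg.sum_integral_osc_sq_mul_le ρ hA.continuous hA.norm_le N
  have hDs : ∑ k ∈ Finset.range N, D k ≤ 3 * 16 ^ Module.finrank ℝ E * G :=
    hg.sum_integral_increment_sq_le ρ N
  have hL := hA.nonneg
  have hrec : ∀ k, Y (k + 1) ≤ 1 / 4 * Y k + (1 / 4 * q ^ 2 * X k +
      (1 / 4) * (4 + q ^ 2) * L ^ 2 * D k) := by
    intro k
    have hWc := hA.continuous_smoothError ρ k
    have hOc := hA.continuous_osc ρ k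
    have b1 : ∀ x, smoothError ρ A (k + 1) x ^ 2 ≤
        1 / 8 * (smoothError ρ A k x ^ 2 + q ^ 2 * osc ρ k a x ^ 2) := by
      intro x
      have h1 := hA.smoothError_succ_le ρ k x
      have h0 := smoothError_nonneg ρ A (k + 1) x
      calc smoothError ρ A (k + 1) x ^ 2
          ≤ (1 / 4 * (smoothError ρ A k x + q * osc ρ k a x)) ^ 2 :=
            pow_le_pow_left₀ h0 h1 2
        _ ≤ _ := by nlinarith [sq_nonneg (smoothError ρ A k x - q * osc ρ k a x)]
    have hφc : ∀ x, 1 / 8 * (smoothError ρ A k x ^ 2 + q ^ 2 * osc ρ k a x ^ 2) ≤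
        1 / 8 * ((4 + q ^ 2) * L ^ 2) := by
      intro x
      have h1 := pow_le_pow_left₀ (smoothError_nonneg ρ A k x) (hA.smoothError_le ρ k x) 2
      have h2 := pow_le_pow_left₀ (osc_nonneg ρ k a x) (osc_le ρ hA.continuous hA.norm_le k x) 2
      have h3 := mul_le_mul_of_nonneg_left h2 (sq_nonneg q)
      nlinarith
    have hcont : Continuous fun x => 1 / 8 * (smoothError ρ A k x ^ 2 + q ^ 2 * osc ρ k a x ^ 2) := by
      fun_prop
    have h4 := hg.integral_mul_next_le ρ k hcont (fun x => by positivity) hφc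
    have h5 : Y (k + 1) ≤ ∫ x, 1 / 8 * (smoothError ρ A k x ^ 2 + q ^ 2 * osc ρ k a x ^ 2) *
        smooth ρ (k + 4) g x ^ 2 := by
      refine integral_mono ((hg.smoothed ρ _).integrable_mul_sq
        ((hA.continuous_smoothError ρ (k + 1)).pow 2))
        ((hg.smoothed ρ _).integrable_mul_sq hcont) fun x => ?_
      exact mul_le_mul_of_nonneg_right (b1 x) (sq_nonneg _)
    have h6 : ∫ x, 1 / 8 * (smoothError ρ A k x ^ 2 + q ^ 2 * osc ρ k a x ^ 2) *
        smooth ρ (k + 3) g x ^ 2 = 1 / 8 * Y k + 1 / 8 * q ^ 2 * X k := by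
      rw [hY, hX]
      simp only
      rw [← integral_const_mul, ← integral_const_mul, ← integral_add
        (((hg.smoothed ρ _).integrable_mul_sq (φ := fun x => smoothError ρ A k x ^ 2)
          (by fun_prop)).const_mul _)
        (((hg.smoothed ρ _).integrable_mul_sq (φ := fun x => osc ρ k a x ^ 2)
          (by fun_prop)).const_mul _)]
      exact integral_congr_ae (Filter.Eventually.of_forall fun x => by simp only; ring)
    rw [h6] at h4
    have h7 : ∫ x, increment ρ g k x ^ 2 = D k := rfl
    rw [h7] at h4
    linarith
  have hY0 : ∀ k, 0 ≤ Y k := fun k => integral_nonneg fun x => by positivity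
  have hsum := sum_le_of_forward_recursion hY0 hrec N
  rw [Finset.sum_add_distrib, ← Finset.mul_sum, ← Finset.mul_sum] at hsum
  have hYL : Y 0 ≤ 4 * L ^ 2 * G := by
    refine hg.integral_mul_smooth_sq_le ρ 3 (φ := fun x => smoothError ρ A 0 x ^ 2)
      ((hA.continuous_smoothError ρ 0).pow 2) (fun x => ?_)
      (by positivity)
    have h1 := pow_le_pow_left₀ (smoothError_nonneg ρ A 0 x) (hA.smoothError_le ρ 0 x) 2
    linarith
  refine hsum.trans ?_
  have h8 := mul_le_mul_of_nonneg_left hXs (by positivity : 0 ≤ 1 / 4 * q ^ 2)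
  have h9 := mul_le_mul_of_nonneg_left hDs (by positivity : 0 ≤ 1 / 4 * (4 + q ^ 2) * L ^ 2)
  linarith

/-- The average of `smoothError` over a ball at the next scale. -/
def meanError (A : E → ℝ) (k : ℕ) : E → ℝ :=
  avg (ballMeasure E (scale ρ (k + 1))) (smoothError ρ A k)

theorem HasBoundedGradient.continuous_meanError (hA : HasBoundedGradient A a L) (k : ℕ) :
    Continuous (meanError ρ A k) := continuous_avg (hA.continuous_smoothError ρ k) _

theorem meanError_nonneg (A : E → ℝ) (k : ℕ) (x : E) : 0 ≤ meanError ρ A k x :=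
  avg_nonneg (smoothError_nonneg ρ A k) _ x

/-- Jensen's inequality takes the square inside the average, the Harnack-type bound moves the weight
from `x` to `x + h` at the price of two more steps, and translation invariance removes the average.
The constant is `(16 ^ d) ^ 2`. -/
theorem HasBoundedGradient.integral_meanError_sq_mul_le (hA : HasBoundedGradient A a L)
    (hg : IsTestFunction g) (k : ℕ) :
    ∫ x, meanError ρ A k x ^ 2 * smooth ρ (k + 3) g x ^ 2 ≤
      256 ^ Module.finrank ℝ E * ∫ x, smoothError ρ A k x ^ 2 * smooth ρ (k + 5) g x ^ 2 := by
  have hWc := hA.continuous_smoothError ρ k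
  set ν := ballMeasure E (scale ρ (k + 1))
  have hi := (hg.smoothed ρ (k + 5)).integrable_mul_sq (φ := fun x => smoothError ρ A k x ^ 2)
    (by fun_prop)
  obtain ⟨h1, h2⟩ := integral_avg hi ν
  rw [← h2, ← integral_const_mul]
  refine integral_mono ((hg.smoothed ρ _).integrable_mul_sq ((hA.continuous_meanError ρ k).pow 2))
    (h1.const_mul _) fun x => ?_
  simp only
  calc meanError ρ A k x ^ 2 * smooth ρ (k + 3) g x ^ 2
      ≤ avg ν (fun y => smoothError ρ A k y ^ 2) x * smooth ρ (k + 3) g x ^ 2 :=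
        mul_le_mul_of_nonneg_right (sq_avg_le hWc ν x) (sq_nonneg _)
    _ = ∫ h, smoothError ρ A k (x + h) ^ 2 * smooth ρ (k + 3) g x ^ 2 ∂ν := by
        rw [integral_mul_const]; rfl
    _ ≤ ∫ h, 256 ^ Module.finrank ℝ E *
          (smoothError ρ A k (x + h) ^ 2 * smooth ρ (k + 5) g (x + h) ^ 2) ∂ν := by
        have hc5 := (hg.smoothed ρ (k + 5)).continuous
        refine integral_mono_ae (integrable_of_ball (by fun_prop) ν)
          (integrable_of_ball (by fun_prop) ν) ?_
        filter_upwards [ae_norm_le ν] with h hh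
        have h3 := smooth_succ_le_smooth ρ hg.continuous hg.nonneg (k + 2) (y := x) (x := x + h) (by
          rw [sub_add_cancel_left, norm_neg, scale_succ]
          linarith [scale_pos ρ (k + 1)])
        have h4 := pow_le_pow_left₀ ((hg.smoothed ρ (k + 3)).nonneg x) h3 2
        have e : ((16 : ℝ) ^ Module.finrank ℝ E) ^ 2 = 256 ^ Module.finrank ℝ E := by
          rw [← pow_mul, mul_comm, pow_mul]; norm_num
        rw [mul_pow, e] at h4
        calc _ ≤ smoothError ρ A k (x + h) ^ 2 *
              (256 ^ Module.finrank ℝ E * smooth ρ (k + 5) g (x + h) ^ 2) := by gcongr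
          _ = _ := by ring
    _ = _ := by rw [integral_const_mul]; rfl

variable (E) in
-- Two changes of weight, from index `k + 5` back to `k + 3`, reduce this to the sum for
-- `smoothError`; their cost is a sum of squared increments.
theorem exists_sum_meanError_sq_le :
    ∃ C : ℝ, 0 < C ∧ ∀ (ρ : ℝ) [Fact (0 < ρ)] (A : E → ℝ) (a : E → E) (L : ℝ) (g : E → ℝ),
      HasBoundedGradient A a L → IsTestFunction g → ∀ N : ℕ,
        ∑ k ∈ Finset.range N, ∫ x, meanError ρ A k x ^ 2 * smooth ρ (k + 3) g x ^ 2 ≤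
          C * L ^ 2 * ∫ x, g x ^ 2 := by
  obtain ⟨C, hC, h⟩ := exists_sum_smoothError_sq_le E
  refine ⟨256 ^ Module.finrank ℝ E * (4 * C + 24 * (3 * 16 ^ Module.finrank ℝ E)),
    by positivity, ?_⟩
  intro ρ hρ A a L g hA hg N
  set G := ∫ x, g x ^ 2
  have hG : 0 ≤ G := integral_nonneg fun x => sq_nonneg _
  set D : ℕ → ℝ := fun k => ∫ x, increment ρ g k x ^ 2 with hD
  set Y : ℕ → ℝ := fun k => ∫ x, smoothError ρ A k x ^ 2 * smooth ρ (k + 3) g x ^ 2 with hY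
  have hD0 : ∀ k, 0 ≤ D k := fun k => integral_nonneg fun x => sq_nonneg _
  have h1 : ∀ k, ∫ x, meanError ρ A k x ^ 2 * smooth ρ (k + 3) g x ^ 2 ≤
      256 ^ Module.finrank ℝ E * (4 * Y k + 16 * L ^ 2 * D k + 8 * L ^ 2 * D (k + 1)) := by
    intro k
    refine (hA.integral_meanError_sq_mul_le ρ hg k).trans ?_
    have hWc := hA.continuous_smoothError ρ k
    have hWc2 : Continuous fun x => smoothError ρ A k x ^ 2 := by fun_prop
    have hb : ∀ x, smoothError ρ A k x ^ 2 ≤ 4 * L ^ 2 := fun x => by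
      have := pow_le_pow_left₀ (smoothError_nonneg ρ A k x) (hA.smoothError_le ρ k x) 2
      linarith
    have h2 := hg.integral_mul_next_le ρ k hWc2 (fun x => sq_nonneg _) hb
    have h3 := hg.integral_mul_next_le ρ (k + 1) hWc2 (fun x => sq_nonneg _) hb
    refine mul_le_mul_of_nonneg_left ?_ (by positivity)
    have e1 : ∫ x, increment ρ g k x ^ 2 = D k := rfl
    have e2 : ∫ x, increment ρ g (k + 1) x ^ 2 = D (k + 1) := rfl
    have e3 : ∫ x, smoothError ρ A k x ^ 2 * smooth ρ (k + 3) g x ^ 2 = Y k := rfl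
    rw [e1, e3] at h2
    rw [e2] at h3
    have e4 : k + 1 + 4 = k + 5 := rfl
    have e5 : k + 1 + 3 = k + 4 := rfl
    rw [e4, e5] at h3
    linarith
  refine (Finset.sum_le_sum fun k _ => h1 k).trans ?_
  rw [← Finset.mul_sum, Finset.sum_add_distrib, Finset.sum_add_distrib, ← Finset.mul_sum,
    ← Finset.mul_sum, ← Finset.mul_sum]
  have e : 256 ^ Module.finrank ℝ E * (4 * C + 24 * (3 * 16 ^ Module.finrank ℝ E)) * L ^ 2 * G =
    256 ^ Module.finrank ℝ E * ((4 * C + 24 * (3 * 16 ^ Module.finrank ℝ E)) * L ^ 2 * G) := by ring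
  rw [e]
  refine mul_le_mul_of_nonneg_left ?_ (by positivity)
  have hYs := h ρ A a L g hA hg N
  have hDs : ∑ k ∈ Finset.range N, D k ≤ 3 * 16 ^ Module.finrank ℝ E * G :=
    hg.sum_integral_increment_sq_le ρ N
  have hDs' : ∑ k ∈ Finset.range (N + 1), D k ≤ 3 * 16 ^ Module.finrank ℝ E * G :=
    hg.sum_integral_increment_sq_le ρ (N + 1)
  rw [Finset.sum_range_succ'] at hDs'
  have h4 := mul_le_mul_of_nonneg_left hDs (by positivity : 0 ≤ 16 * L ^ 2)
  have h5 : ∑ k ∈ Finset.range N, D (k + 1) ≤ 3 * 16 ^ Module.finrank ℝ E * G := by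
    linarith [hD0 0]
  have h6 := mul_le_mul_of_nonneg_left h5 (by positivity : 0 ≤ 8 * L ^ 2)
  linarith

/-! ### The deviation of a Lipschitz function from affine functions -/

/-- The weight `r / max r ‖u‖ ^ (d + 2)`. -/
def flatWeight (r : ℝ) (u : E) : ℝ := r / max r ‖u‖ ^ (Module.finrank ℝ E + 2)

theorem flatWeight_nonneg {r : ℝ} (hr : 0 < r) (u : E) : 0 ≤ flatWeight r u := by
  unfold flatWeight; positivity

theorem continuous_flatWeight {r : ℝ} (hr : 0 < r) : Continuous (flatWeight r : E → ℝ) := by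
  unfold flatWeight
  refine Continuous.div (by fun_prop) (by fun_prop) fun u => ?_
  positivity

/-- Because of the `max`, beyond radius `4 r` the weight is exactly a quarter of the weight at scale
`4 r`. This is the source of the recursion over scales. -/
theorem flatWeight_le {r : ℝ} (hr : 0 < r) (u : E) :
    flatWeight r u ≤ (if ‖u‖ ≤ 4 * r then (r ^ (Module.finrank ℝ E + 1))⁻¹ else 0) +
      1 / 4 * flatWeight (4 * r) u := by
  have h4 := flatWeight_nonneg (by positivity : 0 < 4 * r) u
  split_ifs with h
  · have : flatWeight r u ≤ (r ^ (Module.finrank ℝ E + 1))⁻¹ := by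
      rw [flatWeight]
      calc r / max r ‖u‖ ^ (Module.finrank ℝ E + 2) ≤ r / r ^ (Module.finrank ℝ E + 2) := by
            gcongr; exact le_max_left _ _
        _ = _ := by rw [pow_succ r (_ + 1)]; field_simp
    linarith
  · rw [not_le] at h
    rw [flatWeight, flatWeight, max_eq_right (by linarith), max_eq_right h.le]
    apply le_of_eq
    ring

/-- Deviations from affine functions grow linearly; with one factor `‖u‖` the weight becomes of
Poisson type and remains integrable. -/
theorem flatWeight_mul_norm_le {r : ℝ} (hr : 0 < r) (u : E) :
    flatWeight r u * ‖u‖ ≤ 2 ^ (Module.finrank ℝ E + 1) * poissonWeight r u := by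
  have hm : 0 < max r ‖u‖ := lt_max_of_lt_left hr
  have h1 : flatWeight r u * ‖u‖ ≤ r / max r ‖u‖ ^ (Module.finrank ℝ E + 1) := by
    rw [flatWeight, div_mul_eq_mul_div, div_le_div_iff₀ (by positivity) (by positivity)]
    have : r * ‖u‖ ≤ r * max r ‖u‖ := by gcongr; exact le_max_right _ _
    calc r * ‖u‖ * max r ‖u‖ ^ (Module.finrank ℝ E + 1)
        ≤ r * max r ‖u‖ * max r ‖u‖ ^ (Module.finrank ℝ E + 1) := by gcongr
      _ = _ := by ring
  refine h1.trans ?_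
  rw [poissonWeight, ← mul_div_assoc, div_le_div_iff₀ (by positivity) (by positivity)]
  have h2 : r + ‖u‖ ≤ 2 * max r ‖u‖ := by linarith [le_max_left r ‖u‖, le_max_right r ‖u‖]
  calc r * (r + ‖u‖) ^ (Module.finrank ℝ E + 1)
      ≤ r * (2 * max r ‖u‖) ^ (Module.finrank ℝ E + 1) := by gcongr
    _ = _ := by rw [mul_pow]; ring

theorem integrable_flatWeight_mul_norm {r : ℝ} (hr : 0 < r) :
    Integrable (fun u : E => flatWeight r u * ‖u‖) :=
  ((integrable_poissonWeight hr).const_mul (2 ^ (Module.finrank ℝ E + 1))).mono'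
    ((continuous_flatWeight hr).mul continuous_norm).aestronglyMeasurable
    (Filter.Eventually.of_forall fun u => by
      rw [Real.norm_of_nonneg (mul_nonneg (flatWeight_nonneg hr u) (norm_nonneg _))]
      exact flatWeight_mul_norm_le hr u)

variable (E) in
/-- A bound for the first moments of the weights `flatWeight`. -/
def flatConst : ℝ := 2 ^ (Module.finrank ℝ E + 1) * weightConst E

variable (E) in
theorem flatConst_pos : 0 < flatConst E := by
  have := weightConst_pos E
  unfold flatConst; positivity

theorem integral_flatWeight_mul_norm_le {r : ℝ} (hr : 0 < r) :
    ∫ u : E, flatWeight r u * ‖u‖ ≤ flatConst E := by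
  refine (integral_mono (integrable_flatWeight_mul_norm hr) ((integrable_poissonWeight hr).const_mul
    (2 ^ (Module.finrank ℝ E + 1))) (flatWeight_mul_norm_le hr)).trans ?_
  rw [integral_const_mul]
  have := integral_poissonWeight_le (E := E) hr
  unfold flatConst
  gcongr

/-- The weighted deviation of `A` around `x` from the affine function with slope `c`. -/
def flatness (A : E → ℝ) (r : ℝ) (c x : E) : ℝ :=
  ∫ u, flatWeight r u * |A (x + u) - A x - inner ℝ c u|

theorem flatness_nonneg (A : E → ℝ) {r : ℝ} (hr : 0 < r) (c x : E) : 0 ≤ flatness A r c x :=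
  integral_nonneg fun u => mul_nonneg (flatWeight_nonneg hr u) (abs_nonneg _)

theorem HasBoundedGradient.abs_deviation_le (hA : HasBoundedGradient A a L) {c : E}
    (hc : ‖c‖ ≤ L) (x u : E) : |A (x + u) - A x - inner ℝ c u| ≤ 2 * L * ‖u‖ := by
  have h1 := hA.abs_sub_le_mul x (x + u)
  rw [add_sub_cancel_left] at h1
  have h2 := abs_real_inner_le_norm c u
  have h3 := abs_sub (A (x + u) - A x) (inner ℝ c u)
  have h4 : ‖c‖ * ‖u‖ ≤ L * ‖u‖ := by gcongr
  linarith

theorem HasBoundedGradient.integrable_flatness (hA : HasBoundedGradient A a L) {c : E}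
    (hc : ‖c‖ ≤ L) {r : ℝ} (hr : 0 < r) (x : E) :
    Integrable (fun u => flatWeight r u * |A (x + u) - A x - inner ℝ c u|) := by
  have hAc := hA.continuous_fun
  refine ((integrable_flatWeight_mul_norm hr).const_mul (2 * L)).mono'
    ((continuous_flatWeight hr).mul (by fun_prop)).aestronglyMeasurable
    (Filter.Eventually.of_forall fun u => ?_)
  rw [Real.norm_of_nonneg (mul_nonneg (flatWeight_nonneg hr u) (abs_nonneg _))]
  calc _ ≤ flatWeight r u * (2 * L * ‖u‖) :=
        mul_le_mul_of_nonneg_left (hA.abs_deviation_le hc x u) (flatWeight_nonneg hr u)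
    _ = _ := by ring

theorem HasBoundedGradient.flatness_le (hA : HasBoundedGradient A a L) {c : E}
    (hc : ‖c‖ ≤ L) {r : ℝ} (hr : 0 < r) (x : E) : flatness A r c x ≤ 2 * L * flatConst E := by
  have hL := hA.nonneg
  calc flatness A r c x ≤ ∫ u : E, 2 * L * (flatWeight r u * ‖u‖) := by
        refine integral_mono (hA.integrable_flatness hc hr x)
          ((integrable_flatWeight_mul_norm hr).const_mul (2 * L)) fun u => ?_
        calc _ ≤ flatWeight r u * (2 * L * ‖u‖) :=
              mul_le_mul_of_nonneg_left (hA.abs_deviation_le hc x u) (flatWeight_nonneg hr u)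
          _ = _ := by ring
    _ ≤ _ := by
        rw [integral_const_mul]
        have := integral_flatWeight_mul_norm_le (E := E) hr
        gcongr

theorem HasBoundedGradient.continuous_flatness (hA : HasBoundedGradient A a L) {c : E → E}
    (hcc : Continuous c) (hc : ∀ x, ‖c x‖ ≤ L) {r : ℝ} (hr : 0 < r) :
    Continuous (fun x => flatness A r (c x) x) := by
  have hAc := hA.continuous_fun
  refine continuous_of_dominated (bound := fun u => 2 * L * (flatWeight r u * ‖u‖))
    (fun x => (hA.integrable_flatness (hc x) hr x).aestronglyMeasurable)
    (fun x => Filter.Eventually.of_forall fun u => ?_)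
    ((integrable_flatWeight_mul_norm hr).const_mul (2 * L))
    (Filter.Eventually.of_forall fun u => by fun_prop)
  rw [Real.norm_of_nonneg (mul_nonneg (flatWeight_nonneg hr u) (abs_nonneg _))]
  calc _ ≤ flatWeight r u * (2 * L * ‖u‖) :=
        mul_le_mul_of_nonneg_left (hA.abs_deviation_le (hc x) x u) (flatWeight_nonneg hr u)
    _ = _ := by ring

end GeometricSums

/-! ### The weighted geometric lemma -/

section FlatnessSums

variable {E : Type*} [NormedAddCommGroup E] [InnerProductSpace ℝ E] [FiniteDimensional ℝ E]
  [MeasurableSpace E] [BorelSpace E]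
variable (ρ : ℝ) [hρ : Fact (0 < ρ)] {g : E → ℝ} {A : E → ℝ} {a : E → E} {L : ℝ}

theorem avg_ballMeasure_eq' (f : E → ℝ) (r : ℝ) (x : E) :
    avg (ballMeasure E r) f x = (volume.real (Metric.closedBall (0 : E) r))⁻¹ *
      ∫ u in Metric.closedBall (0 : E) r, f (x + u) := by
  rw [avg, ballMeasure, ProbabilityTheory.cond, integral_smul_measure, smul_eq_mul]
  simp [Measure.real]

variable (E) in
/-- The volume of the ball of radius four. -/
def ballConst : ℝ := 4 ^ Module.finrank ℝ E * volume.real (Metric.closedBall (0 : E) 1)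

variable (E) in
theorem ballConst_pos : 0 < ballConst E := by
  have := volume_real_closedBall_pos (0 : E) one_pos
  unfold ballConst; positivity

theorem volume_real_closedBall_four_mul {r : ℝ} (hr : 0 < r) :
    volume.real (Metric.closedBall (0 : E) (4 * r)) = r ^ Module.finrank ℝ E * ballConst E := by
  rw [volume_real_closedBall_mul 0 (by norm_num) hr.le, ballConst, ← mul_one r,
    volume_real_closedBall_mul 0 hr.le zero_le_one, mul_one]
  ring

/-- Replace `A` by `smooth ρ (k + 1) A` at both points, at the cost of two errors, and expand the
averaged function by `taylor`. -/
theorem HasBoundedGradient.abs_deviation_smooth_le (hA : HasBoundedGradient A a L) (k : ℕ)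
    (x : E) {u : E} (hu : ‖u‖ ≤ 4 * scale ρ k) :
    |A (x + u) - A x - inner ℝ (smooth ρ (k + 3) a x) u| ≤
      scale ρ k * (smoothError ρ A k (x + u) + smoothError ρ A k x +
        4 * 4 ^ Module.finrank ℝ E * osc ρ k a x) := by
  have hr := scale_pos ρ k
  have h := hA.taylor ρ k (x := x) (y := x + u) (by rw [add_sub_cancel_left]; linarith)
  rw [add_sub_cancel_left] at h
  have e1 : scale ρ k * smoothError ρ A k (x + u) =
      |A (x + u) - smooth ρ (k + 1) A (x + u)| := by
    rw [smoothError]; field_simp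
  have e2 : scale ρ k * smoothError ρ A k x = |A x - smooth ρ (k + 1) A x| := by
    rw [smoothError]; field_simp
  have h2 : 4 ^ Module.finrank ℝ E * osc ρ k a x * ‖u‖ ≤
      4 ^ Module.finrank ℝ E * osc ρ k a x * (4 * scale ρ k) := by
    have := osc_nonneg ρ k a x
    gcongr
  have h3 : |A (x + u) - A x - inner ℝ (smooth ρ (k + 3) a x) u| ≤
      |A (x + u) - smooth ρ (k + 1) A (x + u)| + |A x - smooth ρ (k + 1) A x| +
      |smooth ρ (k + 1) A (x + u) - smooth ρ (k + 1) A x - inner ℝ (smooth ρ (k + 3) a x) u| := by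
    rw [abs_le]
    have a1 := abs_le.1 (le_refl |A (x + u) - smooth ρ (k + 1) A (x + u)|)
    have a2 := abs_le.1 (le_refl |A x - smooth ρ (k + 1) A x|)
    have a3 := abs_le.1 (le_refl |smooth ρ (k + 1) A (x + u) - smooth ρ (k + 1) A x -
      inner ℝ (smooth ρ (k + 3) a x) u|)
    constructor <;> linarith [a1.1, a1.2, a2.1, a2.2, a3.1, a3.2]
  rw [mul_add, mul_add, e1, e2]
  linarith

/-- The deviation of `A` from its approximate tangent plane at scale `k`. -/
def scaleFlatness (A : E → ℝ) (a : E → E) (k : ℕ) (x : E) : ℝ :=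
  flatness A (scale ρ k) (smooth ρ (k + 3) a x) x

/-- Inside radius `4 * scale ρ k` the deviation is bounded by errors at scale `k`. Outside, the
weight is a quarter of the next one, and passing to the slope of scale `k + 1` costs the oscillation
there. -/
theorem HasBoundedGradient.scaleFlatness_le (hA : HasBoundedGradient A a L) (k : ℕ) (x : E) :
    scaleFlatness ρ A a k x ≤ 1 / 4 * scaleFlatness ρ A a (k + 1) x +
      (ballConst E * (meanError ρ A k x + smoothError ρ A k x +
        4 * 4 ^ Module.finrank ℝ E * osc ρ k a x) +
        flatConst E * 4 ^ Module.finrank ℝ E * osc ρ (k + 1) a x) := by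
  have hr := scale_pos ρ k
  have hc : ∀ j, ‖smooth ρ j a x‖ ≤ L := fun j => norm_smooth_le ρ hA.norm_le j x
  set r := scale ρ k with hrdef
  have hr4 : scale ρ (k + 1) = 4 * r := scale_succ ρ k
  set c := smooth ρ (k + 3) a x
  set c' := smooth ρ (k + 4) a x
  set D : E → ℝ := fun u => |A (x + u) - A x - inner ℝ c u| with hD
  have hAc := hA.continuous_fun
  have hDc : Continuous D := by rw [hD]; fun_prop
  set B := Metric.closedBall (0 : E) (4 * r)
  have hB : MeasurableSet B := Metric.isClosed_closedBall.measurableSet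
  have i1 : Integrable (B.indicator fun u => (r ^ (Module.finrank ℝ E + 1))⁻¹ * D u) :=
    IntegrableOn.integrable_indicator ((hDc.continuousOn.integrableOn_compact
      (isCompact_closedBall _ _)).const_mul _) hB
  have i2 : Integrable (fun u => flatWeight (4 * r) u * D u) :=
    hA.integrable_flatness (hc _) (by positivity) x
  have step1 : scaleFlatness ρ A a k x ≤ (∫ u in B, (r ^ (Module.finrank ℝ E + 1))⁻¹ * D u) +
      1 / 4 * ∫ u, flatWeight (4 * r) u * D u := by
    rw [← integral_indicator hB, ← integral_const_mul, ← integral_add i1 (i2.const_mul _)]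
    refine integral_mono (hA.integrable_flatness (hc _) hr x) (i1.add (i2.const_mul _)) fun u => ?_
    have h1 := mul_le_mul_of_nonneg_right (flatWeight_le hr u) (abs_nonneg
      (A (x + u) - A x - inner ℝ c u))
    refine h1.trans (le_of_eq ?_)
    by_cases hu : ‖u‖ ≤ 4 * r
    · have : u ∈ B := by simpa [B] using hu
      simp only [hu, if_true, Set.indicator_of_mem this, hD]
      ring
    · have : u ∉ B := by simpa [B] using hu
      simp only [hu, if_false, Set.indicator_of_notMem this, hD]
      ring
  have step2 : ∫ u in B, (r ^ (Module.finrank ℝ E + 1))⁻¹ * D u ≤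
      ballConst E * (meanError ρ A k x + smoothError ρ A k x +
        4 * 4 ^ Module.finrank ℝ E * osc ρ k a x) := by
    have hWc := hA.continuous_smoothError ρ k
    have i3 : IntegrableOn (fun u => smoothError ρ A k (x + u)) B :=
      (Continuous.continuousOn (by fun_prop)).integrableOn_compact (isCompact_closedBall _ _)
    set m := smoothError ρ A k x + 4 * 4 ^ Module.finrank ℝ E * osc ρ k a x with hm
    have i4 : IntegrableOn (fun _ : E => m) B :=
      continuousOn_const.integrableOn_compact (isCompact_closedBall _ _)
    have hv := volume_real_closedBall_pos (0 : E) (by positivity : 0 < 4 * r)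
    have e1 : ∫ u in B, smoothError ρ A k (x + u) = volume.real B * meanError ρ A k x := by
      rw [meanError, avg_ballMeasure_eq', hr4, mul_inv_cancel_left₀ hv.ne']
    calc ∫ u in B, (r ^ (Module.finrank ℝ E + 1))⁻¹ * D u
        ≤ ∫ u in B, (r ^ (Module.finrank ℝ E + 1))⁻¹ * (r * (smoothError ρ A k (x + u) + m)) := by
          refine setIntegral_mono_on ((hDc.continuousOn.integrableOn_compact
            (isCompact_closedBall _ _)).const_mul _) (((i3.add i4).const_mul r).const_mul _) hB
            fun u hu => ?_
          have hu' : ‖u‖ ≤ 4 * scale ρ k := by simpa [B] using hu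
          have := hA.abs_deviation_smooth_le ρ k x hu'
          rw [add_assoc] at this
          exact mul_le_mul_of_nonneg_left this (by positivity)
      _ = (r ^ (Module.finrank ℝ E + 1))⁻¹ * (r * (volume.real B * meanError ρ A k x +
            volume.real B * m)) := by
          rw [integral_const_mul, integral_const_mul, integral_add i3 i4, e1, setIntegral_const,
            smul_eq_mul]
      _ = ballConst E * (meanError ρ A k x + m) := by
          rw [volume_real_closedBall_four_mul hr, pow_succ]
          field_simp
      _ = _ := by rw [hm]; ring
  have step3 : ∫ u, flatWeight (4 * r) u * D u ≤ scaleFlatness ρ A a (k + 1) x +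
      flatConst E * 4 ^ Module.finrank ℝ E * osc ρ (k + 1) a x := by
    have i5 : Integrable (fun u => flatWeight (4 * r) u * |A (x + u) - A x - inner ℝ c' u|) :=
      hA.integrable_flatness (hc _) (by positivity) x
    have i6 : Integrable (fun u : E => ‖c - c'‖ * (flatWeight (4 * r) u * ‖u‖)) :=
      (integrable_flatWeight_mul_norm (by positivity)).const_mul _
    have hcc : ‖c - c'‖ ≤ 4 ^ Module.finrank ℝ E * osc ρ (k + 1) a x :=
      norm_smooth_add_two_sub_le ρ hA.continuous (k + 1) x
    calc ∫ u, flatWeight (4 * r) u * D u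
        ≤ ∫ u, (flatWeight (4 * r) u * |A (x + u) - A x - inner ℝ c' u| +
            ‖c - c'‖ * (flatWeight (4 * r) u * ‖u‖)) := by
          refine integral_mono i2 (i5.add i6) fun u => ?_
          have h1 : D u ≤ |A (x + u) - A x - inner ℝ c' u| + ‖c - c'‖ * ‖u‖ := by
            have e : A (x + u) - A x - inner ℝ c u =
              (A (x + u) - A x - inner ℝ c' u) - inner ℝ (c - c') u := by
              rw [inner_sub_left]; ring
            simp only [hD]
            rw [e]
            exact (abs_sub _ _).trans (add_le_add le_rfl (abs_real_inner_le_norm _ _))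
          have h2 := mul_le_mul_of_nonneg_left h1
            (flatWeight_nonneg (by positivity : 0 < 4 * r) u)
          simp only
          linarith
      _ = scaleFlatness ρ A a (k + 1) x + ‖c - c'‖ * ∫ u : E, flatWeight (4 * r) u * ‖u‖ := by
          rw [integral_add i5 i6, integral_const_mul, scaleFlatness, hr4]
          rfl
      _ ≤ scaleFlatness ρ A a (k + 1) x +
          (4 ^ Module.finrank ℝ E * osc ρ (k + 1) a x) * flatConst E := by
          have h3 := integral_flatWeight_mul_norm_le (E := E) (by positivity : 0 < 4 * r)
          have h4 : 0 ≤ ∫ u : E, flatWeight (4 * r) u * ‖u‖ := integral_nonneg fun u =>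
            mul_nonneg (flatWeight_nonneg (by positivity) u) (norm_nonneg u)
          have h5 := osc_nonneg ρ (k + 1) a x
          gcongr
      _ = _ := by ring
  have h6 := osc_nonneg ρ (k + 1) a x
  have h7 : 0 ≤ flatConst E * 4 ^ Module.finrank ℝ E * osc ρ (k + 1) a x := by
    have := flatConst_pos E
    positivity
  linarith

theorem scaleFlatness_nonneg (A : E → ℝ) (a : E → E) (k : ℕ) (x : E) :
    0 ≤ scaleFlatness ρ A a k x := flatness_nonneg A (scale_pos ρ k) _ x

theorem HasBoundedGradient.continuous_scaleFlatness (hA : HasBoundedGradient A a L) (k : ℕ) :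
    Continuous (scaleFlatness ρ A a k) :=
  hA.continuous_flatness (continuous_smooth ρ hA.continuous _)
    (norm_smooth_le ρ hA.norm_le _) (scale_pos ρ k)

theorem HasBoundedGradient.scaleFlatness_le_const (hA : HasBoundedGradient A a L) (k : ℕ) (x : E) :
    scaleFlatness ρ A a k x ≤ 2 * L * flatConst E :=
  hA.flatness_le (norm_smooth_le ρ hA.norm_le _ x) (scale_pos ρ k) x

variable (E) in
theorem exists_scaleFlatness_sq_le :
    ∃ K : ℝ, 0 < K ∧ ∀ (ρ : ℝ) [Fact (0 < ρ)] (A : E → ℝ) (a : E → E) (L : ℝ),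
      HasBoundedGradient A a L → ∀ (k : ℕ) (x : E), scaleFlatness ρ A a k x ^ 2 ≤
        1 / 8 * scaleFlatness ρ A a (k + 1) x ^ 2 + K * (meanError ρ A k x ^ 2 +
          smoothError ρ A k x ^ 2 + osc ρ k a x ^ 2 + osc ρ (k + 1) a x ^ 2) := by
  set b := ballConst E
  set f := flatConst E
  set q : ℝ := 4 ^ Module.finrank ℝ E
  have hb : 0 < b := ballConst_pos E
  have hf : 0 < f := flatConst_pos E
  have hq : 0 < q := by positivity
  set M := b * (1 + 4 * q) + f * q with hM
  have hM0 : 0 < M := by positivity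
  refine ⟨8 * M ^ 2, by positivity, ?_⟩
  intro ρ hρ A a L hA k x
  have h := hA.scaleFlatness_le ρ k x
  have h0 := scaleFlatness_nonneg ρ A a k x
  have w1 := meanError_nonneg ρ A k x
  have w2 := smoothError_nonneg ρ A k x
  have w3 := osc_nonneg ρ k a x
  have w4 := osc_nonneg ρ (k + 1) a x
  set s := scaleFlatness ρ A a (k + 1) x
  set p1 := meanError ρ A k x
  set p2 := smoothError ρ A k x
  set p3 := osc ρ k a x
  set p4 := osc ρ (k + 1) a x
  have h1 : b * (p1 + p2 + 4 * q * p3) + f * q * p4 ≤ M * (p1 + p2 + p3 + p4) := by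
    rw [hM]
    have : 0 ≤ b * (4 * q) * (p1 + p2) := by positivity
    have : 0 ≤ b * p3 := by positivity
    have : 0 ≤ b * (1 + 4 * q) * p4 := by positivity
    have : 0 ≤ f * q * (p1 + p2 + p3) := by positivity
    nlinarith
  have h2 : scaleFlatness ρ A a k x ≤ 1 / 4 * s + M * (p1 + p2 + p3 + p4) := by linarith
  calc scaleFlatness ρ A a k x ^ 2 ≤ (1 / 4 * s + M * (p1 + p2 + p3 + p4)) ^ 2 :=
        pow_le_pow_left₀ h0 h2 2
    _ ≤ 1 / 8 * s ^ 2 + 2 * M ^ 2 * (p1 + p2 + p3 + p4) ^ 2 := by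
        nlinarith [sq_nonneg (1 / 4 * s - M * (p1 + p2 + p3 + p4))]
    _ ≤ 1 / 8 * s ^ 2 + 2 * M ^ 2 * (4 * (p1 ^ 2 + p2 ^ 2 + p3 ^ 2 + p4 ^ 2)) := by
        gcongr
        nlinarith [sq_nonneg (p1 - p2), sq_nonneg (p1 - p3), sq_nonneg (p1 - p4),
          sq_nonneg (p2 - p3), sq_nonneg (p2 - p4), sq_nonneg (p3 - p4)]
    _ = _ := by ring

variable (E) in
/-- The weighted geometric lemma: the deviations of a Lipschitz function from affine functions
form a Carleson-type family. -/
theorem exists_sum_scaleFlatness_sq_le :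
    ∃ C : ℝ, 0 < C ∧ ∀ (ρ : ℝ) [Fact (0 < ρ)] (A : E → ℝ) (a : E → E) (L : ℝ) (g : E → ℝ),
      HasBoundedGradient A a L → IsTestFunction g → ∀ N : ℕ,
        ∑ k ∈ Finset.range N, ∫ x, scaleFlatness ρ A a k x ^ 2 * smooth ρ (k + 3) g x ^ 2 ≤
          C * L ^ 2 * ∫ x, g x ^ 2 := by
  obtain ⟨C₁, hC₁, hmean⟩ := exists_sum_meanError_sq_le E
  obtain ⟨C₂, hC₂, herr⟩ := exists_sum_smoothError_sq_le E
  obtain ⟨K, hK, hpt⟩ := exists_scaleFlatness_sq_le E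
  set f := flatConst E
  have hf : 0 < f := flatConst_pos E
  set q : ℝ := 3 * 16 ^ Module.finrank ℝ E
  have hq : 0 < q := by positivity
  refine ⟨4 / 3 * (4 * f ^ 2 + (f ^ 2 * q + K * (C₁ + C₂ + 54 + (108 + 2 * q)))),
    by positivity, ?_⟩
  intro ρ hρ A a L g hA hg N
  set G := ∫ x, g x ^ 2
  have hG : 0 ≤ G := integral_nonneg fun x => sq_nonneg _
  have hIc := fun k => hA.continuous_scaleFlatness ρ k
  have hmc := fun k => hA.continuous_meanError ρ k
  have hec := fun k => hA.continuous_smoothError ρ k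
  have hoc := fun k => hA.continuous_osc ρ k
  set X : ℕ → ℝ := fun k => ∫ x, scaleFlatness ρ A a k x ^ 2 * smooth ρ (k + 3) g x ^ 2 with hX
  set P₁ : ℕ → ℝ := fun k => ∫ x, meanError ρ A k x ^ 2 * smooth ρ (k + 3) g x ^ 2
  set P₂ : ℕ → ℝ := fun k => ∫ x, smoothError ρ A k x ^ 2 * smooth ρ (k + 3) g x ^ 2
  set P₃ : ℕ → ℝ := fun k => ∫ x, osc ρ k a x ^ 2 * smooth ρ (k + 3) g x ^ 2
  set D : ℕ → ℝ := fun k => ∫ x, increment ρ g k x ^ 2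
  have hX0 : ∀ k, 0 ≤ X k := fun k => integral_nonneg fun x => by positivity
  have hP₃0 : ∀ k, 0 ≤ P₃ k := fun k => integral_nonneg fun x => by positivity
  have hD0 : ∀ k, 0 ≤ D k := fun k => integral_nonneg fun x => by positivity
  have hI2 : ∀ k x, scaleFlatness ρ A a k x ^ 2 ≤ 4 * L ^ 2 * f ^ 2 := fun k x => by
    have := pow_le_pow_left₀ (scaleFlatness_nonneg ρ A a k x) (hA.scaleFlatness_le_const ρ k x) 2
    linarith
  have hO2 : ∀ k x, osc ρ k a x ^ 2 ≤ L ^ 2 := fun k x =>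
    pow_le_pow_left₀ (osc_nonneg ρ k a x) (osc_le ρ hA.continuous hA.norm_le k x) 2
  -- The term of scale `k + 1` arrives with weight index `k + 3`; passing to its own index `k + 4`
  -- doubles `1 / 8` to `1 / 4`.
  have hrec : ∀ k, X k ≤ 1 / 4 * X (k + 1) + (L ^ 2 * f ^ 2 * D k +
      K * (P₁ k + P₂ k + P₃ k + (2 * P₃ (k + 1) + 2 * L ^ 2 * D k))) := by
    intro k
    have hw := hg.smoothed ρ (k + 3)
    have j1 := hw.integrable_mul_sq (φ := fun x => scaleFlatness ρ A a k x ^ 2) (by fun_prop)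
    have j2 := hw.integrable_mul_sq (φ := fun x => scaleFlatness ρ A a (k + 1) x ^ 2) (by fun_prop)
    have j3 := hw.integrable_mul_sq (φ := fun x => meanError ρ A k x ^ 2) (by fun_prop)
    have j4 := hw.integrable_mul_sq (φ := fun x => smoothError ρ A k x ^ 2) (by fun_prop)
    have j5 := hw.integrable_mul_sq (φ := fun x => osc ρ k a x ^ 2) (by fun_prop)
    have j6 := hw.integrable_mul_sq (φ := fun x => osc ρ (k + 1) a x ^ 2) (by fun_prop)
    have hle : X k ≤ 1 / 8 * (∫ x, scaleFlatness ρ A a (k + 1) x ^ 2 * smooth ρ (k + 3) g x ^ 2) +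
        K * (P₁ k + P₂ k + P₃ k + ∫ x, osc ρ (k + 1) a x ^ 2 * smooth ρ (k + 3) g x ^ 2) := by
      have j34 : Integrable fun x => meanError ρ A k x ^ 2 * smooth ρ (k + 3) g x ^ 2 +
        smoothError ρ A k x ^ 2 * smooth ρ (k + 3) g x ^ 2 := j3.add j4
      have j345 : Integrable fun x => meanError ρ A k x ^ 2 * smooth ρ (k + 3) g x ^ 2 +
        smoothError ρ A k x ^ 2 * smooth ρ (k + 3) g x ^ 2 +
        osc ρ k a x ^ 2 * smooth ρ (k + 3) g x ^ 2 := j34.add j5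
      have j7 : Integrable fun x => meanError ρ A k x ^ 2 * smooth ρ (k + 3) g x ^ 2 +
        smoothError ρ A k x ^ 2 * smooth ρ (k + 3) g x ^ 2 +
        osc ρ k a x ^ 2 * smooth ρ (k + 3) g x ^ 2 +
        osc ρ (k + 1) a x ^ 2 * smooth ρ (k + 3) g x ^ 2 := j345.add j6
      rw [← integral_add j3 j4, ← integral_add j34 j5, ← integral_add j345 j6,
        ← integral_const_mul, ← integral_const_mul,
        ← integral_add (j2.const_mul _) (j7.const_mul _)]
      refine integral_mono j1 ((j2.const_mul _).add (j7.const_mul _)) fun x => ?_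
      have := mul_le_mul_of_nonneg_right (hpt ρ A a L hA k x) (sq_nonneg (smooth ρ (k + 3) g x))
      simp only
      refine this.trans (le_of_eq ?_)
      ring
    have h1 := hg.integral_mul_prev_le ρ k (φ := fun x => scaleFlatness ρ A a (k + 1) x ^ 2)
      (by fun_prop) (fun x => sq_nonneg _) (hI2 (k + 1))
    have h2 := hg.integral_mul_prev_le ρ k (φ := fun x => osc ρ (k + 1) a x ^ 2)
      (by fun_prop) (fun x => sq_nonneg _) (hO2 (k + 1))
    have h3 := mul_le_mul_of_nonneg_left h2 hK.le
    have e1 : ∫ x, scaleFlatness ρ A a (k + 1) x ^ 2 * smooth ρ (k + 4) g x ^ 2 = X (k + 1) := rfl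
    have e2 : ∫ x, osc ρ (k + 1) a x ^ 2 * smooth ρ (k + 4) g x ^ 2 = P₃ (k + 1) := rfl
    have e3 : ∫ x, increment ρ g k x ^ 2 = D k := rfl
    rw [e1, e3] at h1
    rw [e2, e3] at h3
    linarith
  -- The boundary term `X N` at the coarsest scale is bounded trivially, uniformly in `N`.
  have hsum := sum_le_of_backward_recursion hX0 hrec N
  simp only [Finset.sum_add_distrib, ← Finset.mul_sum] at hsum
  have hXN : X N ≤ 4 * L ^ 2 * f ^ 2 * G :=
    hg.integral_mul_smooth_sq_le ρ (N + 3) (φ := fun x => scaleFlatness ρ A a N x ^ 2)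
      (by fun_prop) (hI2 N) (by positivity)
  have s1 : ∑ k ∈ Finset.range N, P₁ k ≤ C₁ * L ^ 2 * G := hmean ρ A a L g hA hg N
  have s2 : ∑ k ∈ Finset.range N, P₂ k ≤ C₂ * L ^ 2 * G := herr ρ A a L g hA hg N
  have s3 : ∀ M, ∑ k ∈ Finset.range M, P₃ k ≤ 54 * L ^ 2 * G := fun M =>
    hg.sum_integral_osc_sq_mul_le ρ hA.continuous hA.norm_le M
  have s4 : ∑ k ∈ Finset.range N, P₃ (k + 1) ≤ 54 * L ^ 2 * G := by
    have := s3 (N + 1)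
    rw [Finset.sum_range_succ'] at this
    linarith [hP₃0 0]
  have s5 : ∑ k ∈ Finset.range N, D k ≤ q * G := hg.sum_integral_increment_sq_le ρ N
  have t5 := mul_le_mul_of_nonneg_left s5 (sq_nonneg L)
  have t6 := mul_le_mul_of_nonneg_left s5 (by positivity : 0 ≤ L ^ 2 * f ^ 2)
  have t7 : ∑ k ∈ Finset.range N, P₁ k + ∑ k ∈ Finset.range N, P₂ k + ∑ k ∈ Finset.range N, P₃ k +
      (2 * ∑ k ∈ Finset.range N, P₃ (k + 1) + 2 * L ^ 2 * ∑ k ∈ Finset.range N, D k) ≤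
      (C₁ + C₂ + 54 + (108 + 2 * q)) * L ^ 2 * G := by
    linarith [s3 N]
  have t8 := mul_le_mul_of_nonneg_left t7 hK.le
  linarith

end FlatnessSums

/-! ### Normalized bump functions -/

section Bump

variable {E : Type*} [NormedAddCommGroup E] [InnerProductSpace ℝ E] [FiniteDimensional ℝ E]
  [MeasurableSpace E] [BorelSpace E]

/-- The hat function supported in the ball of radius `1 / 2`. -/
def hat (u : E) : ℝ := max 0 (1 - 2 * ‖u‖)

theorem hat_nonneg (u : E) : 0 ≤ hat u := le_max_left _ _

theorem hat_le_one (u : E) : hat u ≤ 1 := max_le zero_le_one (by linarith [norm_nonneg u])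

theorem continuous_hat : Continuous (hat : E → ℝ) := by unfold hat; fun_prop

theorem hat_eq_zero {u : E} (hu : 1 / 2 ≤ ‖u‖) : hat u = 0 := max_eq_left (by linarith)

theorem abs_hat_sub_hat_le (u v : E) : |hat u - hat v| ≤ 2 * ‖u - v‖ := by
  refine (abs_max_sub_max_le_max _ _ _ _).trans ?_
  rw [sub_self, abs_zero, max_eq_right (abs_nonneg _)]
  have h := abs_norm_sub_norm_le u v
  have e : 1 - 2 * ‖u‖ - (1 - 2 * ‖v‖) = -(2 * (‖u‖ - ‖v‖)) := by ring
  rw [e, abs_neg, abs_mul, abs_two]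
  linarith

theorem hasCompactSupport_hat : HasCompactSupport (hat : E → ℝ) :=
  HasCompactSupport.intro (isCompact_closedBall (0 : E) (1 / 2)) fun u hu => hat_eq_zero (by
    simp only [Metric.mem_closedBall, dist_zero_right, not_le] at hu
    exact hu.le)

theorem integrable_hat : Integrable (hat : E → ℝ) :=
  continuous_hat.integrable_of_hasCompactSupport hasCompactSupport_hat

variable (E) in
theorem integral_hat_pos : 0 < ∫ u : E, hat u :=
  continuous_hat.integral_pos_of_hasCompactSupport_nonneg_nonzero hasCompactSupport_hat
    hat_nonneg (x := 0) (by simp [hat])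

variable (E) in
/-- The normalizing constant of the hat function. -/
def hatConst : ℝ := (∫ u : E, hat u)⁻¹

variable (E) in
theorem hatConst_pos : 0 < hatConst E := inv_pos.2 (integral_hat_pos E)

/-- The normalized hat function at scale `r`. -/
def bump (r : ℝ) (u : E) : ℝ := (r ^ Module.finrank ℝ E)⁻¹ * (hatConst E * hat (r⁻¹ • u))

variable {r : ℝ}

theorem bump_nonneg (hr : 0 < r) (u : E) : 0 ≤ bump r u := by
  have := hatConst_pos E
  have := hat_nonneg (r⁻¹ • u)
  unfold bump; positivity

theorem continuous_bump : Continuous (bump r : E → ℝ) := by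
  have := continuous_hat (E := E)
  unfold bump; fun_prop

theorem bump_integral (hr : 0 < r) : Integrable (bump r : E → ℝ) ∧ ∫ u : E, bump r u = 1 := by
  have h := integrable_scaled (integrable_hat (E := E) |>.const_mul (hatConst E)) hr
  refine ⟨h.1, h.2.trans ?_⟩
  rw [integral_const_mul, hatConst, inv_mul_cancel₀ (integral_hat_pos E).ne']

theorem bump_le (hr : 0 < r) (u : E) :
    bump r u ≤ (r ^ Module.finrank ℝ E)⁻¹ * hatConst E := by
  have := hatConst_pos E
  have h := hat_le_one (r⁻¹ • u)
  unfold bump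
  exact mul_le_mul_of_nonneg_left (mul_le_of_le_one_right this.le h) (by positivity)

theorem norm_inv_smul_eq (hr : 0 < r) (u : E) : ‖r⁻¹ • u‖ = ‖u‖ / r := by
  rw [norm_smul, norm_inv, Real.norm_of_nonneg hr.le, inv_mul_eq_div]

theorem bump_eq_zero (hr : 0 < r) {u : E} (hu : r / 2 ≤ ‖u‖) : bump r u = 0 := by
  rw [bump, hat_eq_zero, mul_zero, mul_zero]
  rw [norm_inv_smul_eq hr, le_div_iff₀ hr]
  linarith

theorem inv_pow_le_poissonWeight (hr : 0 < r) {u : E} (hu : ‖u‖ ≤ r / 2) :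
    (r ^ Module.finrank ℝ E)⁻¹ ≤ 2 ^ (Module.finrank ℝ E + 1) * poissonWeight r u := by
  rw [poissonWeight, ← mul_div_assoc, le_div_iff₀ (by positivity)]
  calc (r ^ Module.finrank ℝ E)⁻¹ * (r + ‖u‖) ^ (Module.finrank ℝ E + 1)
      ≤ (r ^ Module.finrank ℝ E)⁻¹ * (2 * r) ^ (Module.finrank ℝ E + 1) := by
        gcongr; linarith
    _ = _ := by rw [mul_pow, pow_succ r]; field_simp

theorem bump_le_poissonWeight (hr : 0 < r) (u : E) :
    bump r u ≤ hatConst E * 2 ^ (Module.finrank ℝ E + 1) * poissonWeight r u := by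
  have hc := hatConst_pos E
  have hw := poissonWeight_nonneg hr u
  rcases le_total ‖u‖ (r / 2) with h | h
  · refine (bump_le hr u).trans ?_
    have := mul_le_mul_of_nonneg_left (inv_pow_le_poissonWeight hr h) hc.le
    linarith
  · rw [bump_eq_zero hr h]; positivity

/-- If one of the points has norm at most `r / 2`, its Poisson weight alone dominates `r ^ (-d)`;
otherwise both bumps vanish. -/
theorem abs_bump_sub_bump_le (hr : 0 < r) (u v : E) :
    |bump r u - bump r v| ≤ hatConst E * 2 ^ (Module.finrank ℝ E + 2) * (‖u - v‖ / r) *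
      (poissonWeight r u + poissonWeight r v) := by
  have hc := hatConst_pos E
  have hw := poissonWeight_nonneg hr u
  have hw' := poissonWeight_nonneg hr v
  have h1 : |bump r u - bump r v| ≤
      (r ^ Module.finrank ℝ E)⁻¹ * (hatConst E * (2 * (‖u - v‖ / r))) := by
    have e : bump r u - bump r v = (r ^ Module.finrank ℝ E)⁻¹ *
      (hatConst E * (hat (r⁻¹ • u) - hat (r⁻¹ • v))) := by unfold bump; ring
    rw [e, abs_mul, abs_mul, abs_of_pos hc, abs_of_pos (by positivity)]
    have h := abs_hat_sub_hat_le (r⁻¹ • u) (r⁻¹ • v)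
    rw [← smul_sub, norm_inv_smul_eq hr] at h
    gcongr
  have key : (r ^ Module.finrank ℝ E)⁻¹ ≤ 2 ^ (Module.finrank ℝ E + 1) *
      (poissonWeight r u + poissonWeight r v) → |bump r u - bump r v| ≤
      hatConst E * 2 ^ (Module.finrank ℝ E + 2) * (‖u - v‖ / r) *
      (poissonWeight r u + poissonWeight r v) := fun h => by
    refine h1.trans ?_
    calc _ ≤ (2 ^ (Module.finrank ℝ E + 1) * (poissonWeight r u + poissonWeight r v)) *
          (hatConst E * (2 * (‖u - v‖ / r))) := by gcongr
      _ = _ := by ring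
  rcases le_total ‖u‖ (r / 2) with h | h
  · refine key ((inv_pow_le_poissonWeight hr h).trans ?_)
    gcongr; linarith
  · rcases le_total ‖v‖ (r / 2) with h' | h'
    · refine key ((inv_pow_le_poissonWeight hr h').trans ?_)
      gcongr; linarith
    · rw [bump_eq_zero hr h, bump_eq_zero hr h', sub_zero, abs_zero]; positivity

/-- A bound interpolating between size and Lipschitz regularity. -/
theorem le_mul_sqrt_mul {x M v W : ℝ} (hv : 0 ≤ v) (hM : 0 ≤ M) (hW : 0 ≤ W)
    (h1 : x ≤ M * W) (h2 : x ≤ M * v * W) : x ≤ M * √v * W := by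
  rcases le_total v 1 with h | h
  · have : v ≤ √v := by
      rw [Real.le_sqrt hv hv]; nlinarith
    exact h2.trans (by gcongr)
  · have : 1 ≤ √v := by rwa [Real.one_le_sqrt]
    calc x ≤ M * 1 * W := by linarith
      _ ≤ _ := by gcongr

variable (ρ : ℝ) [hρ : Fact (0 < ρ)] {g : E → ℝ}

/-- The bump is bounded by a multiple of `r ^ (-d)` and lives on the half ball, whose `g`-mass is
controlled by `smooth ρ (k + 1) g`. Two more steps bring the index to `k + 3`, that of the weight in
the geometric lemma. -/
theorem IsTestFunction.abs_integral_bump_mul_le (hg : IsTestFunction g) (k : ℕ) (x : E) :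
    |∫ y, bump (scale ρ k) (x - y) * g y| ≤
      hatConst E * volume.real (Metric.closedBall (0 : E) 1) * 16 ^ Module.finrank ℝ E *
        smooth ρ (k + 3) g x := by
  have hr := scale_pos ρ k
  set r := scale ρ k with hrdef
  have hc := hatConst_pos E
  have h0 : 0 ≤ ∫ y, bump r (x - y) * g y := integral_nonneg fun y =>
    mul_nonneg (bump_nonneg hr _) (hg.nonneg y)
  have hB : MeasurableSet (Metric.closedBall x (r / 2)) := Metric.isClosed_closedBall.measurableSet
  have i1 : IntegrableOn g (Metric.closedBall x (r / 2)) :=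
    hg.continuous.continuousOn.integrableOn_compact (isCompact_closedBall _ _)
  rw [abs_of_nonneg h0]
  calc ∫ y, bump r (x - y) * g y
      ≤ ∫ y, (Metric.closedBall x (r / 2)).indicator
          (fun y => (r ^ Module.finrank ℝ E)⁻¹ * hatConst E * g y) y := by
        refine integral_mono ?_ (IntegrableOn.integrable_indicator (i1.const_mul _) hB) fun y => ?_
        · exact integrable_mul_of_compact (continuous_bump.comp (by fun_prop)) hg.continuous
            hg.hasCompactSupport
        · by_cases hy : y ∈ Metric.closedBall x (r / 2)
          · rw [Set.indicator_of_mem hy]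
            exact mul_le_mul_of_nonneg_right (bump_le hr _) (hg.nonneg y)
          · rw [Set.indicator_of_notMem hy]
            simp only [Metric.mem_closedBall, not_le, dist_comm y x, dist_eq_norm] at hy
            simp only
            rw [bump_eq_zero hr hy.le, zero_mul]
    _ = (r ^ Module.finrank ℝ E)⁻¹ * hatConst E * ∫ y in Metric.closedBall x (r / 2), g y := by
        rw [integral_indicator hB, integral_const_mul]
    _ ≤ (r ^ Module.finrank ℝ E)⁻¹ * hatConst E *
          (volume.real (Metric.closedBall (0 : E) r) * smooth ρ (k + 1) g x) := by
        have := setIntegral_closedBall_le_smooth ρ hg.continuous hg.nonneg k x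
        gcongr
    _ = hatConst E * volume.real (Metric.closedBall (0 : E) 1) * smooth ρ (k + 1) g x := by
        have e : volume.real (Metric.closedBall (0 : E) r) =
            r ^ Module.finrank ℝ E * volume.real (Metric.closedBall (0 : E) 1) := by
          rw [← volume_real_closedBall_mul 0 hr.le zero_le_one, mul_one]
        rw [e]
        field_simp
    _ ≤ hatConst E * volume.real (Metric.closedBall (0 : E) 1) *
          (16 ^ Module.finrank ℝ E * smooth ρ (k + 3) g x) := by
        have := smooth_succ_le_smooth ρ hg.continuous hg.nonneg k (x := x) (y := x) (by
          rw [sub_self, norm_zero]; positivity)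
        gcongr
    _ = _ := by ring

end Bump

/-! ### Splitting the kernel into a cancelling part and a flatness part -/

section Theta

variable {E : Type*} [NormedAddCommGroup E] [InnerProductSpace ℝ E] [FiniteDimensional ℝ E]
  [MeasurableSpace E] [BorelSpace E]

/-- A kernel of order `-(d + 1)` on `E × ℝ` whose integrals over the graphs of affine functions
vanish. -/
structure IsFlatKernel (κ : E → ℝ → ℝ) (B : ℝ) : Prop where
  measurable : Measurable (Function.uncurry κ)
  size : ∀ u s, 0 < ‖u‖ + |s| → |κ u s| ≤ B / (‖u‖ + |s|) ^ (Module.finrank ℝ E + 1)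
  diff : ∀ u s u' s' m, 0 < m → m ≤ ‖u‖ + |s| → m ≤ ‖u'‖ + |s'| →
    |κ u s - κ u' s'| ≤ B * (‖u - u'‖ + |s - s'|) / m ^ (Module.finrank ℝ E + 2)
  flat : ∀ (c : E) (t : ℝ), 0 < t → ∫ u, κ u (inner ℝ c u + t) = 0

/-- The kernel `t κ(x - y, A x - A y + t)`. -/
def theta (κ : E → ℝ → ℝ) (A : E → ℝ) (t : ℝ) (x y : E) : ℝ := t * κ (x - y) (A x - A y + t)

variable {κ : E → ℝ → ℝ} {B : ℝ} {A : E → ℝ} {L : ℝ} {t : ℝ}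

/-- Because `t ≤ |s + t| + L ‖u‖`, a point at height `t` over a Lipschitz graph cannot come closer
to its points than a fixed multiple of `t + ‖u‖`. -/
theorem add_le_mul_norm_add_abs (hL : 0 ≤ L) {u : E} {s : ℝ} (hs : |s| ≤ L * ‖u‖) :
    (t + ‖u‖) / (1 + L) ≤ ‖u‖ + |s + t| := by
  rw [div_le_iff₀ (by positivity)]
  have h1 : t ≤ |s + t| + |s| := by
    have := abs_sub (s + t) s
    rw [add_sub_cancel_left] at this
    exact (le_abs_self t).trans this
  have h2 : 0 ≤ |s + t| * L := by positivity
  nlinarith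

theorem IsFlatKernel.abs_theta_le (hκ : IsFlatKernel κ B) (hB : 0 ≤ B) (hL : 0 ≤ L)
    (ht : 0 < t) (hA : ∀ x y, |A x - A y| ≤ L * ‖x - y‖) (x y : E) :
    |theta κ A t x y| ≤
      B * (1 + L) ^ (Module.finrank ℝ E + 1) * poissonWeight t (x - y) := by
  have h := add_le_mul_norm_add_abs (t := t) hL (hA x y)
  have h0 : 0 < (t + ‖x - y‖) / (1 + L) := by positivity
  have h1 := hκ.size (x - y) (A x - A y + t) (h0.trans_le h)
  rw [theta, abs_mul, abs_of_pos ht]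
  calc t * |κ (x - y) (A x - A y + t)|
      ≤ t * (B / ((t + ‖x - y‖) / (1 + L)) ^ (Module.finrank ℝ E + 1)) := by
        refine mul_le_mul_of_nonneg_left (h1.trans ?_) ht.le
        gcongr
    _ = _ := by rw [poissonWeight, div_pow]; field_simp

/-- Interpolation between the size bound and a Lipschitz bound. In the latter, the smaller of the
two distances is the denominator of one of the two Poisson weights. -/
theorem IsFlatKernel.abs_theta_sub_theta_le (hκ : IsFlatKernel κ B) (hB : 0 ≤ B) (hL : 0 ≤ L)
    (ht : 0 < t) (hA : ∀ x y, |A x - A y| ≤ L * ‖x - y‖) (z x y : E) :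
    |theta κ A t z y - theta κ A t z x| ≤
      B * (1 + L) ^ (Module.finrank ℝ E + 3) * √(‖x - y‖ / t) *
        (poissonWeight t (z - y) + poissonWeight t (z - x)) := by
  have hw := poissonWeight_nonneg ht (z - y)
  have hw' := poissonWeight_nonneg ht (z - x)
  refine le_mul_sqrt_mul (by positivity) (by positivity) (by positivity) ?_ ?_
  · have h1 := hκ.abs_theta_le hB hL ht hA z y
    have h2 := hκ.abs_theta_le hB hL ht hA z x
    have h3 : (1 + L) ^ (Module.finrank ℝ E + 1) ≤ (1 + L) ^ (Module.finrank ℝ E + 3) :=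
      pow_le_pow_right₀ (by linarith) (by omega)
    refine (abs_sub _ _).trans ?_
    calc _ ≤ B * (1 + L) ^ (Module.finrank ℝ E + 1) *
          (poissonWeight t (z - y) + poissonWeight t (z - x)) := by linarith
      _ ≤ _ := by gcongr
  · set m₀ := min (t + ‖z - y‖) (t + ‖z - x‖) with hm₀
    have hm₀t : t ≤ m₀ := le_min (by linarith [norm_nonneg (z - y)])
      (by linarith [norm_nonneg (z - x)])
    have hm₀p : 0 < m₀ := ht.trans_le hm₀t
    have h1 := add_le_mul_norm_add_abs (t := t) hL (hA z y)
    have h2 := add_le_mul_norm_add_abs (t := t) hL (hA z x)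
    have hd := hκ.diff (z - y) (A z - A y + t) (z - x) (A z - A x + t) (m₀ / (1 + L))
      (by positivity)
      (le_trans (div_le_div_of_nonneg_right (min_le_left _ _) (by positivity)) h1)
      (le_trans (div_le_div_of_nonneg_right (min_le_right _ _) (by positivity)) h2)
    have e1 : z - y - (z - x) = x - y := by abel
    have e2 : A z - A y + t - (A z - A x + t) = A x - A y := by ring
    rw [e1, e2] at hd
    have h3 : t / m₀ ^ (Module.finrank ℝ E + 1) ≤
        poissonWeight t (z - y) + poissonWeight t (z - x) := by
      rcases min_choice (t + ‖z - y‖) (t + ‖z - x‖) with h | h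
      · have : t / m₀ ^ (Module.finrank ℝ E + 1) = poissonWeight t (z - y) := by
          rw [hm₀, h, poissonWeight]
        linarith
      · have : t / m₀ ^ (Module.finrank ℝ E + 1) = poissonWeight t (z - x) := by
          rw [hm₀, h, poissonWeight]
        linarith
    have e3 : theta κ A t z y - theta κ A t z x =
      t * (κ (z - y) (A z - A y + t) - κ (z - x) (A z - A x + t)) := by unfold theta; ring
    rw [e3, abs_mul, abs_of_pos ht]
    calc t * |κ (z - y) (A z - A y + t) - κ (z - x) (A z - A x + t)|
        ≤ t * (B * (‖x - y‖ + L * ‖x - y‖) / (m₀ / (1 + L)) ^ (Module.finrank ℝ E + 2)) := by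
          have := hA x y
          refine mul_le_mul_of_nonneg_left (hd.trans ?_) ht.le
          gcongr
      _ = B * (1 + L) ^ (Module.finrank ℝ E + 3) * (‖x - y‖ / m₀) *
            (t / m₀ ^ (Module.finrank ℝ E + 1)) := by
          rw [div_pow, pow_succ m₀ (_ + 1), pow_succ (1 + L) (_ + 2)]
          field_simp
      _ ≤ _ := by gcongr

theorem IsFlatKernel.measurable_theta (hκ : IsFlatKernel κ B) (hA : Measurable A) (t : ℝ) :
    Measurable (Function.uncurry (theta κ A t)) := by
  have h : Measurable fun p : E × E => (p.1 - p.2, A p.1 - A p.2 + t) := by fun_prop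
  exact (hκ.measurable.comp h).const_mul t

theorem measurable_of_lipschitz (hA : ∀ x y, |A x - A y| ≤ L * ‖x - y‖) : Measurable A :=
  (LipschitzWith.of_dist_le' (K := L) fun x y => by
    rw [Real.dist_eq, dist_eq_norm]; exact hA x y).continuous.measurable

theorem IsFlatKernel.isPoissonKernel_theta (hκ : IsFlatKernel κ B) (hB : 0 ≤ B) (hL : 0 ≤ L)
    (ht : 0 < t) (hA : ∀ x y, |A x - A y| ≤ L * ‖x - y‖) :
    IsPoissonKernel (theta κ A t) (B * (1 + L) ^ (Module.finrank ℝ E + 1)) t where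
  measurable := hκ.measurable_theta (measurable_of_lipschitz hA) t
  size := hκ.abs_theta_le hB hL ht hA

/-- The integral of the kernel `theta` over the second variable. -/
def thetaOne (κ : E → ℝ → ℝ) (A : E → ℝ) (t : ℝ) (x : E) : ℝ := ∫ y, theta κ A t x y

theorem IsFlatKernel.measurable_thetaOne (hκ : IsFlatKernel κ B) (hA : Measurable A) :
    Measurable (thetaOne κ A t) :=
  ((hκ.measurable_theta hA t).stronglyMeasurable.integral_prod_right).measurable

theorem IsFlatKernel.abs_thetaOne_le_const (hκ : IsFlatKernel κ B) (hB : 0 ≤ B) (hL : 0 ≤ L)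
    (ht : 0 < t) (hA : ∀ x y, |A x - A y| ≤ L * ‖x - y‖) (x : E) :
    |thetaOne κ A t x| ≤ B * (1 + L) ^ (Module.finrank ℝ E + 1) * weightConst E := by
  have h1 := abs_integral_le_of_abs_le (((integrable_poissonWeight ht).comp_sub_left x).const_mul
    (B * (1 + L) ^ (Module.finrank ℝ E + 1)))
    (Filter.Eventually.of_forall fun y => hκ.abs_theta_le hB hL ht hA x y)
  rw [integral_const_mul, integral_sub_left_eq_self (poissonWeight t) volume] at h1
  refine h1.trans ?_
  have := integral_poissonWeight_le (E := E) ht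
  gcongr

theorem HasBoundedGradient.abs_sub_le_mul' {a : E → E} (hA : HasBoundedGradient A a L) (x y : E) :
    |A x - A y| ≤ L * ‖x - y‖ := hA.abs_sub_le_mul y x

/-- Cancellation: the integral of the kernel is controlled by the deviation of `A` from any
affine function. -/
theorem IsFlatKernel.abs_thetaOne_le_flatness (hκ : IsFlatKernel κ B) (hB : 0 ≤ B) (ht : 0 < t)
    {a : E → E} (hA : HasBoundedGradient A a L) {c : E} (hc : ‖c‖ ≤ L) (x : E) :
    |thetaOne κ A t x| ≤ B * (1 + L) ^ (Module.finrank ℝ E + 2) * flatness A t c x := by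
  have hL := hA.nonneg
  have hcL : ∀ x y, |(inner ℝ c x : ℝ) - inner ℝ c y| ≤ L * ‖x - y‖ := fun x y => by
    rw [← inner_sub_right]
    exact (abs_real_inner_le_norm _ _).trans (by gcongr)
  have hθ := (hκ.isPoissonKernel_theta hB hL ht hA.abs_sub_le_mul').integrable ht x
  have hθ' := (hκ.isPoissonKernel_theta hB hL ht hcL).integrable ht x
  -- For the linear function of slope `c` the integral vanishes by `flat`, so only the difference of
  -- the two kernels matters; it is of order `-(d + 2)` times the deviation of `A`.
  have z : ∫ y, theta κ (fun y => inner ℝ c y) t x y = 0 := by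
    have h0 : ∫ u, t * κ u (inner ℝ c u + t) = 0 := by
      rw [integral_const_mul, hκ.flat c t ht, mul_zero]
    have h1 := integral_sub_left_eq_self (fun u => t * κ u (inner ℝ c u + t)) volume x
    rw [h0] at h1
    rw [← h1]
    refine integral_congr_ae (Filter.Eventually.of_forall fun y => ?_)
    simp only [theta, inner_sub_right]
  have e : thetaOne κ A t x = ∫ u, (theta κ A t x (x + u) -
      theta κ (fun y => inner ℝ c y) t x (x + u)) := by
    rw [integral_add_left_eq_self (fun y => theta κ A t x y -
      theta κ (fun y => inner ℝ c y) t x y) x, integral_sub hθ hθ', z, sub_zero, thetaOne]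
  rw [e, flatness, ← integral_const_mul]
  refine abs_integral_le_of_abs_le ((hA.integrable_flatness hc ht x).const_mul _)
    (Filter.Eventually.of_forall fun u => ?_)
  have m0 : 0 < (t + ‖u‖) / (1 + L) := by positivity
  have e0 : x - (x + u) = -u := by abel
  have b1 := add_le_mul_norm_add_abs (t := t) hL (hA.abs_sub_le_mul' x (x + u))
  have b2 := add_le_mul_norm_add_abs (t := t) hL (hcL x (x + u))
  rw [e0, norm_neg] at b1 b2
  have hd := hκ.diff (-u) (A x - A (x + u) + t) (-u) (inner ℝ c x - inner ℝ c (x + u) + t) _ m0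
    (by rw [norm_neg]; exact b1) (by rw [norm_neg]; exact b2)
  have e1 : A x - A (x + u) + t - (inner ℝ c x - inner ℝ c (x + u) + t) =
      -(A (x + u) - A x - inner ℝ c u) := by rw [inner_add_right]; ring
  rw [sub_self, norm_zero, zero_add, e1, abs_neg] at hd
  simp only [theta]
  rw [e0, ← mul_sub, abs_mul, abs_of_pos ht]
  have hfw : t / (t + ‖u‖) ^ (Module.finrank ℝ E + 2) ≤ flatWeight t u := by
    unfold flatWeight
    gcongr
    exact max_le (by linarith [norm_nonneg u]) (by linarith)
  calc _ ≤ t * (B * |A (x + u) - A x - inner ℝ c u| /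
        ((t + ‖u‖) / (1 + L)) ^ (Module.finrank ℝ E + 2)) := mul_le_mul_of_nonneg_left hd ht.le
    _ = B * (1 + L) ^ (Module.finrank ℝ E + 2) *
        ((t / (t + ‖u‖) ^ (Module.finrank ℝ E + 2)) * |A (x + u) - A x - inner ℝ c u|) := by
        rw [div_pow]; field_simp
    _ ≤ _ := by gcongr

/-- The kernel `theta` corrected to have mean value zero. -/
def thetaCorrected (κ : E → ℝ → ℝ) (A : E → ℝ) (t : ℝ) (x y : E) : ℝ :=
  theta κ A t x y - thetaOne κ A t x * bump t (x - y)

theorem memLp_of_test {g : E → ℝ} (hg : IsTestFunction g) : MemLp g 2 :=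
  hg.continuous.memLp_of_hasCompactSupport hg.hasCompactSupport

variable (E) in
/-- A bound for the size and regularity of the corrected kernels. -/
def correctedConst (B L : ℝ) : ℝ := B * (1 + L) ^ (Module.finrank ℝ E + 3) *
  (1 + weightConst E * (hatConst E * 2 ^ (Module.finrank ℝ E + 2)))

theorem correctedConst_pos (hB : 0 < B) (hL : 0 ≤ L) : 0 < correctedConst E B L := by
  have := weightConst_pos E
  have := hatConst_pos E
  unfold correctedConst; positivity

theorem IsFlatKernel.isPoissonKernel_thetaCorrected (hκ : IsFlatKernel κ B) (hB : 0 < B)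
    (hL : 0 ≤ L) (ht : 0 < t) (hA : ∀ x y, |A x - A y| ≤ L * ‖x - y‖) :
    IsPoissonKernel (thetaCorrected κ A t) (correctedConst E B L) t where
  measurable := by
    have hAm := measurable_of_lipschitz hA
    have h1 := hκ.measurable_theta hAm t
    have h2 : Measurable fun p : E × E => thetaOne κ A t p.1 :=
      (hκ.measurable_thetaOne hAm).comp measurable_fst
    have h3 : Measurable fun p : E × E => bump t (p.1 - p.2) :=
      (continuous_bump.comp (by fun_prop)).measurable
    exact h1.sub (h2.mul h3)
  size x y := by
    have h1 := hκ.abs_theta_le hB.le hL ht hA x y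
    have h2 := hκ.abs_thetaOne_le_const hB.le hL ht hA x
    have h3 := bump_le_poissonWeight ht (x - y)
    have h4 := bump_nonneg ht (x - y)
    have hw := poissonWeight_nonneg ht (x - y)
    have hc := weightConst_pos E
    have hh := hatConst_pos E
    have h5 : (1 + L) ^ (Module.finrank ℝ E + 1) ≤ (1 + L) ^ (Module.finrank ℝ E + 3) :=
      pow_le_pow_right₀ (by linarith) (by omega)
    have h6 : (2 : ℝ) ^ (Module.finrank ℝ E + 1) ≤ 2 ^ (Module.finrank ℝ E + 2) :=
      pow_le_pow_right₀ (by norm_num) (by omega)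
    refine (abs_sub _ _).trans ?_
    rw [abs_mul, abs_of_nonneg h4]
    calc _ ≤ B * (1 + L) ^ (Module.finrank ℝ E + 3) * poissonWeight t (x - y) +
          (B * (1 + L) ^ (Module.finrank ℝ E + 3) * weightConst E) *
          (hatConst E * 2 ^ (Module.finrank ℝ E + 2) * poissonWeight t (x - y)) := by
          refine add_le_add (h1.trans (by gcongr)) (mul_le_mul (h2.trans (by gcongr))
            (h3.trans (by gcongr)) h4 (by positivity))
      _ = _ := by rw [correctedConst]; ring

theorem IsFlatKernel.abs_thetaCorrected_sub_le (hκ : IsFlatKernel κ B) (hB : 0 < B)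
    (hL : 0 ≤ L) (ht : 0 < t) (hA : ∀ x y, |A x - A y| ≤ L * ‖x - y‖) (z x y : E) :
    |thetaCorrected κ A t z y - thetaCorrected κ A t z x| ≤
      correctedConst E B L * √(‖x - y‖ / t) *
        (poissonWeight t (z - y) + poissonWeight t (z - x)) := by
  have h1 := hκ.abs_theta_sub_theta_le hB.le hL ht hA z x y
  have h2 := hκ.abs_thetaOne_le_const hB.le hL ht hA z
  have hw := poissonWeight_nonneg ht (z - y)
  have hw' := poissonWeight_nonneg ht (z - x)
  have hc := weightConst_pos E
  have hh := hatConst_pos E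
  have h3 : |bump t (z - y) - bump t (z - x)| ≤ hatConst E * 2 ^ (Module.finrank ℝ E + 2) *
      √(‖x - y‖ / t) * (poissonWeight t (z - y) + poissonWeight t (z - x)) := by
    refine le_mul_sqrt_mul (by positivity) (by positivity) (by positivity) ?_ ?_
    · have b1 := bump_le_poissonWeight ht (z - y)
      have b2 := bump_le_poissonWeight ht (z - x)
      have b3 := bump_nonneg ht (z - y)
      have b4 := bump_nonneg ht (z - x)
      have h6 : (2 : ℝ) ^ (Module.finrank ℝ E + 1) ≤ 2 ^ (Module.finrank ℝ E + 2) :=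
        pow_le_pow_right₀ (by norm_num) (by omega)
      refine (abs_sub _ _).trans ?_
      rw [abs_of_nonneg b3, abs_of_nonneg b4]
      calc _ ≤ hatConst E * 2 ^ (Module.finrank ℝ E + 1) *
            (poissonWeight t (z - y) + poissonWeight t (z - x)) := by linarith
        _ ≤ _ := by gcongr
    · have := abs_bump_sub_bump_le ht (z - y) (z - x)
      have e1 : z - y - (z - x) = x - y := by abel
      rwa [e1] at this
  have h5 : (1 + L) ^ (Module.finrank ℝ E + 1) ≤ (1 + L) ^ (Module.finrank ℝ E + 3) :=
    pow_le_pow_right₀ (by linarith) (by omega)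
  have e : thetaCorrected κ A t z y - thetaCorrected κ A t z x =
      (theta κ A t z y - theta κ A t z x) -
        thetaOne κ A t z * (bump t (z - y) - bump t (z - x)) := by
    unfold thetaCorrected; ring
  rw [e]
  refine (abs_sub _ _).trans ?_
  rw [abs_mul]
  calc _ ≤ B * (1 + L) ^ (Module.finrank ℝ E + 3) * √(‖x - y‖ / t) *
        (poissonWeight t (z - y) + poissonWeight t (z - x)) +
        (B * (1 + L) ^ (Module.finrank ℝ E + 3) * weightConst E) *
        (hatConst E * 2 ^ (Module.finrank ℝ E + 2) *
          √(‖x - y‖ / t) * (poissonWeight t (z - y) + poissonWeight t (z - x))) :=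
        add_le_add h1 (mul_le_mul (h2.trans (by gcongr)) h3 (abs_nonneg _) (by positivity))
    _ = _ := by rw [correctedConst]; ring

theorem IsFlatKernel.integral_thetaCorrected (hκ : IsFlatKernel κ B) (hB : 0 < B)
    (hL : 0 ≤ L) (ht : 0 < t) (hA : ∀ x y, |A x - A y| ≤ L * ‖x - y‖) (x : E) :
    ∫ y, thetaCorrected κ A t x y = 0 := by
  have i1 := (hκ.isPoissonKernel_theta hB.le hL ht hA).integrable ht x
  obtain ⟨i2, e2⟩ := bump_integral (E := E) ht
  unfold thetaCorrected
  rw [integral_sub i1 ((i2.comp_sub_left x).const_mul _), integral_const_mul,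
    integral_sub_left_eq_self (bump t) volume, e2, mul_one, thetaOne, sub_self]

variable (E) in
/-- The discrete square function estimate for smooth graphs and test functions. -/
theorem exists_sum_integral_theta_sq_le (B L : ℝ) (hB : 0 < B) (hL : 0 ≤ L) :
    ∃ C : ℝ, 0 < C ∧ ∀ (ρ : ℝ) [Fact (0 < ρ)] (κ : E → ℝ → ℝ) (A : E → ℝ) (a : E → E) (g : E → ℝ),
      IsFlatKernel κ B → HasBoundedGradient A a L → IsTestFunction g → ∀ N : ℕ,
        ∑ k ∈ Finset.range N, ∫ x, kernelOp (theta κ A (scale ρ k)) g x ^ 2 ≤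
          C * ∫ x, g x ^ 2 := by
  obtain ⟨C₁, hC₁, hT⟩ := exists_sum_integral_kernelOp_sq_le E
  obtain ⟨C₂, hC₂, hG⟩ := exists_sum_scaleFlatness_sq_le E
  set D := correctedConst E B L
  have hD : 0 < D := correctedConst_pos hB hL
  set p : ℝ := hatConst E * volume.real (Metric.closedBall (0 : E) 1) * 16 ^ Module.finrank ℝ E
  have hp : 0 < p := by
    have := hatConst_pos E
    have := volume_real_closedBall_pos (0 : E) one_pos
    positivity
  set q : ℝ := B * (1 + L) ^ (Module.finrank ℝ E + 2)
  have hq : 0 < q := by positivity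
  refine ⟨2 * (C₁ * D ^ 2) + 2 * ((q * p) ^ 2 * (C₂ * L ^ 2)), by positivity, ?_⟩
  intro ρ hρ κ A a g hκ hA hg N
  have hr := fun k => scale_pos ρ k
  have hAl := hA.abs_sub_le_mul'
  have hg2 := memLp_of_test hg
  set G := ∫ x, g x ^ 2
  have hG0 : 0 ≤ G := integral_nonneg fun x => sq_nonneg _
  have h1 := hT ρ D (fun k => thetaCorrected κ A (scale ρ k)) hρ.out hD
    (fun k => hκ.isPoissonKernel_thetaCorrected hB hL (hr k) hAl)
    (fun k => hκ.integral_thetaCorrected hB hL (hr k) hAl)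
    (fun k => hκ.abs_thetaCorrected_sub_le hB hL (hr k) hAl) g hg2 N
  have h2 := hG ρ A a L g hA hg N
  have hstep : ∀ k, ∫ x, kernelOp (theta κ A (scale ρ k)) g x ^ 2 ≤
      2 * (∫ x, kernelOp (thetaCorrected κ A (scale ρ k)) g x ^ 2) +
      2 * ((q * p) ^ 2 * ∫ x, scaleFlatness ρ A a k x ^ 2 * smooth ρ (k + 3) g x ^ 2) := by
    intro k
    have hS := hκ.isPoissonKernel_thetaCorrected hB hL (hr k) hAl
    have i1 := (hS.memLp_kernelOp (hr k) hg2).integrable_sq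
    have hIc := hA.continuous_scaleFlatness ρ k
    have i2 := (hg.smoothed ρ (k + 3)).integrable_mul_sq
      (φ := fun x => scaleFlatness ρ A a k x ^ 2) (by fun_prop)
    have i3 := ((hκ.isPoissonKernel_theta hB.le hL (hr k) hAl).memLp_kernelOp (hr k)
      hg2).integrable_sq
    rw [← integral_const_mul, ← integral_const_mul, ← integral_const_mul,
      ← integral_add (i1.const_mul _) ((i2.const_mul _).const_mul _)]
    refine integral_mono i3 ((i1.const_mul _).add ((i2.const_mul _).const_mul _)) fun x => ?_
    have j1 := hS.integrable_mul (hr k) hg2 x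
    have j2 : Integrable fun y => bump (scale ρ k) (x - y) * g y :=
      integrable_mul_of_compact (continuous_bump.comp (by fun_prop)) hg.continuous
        hg.hasCompactSupport
    -- The first part falls under almost orthogonality, the second under the geometric lemma.
    have e : kernelOp (theta κ A (scale ρ k)) g x = kernelOp (thetaCorrected κ A (scale ρ k)) g x +
        thetaOne κ A (scale ρ k) x * ∫ y, bump (scale ρ k) (x - y) * g y := by
      rw [kernelOp, kernelOp, ← integral_const_mul, ← integral_add j1 (j2.const_mul _)]
      refine integral_congr_ae (Filter.Eventually.of_forall fun y => ?_)
      simp only [thetaCorrected]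
      ring
    -- The slope is free; `smooth ρ (k + 3) a x` turns the deviation into `scaleFlatness`.
    have b1 := hκ.abs_thetaOne_le_flatness hB.le (hr k) hA
      (norm_smooth_le ρ hA.norm_le (k + 3) x) x
    have b2 := hg.abs_integral_bump_mul_le ρ k x
    have s0 := scaleFlatness_nonneg ρ A a k x
    have b3 : |thetaOne κ A (scale ρ k) x * ∫ y, bump (scale ρ k) (x - y) * g y| ≤
        (q * scaleFlatness ρ A a k x) * (p * smooth ρ (k + 3) g x) := by
      rw [abs_mul]
      exact mul_le_mul b1 b2 (abs_nonneg _) (mul_nonneg hq.le s0)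
    have b4 := pow_le_pow_left₀ (abs_nonneg _) b3 2
    rw [sq_abs] at b4
    simp only
    rw [e]
    set u := kernelOp (thetaCorrected κ A (scale ρ k)) g x
    set w := thetaOne κ A (scale ρ k) x * ∫ y, bump (scale ρ k) (x - y) * g y
    have : (u + w) ^ 2 ≤ 2 * u ^ 2 + 2 * w ^ 2 := by nlinarith [sq_nonneg (u - w)]
    nlinarith
  refine (Finset.sum_le_sum fun k _ => hstep k).trans ?_
  rw [Finset.sum_add_distrib, ← Finset.mul_sum, ← Finset.mul_sum, ← Finset.mul_sum]
  have h3 := mul_le_mul_of_nonneg_left h2 (sq_nonneg (q * p))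
  linarith

end Theta

/-! ### From discrete scales to the continuous square function over Lipschitz graphs -/

section Energy

open Set Filter Topology

/-- Fatou's lemma for convergent sequences of functions with convergent bounds. -/
theorem lintegral_le_of_tendsto_of_le {α : Type*} [MeasurableSpace α] {μ : Measure α}
    {f : ℕ → α → ℝ≥0∞} {g : α → ℝ≥0∞} {c : ℕ → ℝ≥0∞} {b : ℝ≥0∞} (hf : ∀ m, Measurable (f m))
    (hfg : ∀ᵐ x ∂μ, Tendsto (fun m => f m x) atTop (𝓝 (g x))) (hc : ∀ m, ∫⁻ x, f m x ∂μ ≤ c m)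
    (hb : Tendsto c atTop (𝓝 b)) : ∫⁻ x, g x ∂μ ≤ b := by
  calc ∫⁻ x, g x ∂μ = ∫⁻ x, liminf (fun m => f m x) atTop ∂μ :=
        lintegral_congr_ae (hfg.mono fun x hx => hx.liminf_eq.symm)
    _ ≤ liminf (fun m => ∫⁻ x, f m x ∂μ) atTop := lintegral_liminf_le hf
    _ ≤ liminf c atTop := liminf_le_liminf (Eventually.of_forall hc)
    _ = b := hb.liminf_eq

/-- Invariance of `dt / t` under dilations. -/
theorem setLIntegral_Ioc_div_eq (h : ℝ → ℝ≥0∞) {r a b : ℝ} (hr : 0 < r) :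
    ∫⁻ t in Ioc (r * a) (r * b), h t / ENNReal.ofReal t =
      ∫⁻ s in Ioc a b, h (r * s) / ENNReal.ofReal s := by
  have himg : Ioc (r * a) (r * b) = (fun s => r * s) '' Ioc a b :=
    (image_mul_left_Ioc hr a b).symm
  rw [himg, lintegral_image_eq_lintegral_abs_deriv_mul (f' := fun _ => r) measurableSet_Ioc
    (fun s _ => by simpa using ((hasDerivAt_id s).const_mul r).hasDerivWithinAt)
    (mul_right_injective₀ hr.ne').injOn]
  refine lintegral_congr fun s => ?_
  rw [abs_of_pos hr, ENNReal.ofReal_mul hr.le, div_eq_mul_inv, ENNReal.mul_inv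
    (Or.inl (by simpa using hr)) (Or.inl ENNReal.ofReal_ne_top), div_eq_mul_inv]
  have : ENNReal.ofReal r * (ENNReal.ofReal r)⁻¹ = 1 :=
    ENNReal.mul_inv_cancel (by simpa using hr) ENNReal.ofReal_ne_top
  calc _ = (ENNReal.ofReal r * (ENNReal.ofReal r)⁻¹) * (h (r * s) * (ENNReal.ofReal s)⁻¹) := by ring
    _ = _ := by rw [this, one_mul]

/-- Uniform bounds for the dyadic sums of a function bound its integral against `dt / t`. -/
theorem lintegral_Ioi_div_le {h : ℝ → ℝ≥0∞} (hm : Measurable h) {D : ℝ≥0∞}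
    (H : ∀ r, 0 < r → ∀ N, ∑ k ∈ Finset.range N, h (r * 4 ^ k) ≤ D) :
    ∫⁻ t in Ioi 0, h t / ENNReal.ofReal t ≤ 3 * D := by
  have hU : Ioi (0 : ℝ) ⊆ ⋃ k : ℤ, Ioc ((4 : ℝ) ^ k * 1) ((4 : ℝ) ^ k * 4) := fun t ht => by
    obtain ⟨k, hk⟩ := exists_mem_Ioc_zpow ht (y := (4 : ℝ)) (by norm_num)
    rw [zpow_add_one₀ (by norm_num)] at hk
    exact mem_iUnion.2 ⟨k, by rwa [mul_one]⟩
  -- A finite set of integers lies between `-m` and `m`, and the hypothesis applies from the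
  -- starting scale `s / 4 ^ m`. Its uniformity in `r` is what admits negative exponents.
  have hsum : ∀ s, 0 < s → ∑' k : ℤ, h ((4 : ℝ) ^ k * s) ≤ D := fun s hs => by
    refine ENNReal.summable.tsum_le_of_sum_le fun F => ?_
    obtain ⟨m, hm⟩ : ∃ m : ℕ, ∀ k ∈ F, k.natAbs ≤ m :=
      ⟨F.sup Int.natAbs, fun k hk => Finset.le_sup hk⟩
    calc ∑ k ∈ F, h ((4 : ℝ) ^ k * s)
        ≤ ∑ k ∈ (Finset.range (2 * m + 1)).image fun j : ℕ => (j : ℤ) - m, h ((4 : ℝ) ^ k * s) := by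
          refine Finset.sum_le_sum_of_subset fun k hk => ?_
          have := hm k hk
          refine Finset.mem_image.2 ⟨(k + m).toNat, Finset.mem_range.2 (by omega), by omega⟩
      _ = ∑ j ∈ Finset.range (2 * m + 1), h (s * (4 ^ m)⁻¹ * 4 ^ j) := by
          rw [Finset.sum_image fun i _ j _ hij => by simpa using hij]
          refine Finset.sum_congr rfl fun j _ => ?_
          rw [zpow_sub₀ (by norm_num), zpow_natCast, zpow_natCast]
          congr 1
          field_simp
      _ ≤ D := H _ (by positivity) _
  calc ∫⁻ t in Ioi 0, h t / ENNReal.ofReal t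
      ≤ ∫⁻ t in ⋃ k : ℤ, Ioc ((4 : ℝ) ^ k * 1) ((4 : ℝ) ^ k * 4), h t / ENNReal.ofReal t :=
        lintegral_mono_set hU
    _ ≤ ∑' k : ℤ, ∫⁻ t in Ioc ((4 : ℝ) ^ k * 1) ((4 : ℝ) ^ k * 4), h t / ENNReal.ofReal t :=
        lintegral_iUnion_le _ _
    _ = ∫⁻ s in Ioc 1 4, ∑' k : ℤ, h ((4 : ℝ) ^ k * s) / ENNReal.ofReal s := by
        rw [lintegral_tsum fun k => Measurable.aemeasurable (by fun_prop)]
        exact tsum_congr fun k => setLIntegral_Ioc_div_eq h (by positivity)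
    _ ≤ ∫⁻ s in Ioc (1 : ℝ) 4, D := by
        refine setLIntegral_mono measurable_const fun s hs => ?_
        simp_rw [div_eq_mul_inv]
        rw [ENNReal.tsum_mul_right]
        calc _ ≤ D * 1 := by
              gcongr
              · exact hsum s (by linarith [hs.1])
              · rw [ENNReal.inv_le_one]
                exact ENNReal.one_le_ofReal.2 hs.1.le
          _ = D := mul_one D
    -- The factor `3` is the length of the interval from `1` to `4`; `1 / s` was bounded by `1`.
    _ = 3 * D := by
        rw [setLIntegral_const, Real.volume_Ioc, mul_comm]
        norm_num

variable {E : Type*} [NormedAddCommGroup E] [InnerProductSpace ℝ E] [FiniteDimensional ℝ E]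
  [MeasurableSpace E] [BorelSpace E] {F : Type*} [NormedAddCommGroup F] [NormedSpace ℝ F]

/-- The potential of the density `g` on the graph of `A`, at height `p.2` above the graph. -/
def potential (κ : E → ℝ → ℝ) (A : E → ℝ) (g : E → F) (p : E × ℝ) : F :=
  ∫ y, κ (p.1 - y) (A p.1 - A y + p.2) • g y

/-- The square function of the potential above the graph. -/
def upperEnergy (κ : E → ℝ → ℝ) (A : E → ℝ) (g : E → F) : ℝ≥0∞ :=
  ∫⁻ p, ENNReal.ofReal p.2 * ‖potential κ A g p‖ₑ ^ 2
    ∂((volume : Measure E).prod (volume.restrict (Ioi (0 : ℝ))))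

variable {κ : E → ℝ → ℝ} {B : ℝ} {A : E → ℝ} {L : ℝ}

theorem ae_prod_restrict_Ioi :
    ∀ᵐ p ∂((volume : Measure E).prod (volume.restrict (Ioi (0 : ℝ)))), 0 < p.2 := by
  have : (volume : Measure E).prod (volume.restrict (Ioi (0 : ℝ))) =
      (volume.prod volume).restrict (univ ×ˢ Ioi 0) := by
    rw [← Measure.prod_restrict, Measure.restrict_univ]
  rw [this]
  filter_upwards [ae_restrict_mem (MeasurableSet.univ.prod measurableSet_Ioi)] with p hp
  exact hp.2

theorem stronglyMeasurable_potential (hκ : Measurable (Function.uncurry κ)) (hA : Measurable A)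
    {g : E → F} (hg : StronglyMeasurable g) : StronglyMeasurable (potential κ A g) := by
  have h : Measurable fun q : (E × ℝ) × E => (q.1.1 - q.2, A q.1.1 - A q.2 + q.1.2) := by fun_prop
  exact ((hκ.comp h).stronglyMeasurable.smul (hg.comp_measurable measurable_snd)
    ).integral_prod_right'

theorem measurable_energyDensity (hκ : Measurable (Function.uncurry κ)) (hA : Measurable A)
    {g : E → F} (hg : StronglyMeasurable g) :
    Measurable fun p : E × ℝ => ENNReal.ofReal p.2 * ‖potential κ A g p‖ₑ ^ 2 := by
  have := (stronglyMeasurable_potential hκ hA hg).enorm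
  fun_prop

theorem mul_potential_eq (t : ℝ) (g : E → ℝ) (x : E) :
    t * potential κ A g (x, t) = kernelOp (theta κ A t) g x := by
  rw [potential, kernelOp, ← integral_const_mul]
  refine integral_congr_ae (Eventually.of_forall fun y => ?_)
  simp only [theta, smul_eq_mul, mul_assoc]

theorem ofReal_mul_potential_eq {t : ℝ} (ht : 0 < t) (g : E → ℝ) (x : E) :
    ENNReal.ofReal t * ‖potential κ A g (x, t)‖ₑ ^ 2 =
      ‖kernelOp (theta κ A t) g x‖ₑ ^ 2 / ENNReal.ofReal t := by
  rw [← mul_potential_eq, enorm_mul, mul_pow, Real.enorm_of_nonneg ht.le, div_eq_mul_inv]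
  have : ENNReal.ofReal t * (ENNReal.ofReal t)⁻¹ = 1 :=
    ENNReal.mul_inv_cancel (by simpa using ht) ENNReal.ofReal_ne_top
  calc _ = (ENNReal.ofReal t * (ENNReal.ofReal t)⁻¹) *
        (ENNReal.ofReal t * ‖potential κ A g (x, t)‖ₑ ^ 2) := by rw [this, one_mul]
    _ = _ := by ring

theorem lintegral_enorm_sq_eq {α : Type*} [MeasurableSpace α] {μ : Measure α} {f : α → ℝ}
    (hf : MemLp f 2 μ) : ∫⁻ x, ‖f x‖ₑ ^ 2 ∂μ = ENNReal.ofReal (∫ x, f x ^ 2 ∂μ) := by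
  rw [ofReal_integral_eq_lintegral_ofReal hf.integrable_sq
    (Eventually.of_forall fun x => sq_nonneg _)]
  refine lintegral_congr fun x => ?_
  rw [← ofReal_norm, ← ENNReal.ofReal_pow (norm_nonneg _), Real.norm_eq_abs, sq_abs]

theorem IsTestFunction.memLp {g : E → ℝ} (hg : IsTestFunction g) : MemLp g 2 :=
  hg.continuous.memLp_of_hasCompactSupport hg.hasCompactSupport

variable (E) in
/-- The square function bound for smooth graphs and test functions. -/
theorem exists_upperEnergy_le_of_gradient (B L : ℝ) (hB : 0 < B) (hL : 0 ≤ L) :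
    ∃ C : ℝ, 0 < C ∧ ∀ (κ : E → ℝ → ℝ) (A : E → ℝ) (a : E → E) (g : E → ℝ), IsFlatKernel κ B →
      HasBoundedGradient A a L → IsTestFunction g →
        upperEnergy κ A g ≤ ENNReal.ofReal C * ENNReal.ofReal (∫ x, g x ^ 2) := by
  obtain ⟨C, hC, H⟩ := exists_sum_integral_theta_sq_le E B L hB hL
  refine ⟨3 * C, by positivity, fun κ A a g hκ hA hg => ?_⟩
  have hAl : ∀ x y, |A x - A y| ≤ L * ‖x - y‖ := hA.abs_sub_le_mul'
  have hAm : Measurable A := measurable_of_lipschitz hAl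
  have hgm := hg.continuous.stronglyMeasurable
  have hkm : StronglyMeasurable fun p : ℝ × E => kernelOp (theta κ A p.1) g p.2 := by
    have h1 : Measurable fun q : (ℝ × E) × E => (q.1.2 - q.2, A q.1.2 - A q.2 + q.1.1) := by
      fun_prop
    have h2 : Measurable fun q : (ℝ × E) × E => theta κ A q.1.1 q.1.2 q.2 * g q.2 := by
      have h3 := hκ.measurable.comp h1
      have h4 := hg.continuous.measurable
      exact ((measurable_fst.comp measurable_fst).mul h3).mul (h4.comp measurable_snd)
    exact h2.stronglyMeasurable.integral_prod_right'
  set h : ℝ → ℝ≥0∞ := fun t => ∫⁻ x, ‖kernelOp (theta κ A t) g x‖ₑ ^ 2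
  have hm : Measurable h := (hkm.enorm.pow_const 2).lintegral_prod_right'
  have hD : ∀ r, 0 < r → ∀ N, ∑ k ∈ Finset.range N, h (r * 4 ^ k) ≤
      ENNReal.ofReal (C * ∫ x, g x ^ 2) := fun r hr N => by
    have : Fact (0 < r) := ⟨hr⟩
    refine le_trans (le_of_eq ?_) (ENNReal.ofReal_le_ofReal (H r κ A a g hκ hA hg N))
    rw [ENNReal.ofReal_sum_of_nonneg fun k _ => integral_nonneg fun x => sq_nonneg _]
    exact Finset.sum_congr rfl fun k _ => lintegral_enorm_sq_eq
      ((hκ.isPoissonKernel_theta hB.le hL (scale_pos r k) hAl).memLp_kernelOp (scale_pos r k)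
        hg.memLp)
  calc upperEnergy κ A g = ∫⁻ t in Ioi (0 : ℝ), ∫⁻ x : E,
        ENNReal.ofReal t * ‖potential κ A g (x, t)‖ₑ ^ 2 :=
        lintegral_prod_symm _ (measurable_energyDensity hκ.measurable hAm hgm).aemeasurable
    _ = ∫⁻ t in Ioi (0 : ℝ), h t / ENNReal.ofReal t := by
        refine setLIntegral_congr_fun measurableSet_Ioi fun t ht => ?_
        simp_rw [ofReal_mul_potential_eq ht, div_eq_mul_inv]
        exact lintegral_mul_const' _ _ (by simpa using ht)
    _ ≤ 3 * ENNReal.ofReal (C * ∫ x, g x ^ 2) := lintegral_Ioi_div_le hm hD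
    _ = _ := by
        rw [ENNReal.ofReal_mul hC.le, ENNReal.ofReal_mul (by norm_num), mul_assoc]
        norm_num

/-- A Lipschitz function is a pointwise limit of smooth functions with the same Lipschitz
constant. -/
theorem exists_seq_hasBoundedGradient (hL : 0 ≤ L) (hA : ∀ x y, |A x - A y| ≤ L * ‖x - y‖) :
    ∃ (Am : ℕ → E → ℝ) (a : ℕ → E → E), (∀ m, HasBoundedGradient (Am m) (a m) L) ∧
      ∀ x, Tendsto (fun m => Am m x) atTop (𝓝 (A x)) := by
  have hAc : Continuous A := (LipschitzWith.of_dist_le' (K := L) fun x y => by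
    rw [Real.dist_eq, dist_eq_norm]; exact hA x y).continuous
  set φ : ℕ → ContDiffBump (0 : E) := fun m =>
    ⟨1 / (m + 1 : ℝ), 2 / (m + 1 : ℝ), by positivity, by gcongr; norm_num⟩
  set Am : ℕ → E → ℝ := fun m =>
    convolution ((φ m).normed volume) A (ContinuousLinearMap.lsmul ℝ ℝ) volume
  have hcs : ∀ m, HasCompactSupport ((φ m).normed volume) := fun m => (φ m).hasCompactSupport_normed
  have hsm : ∀ m, ContDiff ℝ 1 (Am m) := fun m =>
    (hcs m).contDiff_convolution_left (n := 1) _ (φ m).contDiff_normed hAc.locallyIntegrable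
  have hint : ∀ m x, Integrable fun u => (φ m).normed volume u * A (x - u) := fun m x =>
    Continuous.integrable_of_hasCompactSupport
      ((φ m).continuous_normed.mul (hAc.comp (by fun_prop))) ((hcs m).mul_right)
  have hlip : ∀ m x y, |Am m x - Am m y| ≤ L * ‖x - y‖ := fun m x y => by
    have e : Am m x - Am m y = ∫ u, (φ m).normed volume u * (A (x - u) - A (y - u)) := by
      simp only [Am, convolution, ContinuousLinearMap.lsmul_apply, smul_eq_mul, mul_sub]
      rw [integral_sub (hint m x) (hint m y)]
    rw [e]
    have h1 := abs_integral_le_of_abs_le (μ := volume)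
      (f := fun u => (φ m).normed volume u * (A (x - u) - A (y - u)))
      (((φ m).integrable_normed (μ := volume)).mul_const (L * ‖x - y‖))
      (Eventually.of_forall fun u => by
        have h0 := (φ m).nonneg_normed (μ := volume) u
        have := hA (x - u) (y - u)
        rw [sub_sub_sub_cancel_right] at this
        rw [abs_mul, abs_of_nonneg h0]
        gcongr)
    rwa [integral_mul_const, (φ m).integral_normed, one_mul] at h1
  have hdiff : ∀ m x, DifferentiableAt ℝ (Am m) x := fun m x =>
    (hsm m).differentiable one_ne_zero x
  refine ⟨Am, fun m x => gradient (Am m) x, fun m => ⟨?_, fun x => ?_, fun x => ?_⟩, fun x => ?_⟩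
  · exact (LinearIsometryEquiv.continuous _).comp ((hsm m).continuous_fderiv one_ne_zero)
  · change ‖gradient (Am m) x‖ ≤ L
    rw [gradient, LinearIsometryEquiv.norm_map]
    have hl : LipschitzWith L.toNNReal (Am m) := LipschitzWith.of_dist_le' fun x y => by
      rw [Real.dist_eq, dist_eq_norm]; exact hlip m x y
    simpa [hL] using norm_fderiv_le_of_lipschitz ℝ hl (x₀ := x)
  · exact (hdiff m x).hasGradientAt.hasFDerivAt
  · refine ContDiffBump.convolution_tendsto_right_of_continuous ?_ hAc x
    have := (tendsto_one_div_add_atTop_nhds_zero_nat (𝕜 := ℝ)).const_mul 2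
    simpa [φ, div_eq_mul_inv] using this

theorem IsFlatKernel.memLp_slice (hκ : IsFlatKernel κ B) (hB : 0 ≤ B) (hL : 0 ≤ L)
    (hA : ∀ x y, |A x - A y| ≤ L * ‖x - y‖) {p : E × ℝ} (hp : 0 < p.2) :
    MemLp (fun y => κ (p.1 - y) (A p.1 - A y + p.2)) 2 := by
  have hθ := hκ.isPoissonKernel_theta hB hL hp hA
  have h1 : MemLp (fun y => B * (1 + L) ^ (Module.finrank ℝ E + 1) *
      poissonWeight p.2 (p.1 - y)) 2 :=
    ((memLp_two_poissonWeight hp).comp_measurePreserving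
      (Measure.measurePreserving_sub_left volume p.1)).const_mul _
  have h2 : MemLp (fun y => theta κ A p.2 p.1 y) 2 := h1.mono
    (hθ.measurable.comp measurable_prodMk_left).aestronglyMeasurable
    (Filter.Eventually.of_forall fun y => (hθ.size p.1 y).trans (le_abs_self _))
  have h3 := h2.const_mul p.2⁻¹
  refine h3.ae_eq (Eventually.of_forall fun y => ?_)
  simp only [theta]
  field_simp

theorem IsFlatKernel.integrable_smul (hκ : IsFlatKernel κ B) (hB : 0 ≤ B) (hL : 0 ≤ L)
    (hA : ∀ x y, |A x - A y| ≤ L * ‖x - y‖) {p : E × ℝ} (hp : 0 < p.2) {g : E → F}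
    (hg : MemLp g 2) : Integrable fun y => κ (p.1 - y) (A p.1 - A y + p.2) • g y := by
  have := hg.smul (hκ.memLp_slice hB hL hA hp) (p := 2) (q := 2) (r := 1)
  exact memLp_one_iff_integrable.1 this

variable (E) in
/-- The square function bound for Lipschitz graphs and test functions. -/
theorem exists_upperEnergy_le_of_lipschitz (B L : ℝ) (hB : 0 < B) (hL : 0 ≤ L) :
    ∃ C : ℝ, 0 < C ∧ ∀ (κ : E → ℝ → ℝ) (A : E → ℝ) (g : E → ℝ), IsFlatKernel κ B →
      (∀ x y, |A x - A y| ≤ L * ‖x - y‖) → IsTestFunction g →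
        upperEnergy κ A g ≤ ENNReal.ofReal C * ENNReal.ofReal (∫ x, g x ^ 2) := by
  obtain ⟨C, hC, H⟩ := exists_upperEnergy_le_of_gradient E B L hB hL
  refine ⟨C, hC, fun κ A g hκ hA hg => ?_⟩
  obtain ⟨Am, a, hAm, hlim⟩ := exists_seq_hasBoundedGradient hL hA
  have hAl : ∀ m x y, |Am m x - Am m y| ≤ L * ‖x - y‖ := fun m => (hAm m).abs_sub_le_mul'
  refine lintegral_le_of_tendsto_of_le (fun m => measurable_energyDensity hκ.measurable
    (measurable_of_lipschitz (hAl m)) hg.continuous.stronglyMeasurable) ?_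
    (fun m => H κ (Am m) (a m) g hκ (hAm m) hg) tendsto_const_nhds
  filter_upwards [ae_prod_restrict_Ioi] with p hp
  -- Dominated convergence: the majorant given by `abs_theta_le` depends on the common Lipschitz
  -- constant only, not on `m`.
  have hpot : Tendsto (fun m => potential κ (Am m) g p) atTop (𝓝 (potential κ A g p)) := by
    have h1 : MemLp (fun y => p.2⁻¹ * (B * (1 + L) ^ (Module.finrank ℝ E + 1) *
        poissonWeight p.2 (p.1 - y))) 2 :=
      (((memLp_two_poissonWeight hp).comp_measurePreserving
        (Measure.measurePreserving_sub_left volume p.1)).const_mul _).const_mul _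
    refine tendsto_integral_of_dominated_convergence _
      (fun m => (hκ.integrable_smul hB.le hL (hAl m) hp hg.memLp).aestronglyMeasurable)
      (h1.integrable_fun_mul hg.memLp.norm) (fun m => Eventually.of_forall fun y => ?_)
      (Eventually.of_forall fun y => ?_)
    · have h2 := hκ.abs_theta_le hB.le hL hp (hAl m) p.1 y
      rw [theta, abs_mul, abs_of_pos hp] at h2
      rw [norm_smul, Real.norm_eq_abs]
      refine mul_le_mul_of_nonneg_right ?_ (norm_nonneg _)
      rwa [le_inv_mul_iff₀ hp]
    · refine Tendsto.smul_const ?_ _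
      have hm0 : 0 < (p.2 + ‖p.1 - y‖) / (1 + L) := by
        have := norm_nonneg (p.1 - y)
        positivity
      rw [tendsto_iff_dist_tendsto_zero]
      have hb : Tendsto (fun m => B * |Am m p.1 - Am m y + p.2 - (A p.1 - A y + p.2)| /
          ((p.2 + ‖p.1 - y‖) / (1 + L)) ^ (Module.finrank ℝ E + 2)) atTop
          (𝓝 (B * |A p.1 - A y + p.2 - (A p.1 - A y + p.2)| /
          ((p.2 + ‖p.1 - y‖) / (1 + L)) ^ (Module.finrank ℝ E + 2))) :=
        (((((hlim p.1).sub (hlim y)).add_const _).sub_const _).abs.const_mul B).div_const _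
      rw [sub_self, abs_zero, mul_zero, zero_div] at hb
      refine squeeze_zero (fun _ => dist_nonneg) (fun m => ?_) hb
      have hd := hκ.diff (p.1 - y) (Am m p.1 - Am m y + p.2) (p.1 - y) (A p.1 - A y + p.2) _ hm0
        (add_le_mul_norm_add_abs hL (hAl m p.1 y)) (add_le_mul_norm_add_abs hL (hA p.1 y))
      rwa [sub_self, norm_zero, zero_add] at hd
  exact ENNReal.Tendsto.const_mul ((ENNReal.continuous_pow 2).continuousAt.tendsto.comp
    (continuous_enorm.continuousAt.tendsto.comp hpot)) (Or.inr ENNReal.ofReal_ne_top)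

end Energy

/-! ### Complex square integrable densities and both sides of the graph -/

section FullEnergy

open Set Filter Topology

theorem lintegral_enorm_sq_eq_eLpNorm {α : Type*} [MeasurableSpace α] {μ : Measure α} {F : Type*}
    [NormedAddCommGroup F] (f : α → F) : ∫⁻ x, ‖f x‖ₑ ^ 2 ∂μ = eLpNorm f 2 μ ^ 2 := by
  have h := eLpNorm_nnreal_pow_eq_lintegral (f := f) (μ := μ) (p := 2) two_ne_zero
  simp only [NNReal.coe_ofNat, ENNReal.rpow_ofNat, ENNReal.coe_ofNat] at h
  exact h.symm

variable {E : Type*} [NormedAddCommGroup E] [InnerProductSpace ℝ E] [FiniteDimensional ℝ E]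
  [MeasurableSpace E] [BorelSpace E] {κ : E → ℝ → ℝ} {B : ℝ} {A : E → ℝ} {L : ℝ}

theorem ofReal_mul_enorm_sq {F : Type*} [NormedAddCommGroup F] {t : ℝ} (ht : 0 ≤ t) (z : F) :
    ENNReal.ofReal t * ‖z‖ₑ ^ 2 = ENNReal.ofReal (t * ‖z‖ ^ 2) := by
  rw [ENNReal.ofReal_mul ht, ENNReal.ofReal_pow (norm_nonneg z), ofReal_norm]

theorem isTestFunction_posPart {q : E → ℝ} (hq : Continuous q) (hc : HasCompactSupport q) :
    IsTestFunction fun x => max (q x) 0 where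
  continuous := hq.max continuous_const
  hasCompactSupport := hc.comp_left (g := fun s => max s 0) (by simp)
  nonneg _ := le_max_right _ _

/-- The potential of a complex density in terms of four real densities. -/
theorem IsFlatKernel.potential_eq (hκ : IsFlatKernel κ B) (hB : 0 ≤ B) (hL : 0 ≤ L)
    (hA : ∀ x y, |A x - A y| ≤ L * ‖x - y‖) {p : E × ℝ} (hp : 0 < p.2) {g : E → ℂ} {q : Fin 4 → E → ℝ}
    (hq : ∀ i, MemLp (q i) 2)
    (hg : ∀ y, g y = ((q 0 y - q 1 y : ℝ) : ℂ) + ((q 2 y - q 3 y : ℝ) : ℂ) * Complex.I) :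
    potential κ A g p = ((potential κ A (q 0) p - potential κ A (q 1) p : ℝ) : ℂ) +
      ((potential κ A (q 2) p - potential κ A (q 3) p : ℝ) : ℂ) * Complex.I := by
  have hi := fun i => hκ.integrable_smul hB hL hA hp (hq i)
  have h01 : Integrable fun y => κ (p.1 - y) (A p.1 - A y + p.2) • q 0 y -
    κ (p.1 - y) (A p.1 - A y + p.2) • q 1 y := (hi 0).sub (hi 1)
  have h23 : Integrable fun y => κ (p.1 - y) (A p.1 - A y + p.2) • q 2 y -
    κ (p.1 - y) (A p.1 - A y + p.2) • q 3 y := (hi 2).sub (hi 3)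
  simp only [potential]
  rw [← integral_sub (hi 0) (hi 1), ← integral_sub (hi 2) (hi 3), ← integral_complex_ofReal,
    ← integral_complex_ofReal, ← integral_mul_const, ← integral_add h01.ofReal
      (h23.ofReal.mul_const _)]
  refine integral_congr_ae (Eventually.of_forall fun y => ?_)
  simp only [hg, smul_eq_mul, Complex.real_smul]
  push_cast
  ring

theorem norm_sq_le_of_four (a b c d : ℝ) :
    ‖((a - b : ℝ) : ℂ) + ((c - d : ℝ) : ℂ) * Complex.I‖ ^ 2 ≤
      2 * (‖a‖ ^ 2 + ‖b‖ ^ 2 + ‖c‖ ^ 2 + ‖d‖ ^ 2) := by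
  rw [Complex.sq_norm, Complex.normSq_add_mul_I]
  simp only [Real.norm_eq_abs, sq_abs]
  nlinarith [sq_nonneg (a + b), sq_nonneg (c + d)]

/-- The estimate so far concerns nonnegative densities, so the positive and negative parts of the
real and imaginary parts are treated separately. -/
theorem exists_four_testFunctions {g : E → ℂ} (hg : Continuous g) (hgc : HasCompactSupport g) :
    ∃ q : Fin 4 → E → ℝ, (∀ i, IsTestFunction (q i)) ∧ (∀ i x, ‖q i x‖ ≤ ‖g x‖) ∧
      ∀ y, g y = ((q 0 y - q 1 y : ℝ) : ℂ) + ((q 2 y - q 3 y : ℝ) : ℂ) * Complex.I := by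
  have c1 : Continuous fun x => (g x).re := Complex.continuous_re.comp hg
  have c2 : Continuous fun x => (g x).im := Complex.continuous_im.comp hg
  have s1 : HasCompactSupport fun x => (g x).re := hgc.comp_left Complex.zero_re
  have s2 : HasCompactSupport fun x => (g x).im := hgc.comp_left Complex.zero_im
  have hq : ∀ i, IsTestFunction ((![fun x => max (g x).re 0, fun x => max (-(g x).re) 0,
      fun x => max (g x).im 0, fun x => max (-(g x).im) 0] : Fin 4 → E → ℝ) i) := by
    rw [Fin.forall_fin_succ, Fin.forall_fin_succ, Fin.forall_fin_succ, Fin.forall_fin_one]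
    exact ⟨isTestFunction_posPart c1 s1, isTestFunction_posPart c1.neg s1.neg,
      isTestFunction_posPart c2 s2, isTestFunction_posPart c2.neg s2.neg⟩
  refine ⟨_, hq, fun i x => ?_, fun y => ?_⟩
  · have h1 := Complex.abs_re_le_norm (g x)
    have h2 := Complex.abs_im_le_norm (g x)
    have h3 := norm_nonneg (g x)
    rw [Real.norm_of_nonneg ((hq i).nonneg x)]
    revert i
    rw [Fin.forall_fin_succ, Fin.forall_fin_succ, Fin.forall_fin_succ, Fin.forall_fin_one]
    exact ⟨max_le ((le_abs_self _).trans h1) h3, max_le ((neg_le_abs _).trans h1) h3,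
      max_le ((le_abs_self _).trans h2) h3, max_le ((neg_le_abs _).trans h2) h3⟩
  · have hm : ∀ s : ℝ, max s 0 - max (-s) 0 = s := fun s => by
      rcases le_total s 0 with h | h
      · rw [max_eq_right h, max_eq_left (by linarith)]; ring
      · rw [max_eq_left h, max_eq_right (by linarith)]; ring
    change g y = ((max (g y).re 0 - max (-(g y).re) 0 : ℝ) : ℂ) +
      ((max (g y).im 0 - max (-(g y).im) 0 : ℝ) : ℂ) * Complex.I
    rw [hm, hm, Complex.re_add_im]

variable (E) in
/-- The square function bound above a Lipschitz graph, for compactly supported densities. -/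
theorem exists_upperEnergy_le_of_hasCompactSupport (B L : ℝ) (hB : 0 < B) (hL : 0 ≤ L) :
    ∃ C : ℝ, 0 < C ∧ ∀ (κ : E → ℝ → ℝ) (A : E → ℝ) (g : E → ℂ), IsFlatKernel κ B →
      (∀ x y, |A x - A y| ≤ L * ‖x - y‖) → Continuous g → HasCompactSupport g →
        upperEnergy κ A g ≤ ENNReal.ofReal C * eLpNorm g 2 ^ 2 := by
  obtain ⟨C, hC, H⟩ := exists_upperEnergy_le_of_lipschitz E B L hB hL
  -- Here `8 = 2 · 4`: the factor in `norm_sq_le_of_four` times the number of densities.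
  refine ⟨8 * C, by positivity, fun κ A g hκ hA hg hgc => ?_⟩
  obtain ⟨q, hq, hqg, hgq⟩ := exists_four_testFunctions hg hgc
  have hbd : ∀ i, upperEnergy κ A (q i) ≤ ENNReal.ofReal C * eLpNorm g 2 ^ 2 := fun i => by
    refine (H κ A (q i) hκ hA (hq i)).trans ?_
    rw [← lintegral_enorm_sq_eq (hq i).memLp, lintegral_enorm_sq_eq_eLpNorm]
    gcongr
    exact eLpNorm_mono (hqg i)
  have hm : ∀ i, Measurable fun p : E × ℝ => ENNReal.ofReal p.2 * ‖potential κ A (q i) p‖ₑ ^ 2 :=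
    fun i => measurable_energyDensity hκ.measurable (measurable_of_lipschitz hA)
      (hq i).continuous.stronglyMeasurable
  have h1 : upperEnergy κ A g ≤ ∫⁻ p, 2 * ∑ i, ENNReal.ofReal p.2 * ‖potential κ A (q i) p‖ₑ ^ 2
        ∂((volume : Measure E).prod (volume.restrict (Ioi (0 : ℝ)))) := by
        refine lintegral_mono_ae ?_
        filter_upwards [ae_prod_restrict_Ioi] with p hp
        simp_rw [ofReal_mul_enorm_sq hp.le]
        rw [← ENNReal.ofReal_sum_of_nonneg fun i _ => by positivity,
          ← ENNReal.ofReal_ofNat, ← ENNReal.ofReal_mul (by norm_num)]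
        refine ENNReal.ofReal_le_ofReal ?_
        rw [hκ.potential_eq hB.le hL hA hp (fun i => (hq i).memLp) hgq, Fin.sum_univ_four]
        have := mul_le_mul_of_nonneg_left (norm_sq_le_of_four (potential κ A (q 0) p)
          (potential κ A (q 1) p) (potential κ A (q 2) p) (potential κ A (q 3) p)) hp.le
        linarith
  have h2 : ∫⁻ p, 2 * ∑ i, ENNReal.ofReal p.2 * ‖potential κ A (q i) p‖ₑ ^ 2
        ∂((volume : Measure E).prod (volume.restrict (Ioi (0 : ℝ)))) =
      2 * ∑ i, upperEnergy κ A (q i) := by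
    rw [lintegral_const_mul _ (Finset.measurable_fun_sum _ fun i _ => hm i),
      lintegral_finsetSum _ fun i _ => hm i]
    rfl
  have h3 : ∑ i, upperEnergy κ A (q i) ≤ 4 * (ENNReal.ofReal C * eLpNorm g 2 ^ 2) := by
    refine (Finset.sum_le_sum fun i _ => hbd i).trans (le_of_eq ?_)
    rw [Finset.sum_const, Finset.card_univ, Fintype.card_fin, nsmul_eq_mul]
    norm_num
  rw [h2] at h1
  refine h1.trans ((mul_le_mul_right h3 2).trans (le_of_eq ?_))
  rw [ENNReal.ofReal_mul (by norm_num), ENNReal.ofReal_ofNat, ← mul_assoc, ← mul_assoc]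
  norm_num

theorem enorm_integral_smul_le {α : Type*} [MeasurableSpace α] {μ : Measure α} {F : Type*}
    [NormedAddCommGroup F] [NormedSpace ℝ F] {k : α → ℝ} {f : α → F}
    (hk : AEStronglyMeasurable k μ) (hf : AEStronglyMeasurable f μ) :
    ‖∫ y, k y • f y ∂μ‖ₑ ≤ eLpNorm k 2 μ * eLpNorm f 2 μ := by
  refine (enorm_integral_le_lintegral_enorm _).trans ?_
  rw [← eLpNorm_one_eq_lintegral_enorm]
  exact eLpNorm_smul_le_mul_eLpNorm (p := 2) (q := 2) (r := 1) hf hk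

variable (E) in
/-- The square function bound above a Lipschitz graph. -/
theorem exists_upperEnergy_le (B L : ℝ) (hB : 0 < B) (hL : 0 ≤ L) :
    ∃ C : ℝ, 0 < C ∧ ∀ (κ : E → ℝ → ℝ) (A : E → ℝ) (g : E → ℂ), IsFlatKernel κ B →
      (∀ x y, |A x - A y| ≤ L * ‖x - y‖) → MemLp g 2 →
        upperEnergy κ A g ≤ ENNReal.ofReal C * eLpNorm g 2 ^ 2 := by
  obtain ⟨C, hC, H⟩ := exists_upperEnergy_le_of_hasCompactSupport E B L hB hL
  refine ⟨C, hC, fun κ A g hκ hA hg => ?_⟩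
  have hε : ∀ m : ℕ, ((m : ℝ≥0∞) + 1)⁻¹ ≠ 0 := fun m => by simp
  have hlim : Tendsto (fun m : ℕ => ((m : ℝ≥0∞) + 1)⁻¹) atTop (𝓝 0) := by
    have := (tendsto_add_atTop_iff_nat 1).2 ENNReal.tendsto_inv_nat_nhds_zero
    simpa using this
  choose gm hgc hgd hgm hgL using fun m => hg.exists_hasCompactSupport_eLpNorm_sub_le
    (by norm_num) (hε m)
  have hnorm : ∀ m, eLpNorm (gm m) 2 ≤ eLpNorm g 2 + ((m : ℝ≥0∞) + 1)⁻¹ := fun m => by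
    have h1 : gm m = g - (g - gm m) := by abel
    have h2 := eLpNorm_sub_le (p := 2) hg.aestronglyMeasurable
      (hg.sub (hgL m)).aestronglyMeasurable one_le_two
    rw [← h1] at h2
    exact h2.trans (add_le_add_right (hgd m) _)
  refine lintegral_le_of_tendsto_of_le
    (f := fun m p => ENNReal.ofReal p.2 * ‖potential κ A (gm m) p‖ₑ ^ 2) (c := fun m =>
      ENNReal.ofReal C * (eLpNorm g 2 + ((m : ℝ≥0∞) + 1)⁻¹) ^ 2)
    (fun m => measurable_energyDensity hκ.measurable
    (measurable_of_lipschitz hA) (hgm m).stronglyMeasurable) ?_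
    (fun m => (H κ A (gm m) hκ hA (hgm m) (hgc m)).trans (by gcongr; exact hnorm m)) ?_
  · filter_upwards [ae_prod_restrict_Ioi] with p hp
    -- For fixed `p` above the graph the kernel is square integrable, so convergence of the
    -- densities in `L²` gives pointwise convergence of the potentials, as Fatou's lemma requires.
    have hpot : Tendsto (fun m => potential κ A (gm m) p) atTop (𝓝 (potential κ A g p)) := by
      rw [tendsto_iff_edist_tendsto_0]
      have hk := hκ.memLp_slice hB.le hL hA hp
      have hb := ENNReal.Tendsto.const_mul hlim (Or.inr hk.eLpNorm_ne_top)
      rw [mul_zero] at hb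
      refine tendsto_of_tendsto_of_tendsto_of_le_of_le tendsto_const_nhds hb (fun _ => zero_le)
        fun m => ?_
      simp only
      have e : potential κ A g p - potential κ A (gm m) p =
          ∫ y, κ (p.1 - y) (A p.1 - A y + p.2) • (g - gm m) y := by
        rw [potential, potential, ← integral_sub (hκ.integrable_smul hB.le hL hA hp hg)
          (hκ.integrable_smul hB.le hL hA hp (hgL m))]
        simp only [Pi.sub_apply, smul_sub]
      rw [edist_comm, edist_eq_enorm_sub, e]
      refine (enorm_integral_smul_le hk.aestronglyMeasurable
        (hg.sub (hgL m)).aestronglyMeasurable).trans ?_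
      gcongr
      exact hgd m
    exact ENNReal.Tendsto.const_mul ((ENNReal.continuous_pow 2).continuousAt.tendsto.comp
      (continuous_enorm.continuousAt.tendsto.comp hpot)) (Or.inr ENNReal.ofReal_ne_top)
  · have h1 : Tendsto (fun m : ℕ => eLpNorm g 2 + ((m : ℝ≥0∞) + 1)⁻¹) atTop (𝓝 (eLpNorm g 2)) := by
      simpa using tendsto_const_nhds.add hlim
    exact ENNReal.Tendsto.const_mul ((ENNReal.continuous_pow 2).continuousAt.tendsto.comp h1)
      (Or.inr ENNReal.ofReal_ne_top)

variable (E) in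
/-- The square function bound on both sides of a Lipschitz graph. -/
theorem exists_lintegral_potential_le (B L : ℝ) (hB : 0 < B) (hL : 0 ≤ L) :
    ∃ C : ℝ, 0 < C ∧ ∀ (κ : E → ℝ → ℝ) (A : E → ℝ) (g : E → ℂ), IsFlatKernel κ B →
      IsFlatKernel (fun u s => κ u (-s)) B → (∀ x y, |A x - A y| ≤ L * ‖x - y‖) → MemLp g 2 →
        ∫⁻ p : E × ℝ, ENNReal.ofReal |p.2| * ‖potential κ A g p‖ₑ ^ 2 ≤
          ENNReal.ofReal C * eLpNorm g 2 ^ 2 := by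
  obtain ⟨C, hC, H⟩ := exists_upperEnergy_le E B L hB hL
  refine ⟨C + C, by positivity, fun κ A g hκ hκ' hA hg => ?_⟩
  have hA' : ∀ x y, |(fun x => -A x) x - (fun x => -A x) y| ≤ L * ‖x - y‖ := fun x y => by
    simp only
    rw [neg_sub_neg, norm_sub_rev]
    exact hA y x
  set ν : Measure (E × ℝ) := (volume : Measure E).prod (volume.restrict (Ioi (0 : ℝ))) with hν
  set T : E × ℝ → E × ℝ := Prod.map id Neg.neg
  have hT : MeasurePreserving T volume volume :=
    (MeasurePreserving.id volume).prod (Measure.measurePreserving_neg volume)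
  have hTe : MeasurableEmbedding T :=
    (MeasurableEquiv.prodCongr (MeasurableEquiv.refl E) (MeasurableEquiv.neg ℝ)).measurableEmbedding
  set f : E × ℝ → ℝ≥0∞ := fun p => ENNReal.ofReal |p.2| * ‖potential κ A g p‖ₑ ^ 2
  have hνr : ν = (volume : Measure (E × ℝ)).restrict (univ ×ˢ Ioi 0) := by
    rw [hν, Measure.volume_eq_prod, ← Measure.prod_restrict, Measure.restrict_univ]
  have hUp : ∫⁻ p in univ ×ˢ Ioi (0 : ℝ), f p = upperEnergy κ A g := by
    rw [← hνr]
    refine lintegral_congr_ae ?_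
    filter_upwards [ae_prod_restrict_Ioi] with p hp
    simp only [f, abs_of_pos hp]
  -- Reflection in the last coordinate exchanges the two sides; it replaces `A` by `-A` and `κ` by
  -- its reflection.
  have hDown : ∫⁻ p in univ ×ˢ Iio (0 : ℝ), f p =
      upperEnergy (fun u s => κ u (-s)) (fun x => -A x) g := by
    have hpre : T ⁻¹' (univ ×ˢ Iio (0 : ℝ)) = univ ×ˢ Ioi 0 := by
      ext p; simp [T]
    rw [← hT.setLIntegral_comp_preimage_emb hTe, hpre, ← hνr]
    refine lintegral_congr_ae ?_
    filter_upwards [ae_prod_restrict_Ioi] with p hp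
    have e : potential κ A g (T p) = potential (fun u s => κ u (-s)) (fun x => -A x) g p := by
      refine integral_congr_ae (Eventually.of_forall fun y => ?_)
      change κ (p.1 - y) (A p.1 - A y + -p.2) • g y = κ (p.1 - y) (-(-A p.1 - -A y + p.2)) • g y
      congr 2
      ring
    have e2 : |(T p).2| = p.2 := by
      change |-p.2| = p.2
      rw [abs_neg, abs_of_pos hp]
    simp only [f, e, e2]
  have hz : ∀ᵐ p : E × ℝ, p ∈ (univ ×ˢ Ioi (0 : ℝ)) ∪ (univ ×ˢ Iio (0 : ℝ)) := by
    have : (volume : Measure (E × ℝ)) (univ ×ˢ {0}) = 0 := by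
      rw [Measure.volume_eq_prod, Measure.prod_prod]
      simp
    rw [← compl_mem_ae_iff] at this
    filter_upwards [this] with p hp
    have h0 : p.2 ≠ 0 := by simpa using hp
    rcases lt_or_gt_of_ne h0 with h | h
    · exact Or.inr ⟨mem_univ _, h⟩
    · exact Or.inl ⟨mem_univ _, h⟩
  calc ∫⁻ p, f p = ∫⁻ p in (univ ×ˢ Ioi (0 : ℝ)) ∪ (univ ×ˢ Iio (0 : ℝ)), f p := by
        rw [Measure.restrict_eq_self_of_ae_mem hz]
    _ ≤ (∫⁻ p in univ ×ˢ Ioi (0 : ℝ), f p) + ∫⁻ p in univ ×ˢ Iio (0 : ℝ), f p :=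
        lintegral_union_le _ _ _
    _ ≤ ENNReal.ofReal C * eLpNorm g 2 ^ 2 + ENNReal.ofReal C * eLpNorm g 2 ^ 2 := by
        rw [hUp, hDown]
        gcongr
        · exact H κ A g hκ hA hg
        · exact H _ _ g hκ' hA' hg
    _ = _ := by rw [ENNReal.ofReal_add hC.le hC.le, add_mul]

end FullEnergy

/-! ### Homogeneous functions and their derivatives -/

section Homogeneous

open Set Filter Topology

variable {V : Type*} [NormedAddCommGroup V] [NormedSpace ℝ V] {F : Type*} [NormedAddCommGroup F]
  [NormedSpace ℝ F] {H : V → F} {a : ℕ}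

theorem norm_le_div_norm_pow_of_homogeneous
    (hH : ∀ r : ℝ, 0 < r → ∀ x, x ≠ 0 → H (r • x) = (r ^ a)⁻¹ • H x) {M : ℝ}
    (hM : ∀ ω ∈ Metric.sphere (0 : V) 1, ‖H ω‖ ≤ M) {z : V} (hz : z ≠ 0) :
    ‖H z‖ ≤ M / ‖z‖ ^ a := by
  have hz0 : 0 < ‖z‖ := norm_pos_iff.2 hz
  have h1 : ‖‖z‖⁻¹ • z‖ = 1 := by rw [norm_smul, norm_inv, norm_norm, inv_mul_cancel₀ hz0.ne']
  have h2 := hH ‖z‖ hz0 (‖z‖⁻¹ • z) (by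
    intro h; rw [h, norm_zero] at h1; exact zero_ne_one h1)
  rw [smul_inv_smul₀ hz0.ne'] at h2
  rw [h2, norm_smul, norm_inv, norm_pow, norm_norm, inv_mul_eq_div]
  have := hM _ (mem_sphere_zero_iff_norm.2 h1)
  gcongr

/-- Differentiating the homogeneity relation in `x` produces one extra factor `r`, which lowers the
degree by one. -/
theorem fderiv_homogeneous (hH : ∀ r : ℝ, 0 < r → ∀ x, x ≠ 0 → H (r • x) = (r ^ a)⁻¹ • H x)
    (hd : ∀ x, x ≠ 0 → DifferentiableAt ℝ H x) (r : ℝ) (hr : 0 < r) (x : V) (hx : x ≠ 0) :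
    fderiv ℝ H (r • x) = (r ^ (a + 1))⁻¹ • fderiv ℝ H x := by
  have h1 : fderiv ℝ (fun y => H (r • y)) x = fderiv ℝ (fun y => (r ^ a)⁻¹ • H y) x := by
    refine Filter.EventuallyEq.fderiv_eq ?_
    filter_upwards [isOpen_compl_singleton.mem_nhds hx] with y hy using hH r hr y hy
  rw [fderiv_comp_smul, fderiv_fun_const_smul (hd x hx)] at h1
  have h2 : fderiv ℝ H (r • x) = r⁻¹ • (r • fderiv ℝ H (r • x)) := (inv_smul_smul₀ hr.ne' _).symm
  rw [h2, h1, smul_smul, pow_succ, mul_inv, mul_comm]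

/-- A function and its derivative with homogeneous bounds: the difference estimate. -/
theorem norm_sub_le_of_fderiv_bound (hd : ∀ x, x ≠ 0 → DifferentiableAt ℝ H x) {N₁ N₂ : ℝ}
    (h1 : ∀ x, x ≠ 0 → ‖H x‖ ≤ N₁ / ‖x‖ ^ a)
    (h2 : ∀ x, x ≠ 0 → ‖fderiv ℝ H x‖ ≤ N₂ / ‖x‖ ^ (a + 1)) (hN₁ : 0 ≤ N₁) (hN₂ : 0 ≤ N₂) {m : ℝ}
    (hm : 0 < m) {z z' : V} (hz : m ≤ ‖z‖) (hz' : m ≤ ‖z'‖) :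
    ‖H z - H z'‖ ≤ (4 * N₁ + 2 ^ (a + 1) * N₂) * ‖z - z'‖ / m ^ (a + 1) := by
  have hpos : ∀ {y : V} {m' : ℝ}, 0 < m' → m' ≤ ‖y‖ → y ≠ 0 := fun h0 h hy => by
    rw [hy, norm_zero] at h; linarith
  -- For close points the segment between them keeps norm at least `m / 2`, and the mean value
  -- inequality applies. For distant points the size bounds suffice.
  rcases le_total ‖z - z'‖ (m / 2) with h | h
  · have hmem : ∀ y ∈ segment ℝ z z', m / 2 ≤ ‖y‖ := fun y hy => by
      have h3 : ‖y - z‖ ≤ ‖z' - z‖ := norm_sub_le_of_mem_segment hy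
      rw [norm_sub_rev z' z] at h3
      have h4 := norm_sub_norm_le z y
      rw [norm_sub_rev z y] at h4
      linarith
    have hb := (convex_segment z z').norm_image_sub_le_of_norm_fderiv_le (𝕜 := ℝ) (f := H)
      (C := N₂ / (m / 2) ^ (a + 1)) (fun y hy => hd y (hpos (half_pos hm) (hmem y hy)))
      (fun y hy => (h2 y (hpos (half_pos hm) (hmem y hy))).trans (by
        have := hmem y hy
        gcongr)) (right_mem_segment ℝ z z') (left_mem_segment ℝ z z')
    refine hb.trans ?_
    calc N₂ / (m / 2) ^ (a + 1) * ‖z - z'‖ = (0 + 2 ^ (a + 1) * N₂) * ‖z - z'‖ / m ^ (a + 1) := by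
          rw [div_pow]; field_simp; ring
      _ ≤ _ := by gcongr; positivity
  · have hb : ‖H z - H z'‖ ≤ N₁ / m ^ a + N₁ / m ^ a := by
      refine (norm_sub_le _ _).trans (add_le_add ((h1 z (hpos hm hz)).trans ?_)
        ((h1 z' (hpos hm hz')).trans ?_)) <;> gcongr
    refine hb.trans ?_
    calc N₁ / m ^ a + N₁ / m ^ a = 4 * N₁ * (m / 2) / m ^ (a + 1) := by
          rw [pow_succ]; field_simp; ring
      _ ≤ (4 * N₁ + 0) * ‖z - z'‖ / m ^ (a + 1) := by rw [add_zero]; gcongr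
      _ ≤ _ := by gcongr; positivity

theorem EuclideanSpace.opNorm_le_of_single {d : ℕ} (T : EuclideanSpace ℝ (Fin d) →L[ℝ] F) {M : ℝ}
    (hM : 0 ≤ M) (h : ∀ i, ‖T (EuclideanSpace.single i 1)‖ ≤ M) : ‖T‖ ≤ d * M := by
  refine T.opNorm_le_bound (by positivity) fun x => ?_
  have hx : T x = ∑ i, x i • T (EuclideanSpace.single i 1) := by
    have := (EuclideanSpace.basisFun (Fin d) ℝ).sum_repr x
    conv_lhs => rw [← this]
    simp only [map_sum, map_smul, EuclideanSpace.basisFun_repr, EuclideanSpace.basisFun_apply]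
  rw [hx]
  refine (norm_sum_le _ _).trans ?_
  calc ∑ i, ‖x i • T (EuclideanSpace.single i 1)‖ ≤ ∑ _i : Fin d, ‖x‖ * M := by
        refine Finset.sum_le_sum fun i _ => ?_
        rw [norm_smul]
        exact mul_le_mul (PiLp.norm_apply_le x i) (h i) (norm_nonneg _) (norm_nonneg _)
    _ = d * M * ‖x‖ := by
        rw [Finset.sum_const, Finset.card_univ, Fintype.card_fin, nsmul_eq_mul]; ring

end Homogeneous

/-! ### Integrals of derivatives under weak decay -/

section Divergence

open Set Filter Topology

variable {E : Type*} [NormedAddCommGroup E] [InnerProductSpace ℝ E] [FiniteDimensional ℝ E]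
  [MeasurableSpace E] [BorelSpace E]

/-- The integral of a directional derivative vanishes, under weak decay of the function. -/
theorem integral_fderiv_apply_eq_zero_of_decay {φ : E → ℝ} (hφ : ContDiff ℝ 1 φ) {w : E}
    (h1 : Integrable fun u => fderiv ℝ φ u w) (h2 : Integrable fun u => φ u / (1 + ‖u‖)) :
    ∫ u, fderiv ℝ φ u w = 0 := by
  -- Cut-off at radius `m + 1`. The derivative of the cut-off has size `r m` and lives where `r m *
  -- ‖u‖ ≤ 2`, so it is at most a multiple of `1 / (1 + ‖u‖)`; this is where the second
  -- integrability hypothesis enters.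
  set η : ContDiffBump (0 : E) := ⟨1, 2, one_pos, one_lt_two⟩
  set r : ℕ → ℝ := fun m => ((m : ℝ) + 1)⁻¹ with hrdef
  have hr : ∀ m, 0 < r m := fun m => by simp only [r]; positivity
  have hr1 : ∀ m, r m ≤ 1 := fun m => inv_le_one_of_one_le₀ (by simp)
  have hr0 : Tendsto r atTop (𝓝 0) := by
    simpa [r] using tendsto_one_div_add_atTop_nhds_zero_nat (𝕜 := ℝ)
  set ηm : ℕ → E → ℝ := fun m u => η (r m • u) with hηm
  have hηs : ∀ m, ContDiff ℝ 1 (ηm m) := fun m => η.contDiff.comp (contDiff_const_smul _)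
  have hηc : ∀ m, HasCompactSupport (ηm m) := fun m => η.hasCompactSupport.comp_smul (hr m).ne'
  have hηd : ∀ m u, fderiv ℝ (ηm m) u w = r m * fderiv ℝ η (r m • u) w := fun m u => by
    simp only [ηm]
    rw [fderiv_comp_smul]
    rfl
  have hd1 : Continuous fun u => fderiv ℝ φ u w :=
    (hφ.continuous_fderiv one_ne_zero).clm_apply continuous_const
  have hd2 : ∀ m, Continuous fun u => fderiv ℝ (ηm m) u w := fun m =>
    ((hηs m).continuous_fderiv one_ne_zero).clm_apply continuous_const
  have hη1 : ContDiff ℝ 1 η := η.contDiff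
  obtain ⟨D, hD⟩ : ∃ D, ∀ u, ‖fderiv ℝ η u w‖ ≤ D :=
    ((hη1.continuous_fderiv one_ne_zero).clm_apply continuous_const
      ).bounded_above_of_compact_support ((η.hasCompactSupport.fderiv ℝ).comp_left
        (g := fun T : E →L[ℝ] ℝ => T w) rfl)
  have hsupp : ∀ u : E, 2 < ‖u‖ → fderiv ℝ η u = 0 := fun u hu => by
    refine image_eq_zero_of_notMem_tsupport fun h => ?_
    have h3 := tsupport_fderiv_subset ℝ h
    rw [η.tsupport_eq, mem_closedBall_zero_iff] at h3
    exact absurd h3 (not_le.2 hu)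
  have hparts : ∀ m, ∫ u, ηm m u * fderiv ℝ φ u w = -∫ u, fderiv ℝ (ηm m) u w * φ u := fun m => by
    refine integral_mul_fderiv_eq_neg_fderiv_mul_of_integrable ?_ ?_ ?_
      (fun u _ => (hηs m).differentiable one_ne_zero u)
      (fun u _ => hφ.differentiable one_ne_zero u)
    · refine ((hd2 m).mul hφ.continuous).integrable_of_hasCompactSupport ?_
      exact HasCompactSupport.mul_right (((hηc m).fderiv ℝ).comp_left
        (g := fun T : E →L[ℝ] ℝ => T w) rfl)
    · exact ((hηs m).continuous.mul hd1).integrable_of_hasCompactSupport (hηc m).mul_right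
    · exact ((hηs m).continuous.mul hφ.continuous).integrable_of_hasCompactSupport (hηc m).mul_right
  have hlimη : ∀ u, Tendsto (fun m => ηm m u) atTop (𝓝 1) := fun u => by
    have h3 : Tendsto (fun m => r m • u) atTop (𝓝 0) := by simpa using hr0.smul_const u
    have h4 := (hη1.continuous.tendsto 0).comp h3
    rwa [η.one_of_mem_closedBall (Metric.mem_closedBall_self η.rIn_pos.le)] at h4
  have l1 : Tendsto (fun m => ∫ u, ηm m u * fderiv ℝ φ u w) atTop (𝓝 (∫ u, fderiv ℝ φ u w)) := by
    refine tendsto_integral_of_dominated_convergence _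
      (fun m => ((hηs m).continuous.mul hd1).aestronglyMeasurable) h1.norm
      (fun m => Eventually.of_forall fun u => ?_) (Eventually.of_forall fun u => ?_)
    · rw [norm_mul]
      refine mul_le_of_le_one_left (norm_nonneg _) ?_
      rw [Real.norm_of_nonneg η.nonneg]
      exact η.le_one
    · simpa using (hlimη u).mul_const (fderiv ℝ φ u w)
  have l2 : Tendsto (fun m => ∫ u, fderiv ℝ (ηm m) u w * φ u) atTop (𝓝 (∫ _ : E, (0 : ℝ))) := by
    refine tendsto_integral_of_dominated_convergence _
      (fun m => ((hd2 m).mul hφ.continuous).aestronglyMeasurable) (h2.norm.const_mul (3 * D))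
      (fun m => Eventually.of_forall fun u => ?_) (Eventually.of_forall fun u => ?_)
    · have hD0 := (norm_nonneg _).trans (hD u)
      rw [hηd, norm_mul, norm_div, Real.norm_of_nonneg (by positivity : (0 : ℝ) ≤ 1 + ‖u‖)]
      rcases le_or_gt ‖r m • u‖ 2 with h | h
      · rw [norm_smul, Real.norm_of_nonneg (hr m).le] at h
        have h4 : r m ≤ 3 / (1 + ‖u‖) := by
          rw [le_div_iff₀ (by positivity)]
          linarith [hr1 m]
        rw [norm_mul, Real.norm_of_nonneg (hr m).le]
        calc r m * ‖fderiv ℝ η (r m • u) w‖ * ‖φ u‖ ≤ 3 / (1 + ‖u‖) * D * ‖φ u‖ := by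
              gcongr
              exact hD _
          _ = _ := by ring
      · rw [hsupp _ h]
        simp only [zero_apply, mul_zero, norm_zero, zero_mul]
        positivity
    · have h3 : Tendsto (fun m => r m * D * ‖φ u‖) atTop (𝓝 (0 * D * ‖φ u‖)) :=
        (hr0.mul_const _).mul_const _
      rw [zero_mul, zero_mul] at h3
      refine squeeze_zero_norm (fun m => ?_) h3
      rw [hηd, norm_mul, norm_mul, Real.norm_of_nonneg (hr m).le]
      have := hr m
      gcongr
      exact hD _
  simp_rw [hparts] at l1
  have h3 := tendsto_nhds_unique l1 l2.neg
  simpa using h3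

end Divergence

/-! ### Coordinates of `ℝⁿ × ℝ` and the cancellation of `∇K` over hyperplanes -/

section Snoc

open Set Filter Topology

/-- The identification of `ℝⁿ × ℝ` with `ℝ^{n+1}`. -/
def snocEquiv (n : ℕ) :
    (EuclideanSpace ℝ (Fin n) × ℝ) ≃L[ℝ] EuclideanSpace ℝ (Fin (n + 1)) :=
  LinearEquiv.toContinuousLinearEquiv
    { toFun := fun p => WithLp.toLp 2 (Fin.snoc (α := fun _ => ℝ) (fun i => p.1 i) p.2)
      invFun := fun z => (WithLp.toLp 2 fun i => z i.castSucc, z (Fin.last n))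
      map_add' := fun p q => by
        ext i
        refine Fin.lastCases ?_ (fun i => ?_) i <;> simp
      map_smul' := fun r p => by
        ext i
        refine Fin.lastCases ?_ (fun i => ?_) i <;> simp
      left_inv := fun p => by
        ext i <;> simp
      right_inv := fun z => by
        ext i
        refine Fin.lastCases ?_ (fun i => ?_) i <;> simp }

variable {n : ℕ}

theorem snocEquiv_apply (p : EuclideanSpace ℝ (Fin n) × ℝ) :
    snocEquiv n p = WithLp.toLp 2 (Fin.snoc (α := fun _ => ℝ) (fun i => p.1 i) p.2) := rfl

theorem norm_snocEquiv_sq (p : EuclideanSpace ℝ (Fin n) × ℝ) :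
    ‖snocEquiv n p‖ ^ 2 = ‖p.1‖ ^ 2 + p.2 ^ 2 := by
  rw [EuclideanSpace.norm_sq_eq, EuclideanSpace.norm_sq_eq, Fin.sum_univ_castSucc]
  simp [snocEquiv_apply]

theorem norm_snocEquiv_le (p : EuclideanSpace ℝ (Fin n) × ℝ) :
    ‖snocEquiv n p‖ ≤ ‖p.1‖ + |p.2| := by
  refine le_of_sq_le_sq ?_ (by positivity)
  rw [norm_snocEquiv_sq, ← sq_abs p.2]
  nlinarith [norm_nonneg p.1, abs_nonneg p.2]

theorem le_norm_snocEquiv (p : EuclideanSpace ℝ (Fin n) × ℝ) :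
    (‖p.1‖ + |p.2|) / 2 ≤ ‖snocEquiv n p‖ := by
  refine le_of_sq_le_sq ?_ (norm_nonneg _)
  rw [norm_snocEquiv_sq, ← sq_abs p.2]
  nlinarith [sq_nonneg (‖p.1‖ - |p.2|), norm_nonneg p.1, abs_nonneg p.2]

theorem snocEquiv_ne_zero {p : EuclideanSpace ℝ (Fin n) × ℝ} (hp : 0 < ‖p.1‖ + |p.2|) :
    snocEquiv n p ≠ 0 := fun h => by
  have := le_norm_snocEquiv p
  rw [h, norm_zero] at this
  linarith

/-- Bounds for a kernel and its first two derivatives. -/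
structure HasKernelBounds (K : EuclideanSpace ℝ (Fin (n + 1)) → ℝ) (N : ℝ) : Prop where
  zero : ∀ z, z ≠ 0 → ‖K z‖ ≤ N / ‖z‖ ^ n
  one : ∀ z, z ≠ 0 → ‖fderiv ℝ K z‖ ≤ N / ‖z‖ ^ (n + 1)
  two : ∀ z, z ≠ 0 → ‖fderiv ℝ (fderiv ℝ K) z‖ ≤ N / ‖z‖ ^ (n + 2)

variable {K : EuclideanSpace ℝ (Fin (n + 1)) → ℝ} {N : ℝ}

theorem IsHomogeneousOddKernel.contDiffAt (hK : IsHomogeneousOddKernel n K)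
    {z : EuclideanSpace ℝ (Fin (n + 1))} (hz : z ≠ 0) : ContDiffAt ℝ 2 K z :=
  hK.contDiffOn.contDiffAt (isOpen_compl_singleton.mem_nhds hz)

theorem IsHomogeneousOddKernel.differentiableAt (hK : IsHomogeneousOddKernel n K)
    (z : EuclideanSpace ℝ (Fin (n + 1))) (hz : z ≠ 0) : DifferentiableAt ℝ K z :=
  (hK.contDiffAt hz).differentiableAt two_ne_zero

theorem IsHomogeneousOddKernel.differentiableAt_fderiv (hK : IsHomogeneousOddKernel n K)
    (z : EuclideanSpace ℝ (Fin (n + 1))) (hz : z ≠ 0) : DifferentiableAt ℝ (fderiv ℝ K) z :=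
  ((hK.contDiffAt hz).fderiv_right (m := 1) (by norm_num)).differentiableAt one_ne_zero

theorem IsHomogeneousOddKernel.fderiv_neg_eq (hK : IsHomogeneousOddKernel n K)
    {z : EuclideanSpace ℝ (Fin (n + 1))} (hz : z ≠ 0) : fderiv ℝ K (-z) = fderiv ℝ K z := by
  have h1 : fderiv ℝ (fun y => K (-y)) z = fderiv ℝ (fun y => -K y) z := by
    refine Filter.EventuallyEq.fderiv_eq ?_
    filter_upwards [isOpen_compl_singleton.mem_nhds hz] with y hy using hK.odd y hy
  have h2 := (hK.differentiableAt (-z) (neg_ne_zero.2 hz)).hasFDerivAt.comp z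
    (hasFDerivAt_id z).neg
  have h3 : fderiv ℝ (fun y => K (-y)) z = -fderiv ℝ K (-z) := by
    rw [show (fun y => K (-y)) = K ∘ fun y => -y from rfl]
    refine h2.fderiv.trans ?_
    ext v; simp
  rw [h3, fderiv_fun_neg] at h1
  exact neg_injective h1

/-- On the sphere, operator norms are bounded through coordinate derivatives, each order costing a
factor `n + 1`; homogeneity carries the bounds to all nonzero points. -/
theorem IsHomogeneousOddKernel.hasKernelBounds (hK : IsHomogeneousOddKernel n K) {M : ℝ}
    (hM0 : 0 ≤ M) (hM : ∀ k : ℕ, k ≤ 2 → ∀ i : Fin k → Fin (n + 1),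
      ∀ ω ∈ Metric.sphere (0 : EuclideanSpace ℝ (Fin (n + 1))) 1, |mixedPartial i K ω| ≤ M) :
    HasKernelBounds K ((n + 1) ^ 2 * M) := by
  have hH : ∀ r : ℝ, 0 < r → ∀ x, x ≠ 0 → K (r • x) = (r ^ n)⁻¹ • K x := hK.homogeneous
  have hH1 := fderiv_homogeneous hH hK.differentiableAt
  have hH2 := fderiv_homogeneous hH1 hK.differentiableAt_fderiv
  have hn : (1 : ℝ) ≤ n + 1 := by simp
  have b0 : ∀ ω ∈ Metric.sphere (0 : EuclideanSpace ℝ (Fin (n + 1))) 1,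
      ‖K ω‖ ≤ (n + 1) ^ 2 * M := fun ω hω => by
    have h := hM 0 (by norm_num) Fin.elim0 ω hω
    rw [mixedPartial, iteratedFDeriv_zero_apply] at h
    exact h.trans (le_mul_of_one_le_left hM0 (one_le_pow₀ hn))
  have b1 : ∀ ω ∈ Metric.sphere (0 : EuclideanSpace ℝ (Fin (n + 1))) 1,
      ‖fderiv ℝ K ω‖ ≤ (n + 1) ^ 2 * M := fun ω hω => by
    have h : ‖fderiv ℝ K ω‖ ≤ ((n + 1 : ℕ) : ℝ) * M :=
      EuclideanSpace.opNorm_le_of_single _ hM0 fun i => by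
        have h := hM 1 (by norm_num) (fun _ => i) ω hω
        rwa [mixedPartial, iteratedFDeriv_one_apply] at h
    push_cast at h
    refine h.trans (mul_le_mul_of_nonneg_right ?_ hM0)
    nlinarith
  have b2 : ∀ ω ∈ Metric.sphere (0 : EuclideanSpace ℝ (Fin (n + 1))) 1,
      ‖fderiv ℝ (fderiv ℝ K) ω‖ ≤ (n + 1) ^ 2 * M := fun ω hω => by
    have h : ‖fderiv ℝ (fderiv ℝ K) ω‖ ≤ ((n + 1 : ℕ) : ℝ) * (((n + 1 : ℕ) : ℝ) * M) :=
      EuclideanSpace.opNorm_le_of_single _ (by positivity) fun i =>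
        EuclideanSpace.opNorm_le_of_single _ hM0 fun j => by
          have h := hM 2 le_rfl ![i, j] ω hω
          rw [mixedPartial, iteratedFDeriv_two_apply] at h
          simpa using h
    push_cast at h
    linarith
  exact ⟨fun z hz => norm_le_div_norm_pow_of_homogeneous hH b0 hz,
    fun z hz => norm_le_div_norm_pow_of_homogeneous hH1 b1 hz,
    fun z hz => norm_le_div_norm_pow_of_homogeneous (H := fderiv ℝ (fderiv ℝ K)) hH2 b2 hz⟩

/-- The point `(u, ⟨c, u⟩ + t)`. -/
def affineGraph (c : EuclideanSpace ℝ (Fin n)) (t : ℝ) (u : EuclideanSpace ℝ (Fin n)) :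
    EuclideanSpace ℝ (Fin (n + 1)) := snocEquiv n (u, inner ℝ c u + t)

variable {c : EuclideanSpace ℝ (Fin n)} {t : ℝ}

theorem continuous_affineGraph : Continuous (affineGraph c t) := by
  unfold affineGraph; fun_prop

theorem hasFDerivAt_affineGraph (u : EuclideanSpace ℝ (Fin n)) :
    HasFDerivAt (affineGraph c t) ((snocEquiv n : _ →L[ℝ] EuclideanSpace ℝ (Fin (n + 1))).comp
      ((ContinuousLinearMap.id ℝ _).prod (innerSL ℝ c))) u := by
  have h : HasFDerivAt (fun u : EuclideanSpace ℝ (Fin n) => (u, inner ℝ c u + t))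
      ((ContinuousLinearMap.id ℝ _).prod (innerSL ℝ c)) u :=
    (hasFDerivAt_id u).prodMk ((innerSL ℝ c).hasFDerivAt.add_const t)
  exact (snocEquiv n).hasFDerivAt.comp u h

theorem hasDerivAt_affineGraph (u : EuclideanSpace ℝ (Fin n)) :
    HasDerivAt (fun t => affineGraph c t u) (snocEquiv n (0, 1)) t := by
  have h : HasDerivAt (fun t : ℝ => (u, inner ℝ c u + t)) ((0 : EuclideanSpace ℝ (Fin n)), (1 : ℝ))
      t := (hasDerivAt_const t u).prodMk ((hasDerivAt_id t).const_add _)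
  exact (snocEquiv n).hasFDerivAt.comp_hasDerivAt t h

theorem affineGraph_neg (u : EuclideanSpace ℝ (Fin n)) :
    affineGraph c (-t) u = -affineGraph c t (-u) := by
  rw [affineGraph, affineGraph, ← map_neg, Prod.neg_mk, neg_neg, inner_neg_right]
  congr 2
  ring

theorem affineGraph_eq_smul (ht : 0 < t) (u : EuclideanSpace ℝ (Fin n)) :
    affineGraph c t u = t • affineGraph c 1 (t⁻¹ • u) := by
  rw [affineGraph, affineGraph, ← map_smul, Prod.smul_mk, smul_inv_smul₀ ht.ne', inner_smul_right,
    smul_eq_mul, mul_add, mul_inv_cancel_left₀ ht.ne', mul_one]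

theorem le_norm_affineGraph (u : EuclideanSpace ℝ (Fin n)) :
    (t + ‖u‖) / (2 * (1 + ‖c‖)) ≤ ‖affineGraph c t u‖ := by
  have h1 := add_le_mul_norm_add_abs (t := t) (norm_nonneg c) (abs_real_inner_le_norm c u)
  have h2 := le_norm_snocEquiv (u, (inner ℝ c u : ℝ) + t)
  calc _ = (t + ‖u‖) / (1 + ‖c‖) / 2 := by rw [div_div, mul_comm 2]
    _ ≤ (‖u‖ + |inner ℝ c u + t|) / 2 := by gcongr
    _ ≤ _ := h2

theorem affineGraph_ne_zero (ht : 0 < t) (u : EuclideanSpace ℝ (Fin n)) :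
    affineGraph c t u ≠ 0 := fun h => by
  have := le_norm_affineGraph (c := c) (t := t) u
  rw [h, norm_zero] at this
  have h2 : 0 < (t + ‖u‖) / (2 * (1 + ‖c‖)) := by positivity
  linarith

theorem div_norm_affineGraph_le (hN : 0 ≤ N) (ht : 0 < t) (u : EuclideanSpace ℝ (Fin n)) :
    N / ‖affineGraph c t u‖ ^ (n + 1) ≤
      N * (2 * (1 + ‖c‖)) ^ (n + 1) / t * poissonWeight t u := by
  have h := le_norm_affineGraph (c := c) (t := t) u
  calc _ ≤ N / ((t + ‖u‖) / (2 * (1 + ‖c‖))) ^ (n + 1) := by gcongr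
    _ = _ := by rw [poissonWeight, finrank_euclideanSpace_fin, div_pow]; field_simp

theorem HasKernelBounds.abs_fderiv_affineGraph_le (hb : HasKernelBounds K N) (hN : 0 ≤ N)
    (ht : 0 < t) (v : EuclideanSpace ℝ (Fin (n + 1))) (u : EuclideanSpace ℝ (Fin n)) :
    |fderiv ℝ K (affineGraph c t u) v| ≤
      N * (2 * (1 + ‖c‖)) ^ (n + 1) / t * poissonWeight t u * ‖v‖ := by
  refine ((fderiv ℝ K (affineGraph c t u)).le_opNorm v).trans ?_
  gcongr
  exact (hb.one _ (affineGraph_ne_zero ht u)).trans (div_norm_affineGraph_le hN ht u)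

theorem measurable_fderiv_affineGraph (v : EuclideanSpace ℝ (Fin (n + 1))) :
    Measurable fun u => fderiv ℝ K (affineGraph c t u) v :=
  (measurable_fderiv_apply_const ℝ K v).comp continuous_affineGraph.measurable

theorem HasKernelBounds.integrable_fderiv_affineGraph (hb : HasKernelBounds K N) (hN : 0 ≤ N)
    (ht : 0 < t) (v : EuclideanSpace ℝ (Fin (n + 1))) :
    Integrable fun u => fderiv ℝ K (affineGraph c t u) v :=
  (((integrable_poissonWeight ht).const_mul _).mul_const _).mono'
    (measurable_fderiv_affineGraph v).aestronglyMeasurable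
    (Eventually.of_forall fun u => hb.abs_fderiv_affineGraph_le hN ht v u)

/-- Cancellation in the directions tangential to a hyperplane. -/
theorem IsHomogeneousOddKernel.integral_fderiv_tangential (hK : IsHomogeneousOddKernel n K)
    (hb : HasKernelBounds K N) (hN : 0 ≤ N) (ht : 0 < t) (w : EuclideanSpace ℝ (Fin n)) :
    ∫ u, fderiv ℝ K (affineGraph c t u) (snocEquiv n (w, inner ℝ c w)) = 0 := by
  have hd : ∀ u, fderiv ℝ (fun u => K (affineGraph c t u)) u w =
      fderiv ℝ K (affineGraph c t u) (snocEquiv n (w, inner ℝ c w)) := fun u => by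
    have h := (hK.differentiableAt _ (affineGraph_ne_zero ht u)).hasFDerivAt.comp u
      (hasFDerivAt_affineGraph (c := c) (t := t) u)
    have h2 : fderiv ℝ (fun u => K (affineGraph c t u)) u = _ := h.fderiv
    rw [h2]
    rfl
  have hs : ContDiff ℝ 1 (affineGraph c t) := by
    have : ContDiff ℝ 1 fun u : EuclideanSpace ℝ (Fin n) => (u, inner ℝ c u + t) :=
      contDiff_id.prodMk ((innerSL ℝ c).contDiff.add contDiff_const)
    exact (snocEquiv n).contDiff.comp this
  have hφ : ContDiff ℝ 1 fun u => K (affineGraph c t u) := contDiff_iff_contDiffAt.2 fun u =>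
    ((hK.contDiffAt (affineGraph_ne_zero ht u)).of_le one_le_two).comp u hs.contDiffAt
  -- On the hyperplane `K` decays only with order `-n`, in general not integrable, but after
  -- division by `1 + ‖u‖` it is.
  have h := integral_fderiv_apply_eq_zero_of_decay hφ (w := w)
    (by simp_rw [hd]; exact hb.integrable_fderiv_affineGraph hN ht _) (by
      refine ((integrable_poissonWeight (E := EuclideanSpace ℝ (Fin n)) ht).const_mul
        (N * (2 * (1 + ‖c‖)) ^ n * (1 + t) / t)).mono'
        (hφ.continuous.div (by fun_prop) fun u => by positivity).aestronglyMeasurable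
        (Eventually.of_forall fun u => ?_)
      have h1 := le_norm_affineGraph (c := c) (t := t) u
      have h2 : ‖K (affineGraph c t u)‖ ≤ N / ((t + ‖u‖) / (2 * (1 + ‖c‖))) ^ n :=
        (hb.zero _ (affineGraph_ne_zero ht u)).trans (by gcongr)
      have h3 : t + ‖u‖ ≤ (1 + t) * (1 + ‖u‖) := by
        have := mul_nonneg ht.le (norm_nonneg u)
        nlinarith
      rw [norm_div, Real.norm_of_nonneg (by positivity : (0 : ℝ) ≤ 1 + ‖u‖), div_le_iff₀
        (by positivity)]
      refine h2.trans ?_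
      rw [poissonWeight, finrank_euclideanSpace_fin, div_pow, pow_succ (t + ‖u‖)]
      have h4 : 1 ≤ (1 + t) * (1 + ‖u‖) / (t + ‖u‖) := by rwa [one_le_div₀ (by positivity)]
      calc _ = N * (2 * (1 + ‖c‖)) ^ n / (t + ‖u‖) ^ n * 1 := by field_simp
        _ ≤ N * (2 * (1 + ‖c‖)) ^ n / (t + ‖u‖) ^ n * ((1 + t) * (1 + ‖u‖) / (t + ‖u‖)) := by
          gcongr
        _ = _ := by field_simp)
  simpa only [hd] using h

/-- Cancellation in the vertical direction, over a hyperplane. -/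
theorem IsHomogeneousOddKernel.integral_fderiv_vertical (hK : IsHomogeneousOddKernel n K)
    (hb : HasKernelBounds K N) (hN : 0 ≤ N) (ht : 0 < t) :
    ∫ u, fderiv ℝ K (affineGraph c t u) (snocEquiv n (0, 1)) = 0 := by
  set e := snocEquiv n (0, 1) with he
  -- By oddness, the sum over `u` and `-u` is a difference of `K` at two points that differ by `2 τ`
  -- vertically. It decays one order faster than `K`, hence is integrable.
  set G : ℝ → EuclideanSpace ℝ (Fin n) → ℝ := fun τ u =>
    K (affineGraph c τ u) + K (affineGraph c τ (-u)) with hG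
  have hcont : ∀ τ, 0 < τ → Continuous fun u => K (affineGraph c τ u) := fun τ hτ =>
    continuous_iff_continuousAt.2 fun u => ContinuousAt.comp
      (hK.differentiableAt _ (affineGraph_ne_zero hτ u)).continuousAt
      continuous_affineGraph.continuousAt
  have hGc : ∀ τ, 0 < τ → Continuous (G τ) := fun τ hτ =>
    (hcont τ hτ).add ((hcont τ hτ).comp continuous_neg)
  have hGi : ∀ τ, 0 < τ → Integrable (G τ) := fun τ hτ => by
    refine ((integrable_poissonWeight (E := EuclideanSpace ℝ (Fin n)) hτ).const_mul
        ((4 * N + 2 ^ (n + 1) * N) * (2 * τ * ‖e‖) * (2 * (1 + ‖c‖)) ^ (n + 1) / τ)).mono'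
        (hGc τ hτ).aestronglyMeasurable (Eventually.of_forall fun u => ?_)
    have h1 : G τ u = K (affineGraph c τ u) - K (affineGraph c (-τ) u) := by
      rw [affineGraph_neg, hK.odd _ (affineGraph_ne_zero hτ _), sub_neg_eq_add]
    have h2 : 0 < (τ + ‖u‖) / (2 * (1 + ‖c‖)) := by positivity
    have h3 : (τ + ‖u‖) / (2 * (1 + ‖c‖)) ≤ ‖affineGraph c (-τ) u‖ := by
      rw [affineGraph_neg, norm_neg]
      simpa using le_norm_affineGraph (c := c) (t := τ) (-u)
    have h4 := norm_sub_le_of_fderiv_bound hK.differentiableAt hb.zero hb.one hN hN h2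
      (le_norm_affineGraph u) h3
    have h5 : affineGraph c τ u - affineGraph c (-τ) u = (2 * τ) • e := by
      rw [he, affineGraph, affineGraph, ← map_sub, ← map_smul]
      congr 1
      ext1
      · simp
      · simp only [Prod.snd_sub, Prod.smul_snd, smul_eq_mul]; ring
    rw [← h1, h5, norm_smul, Real.norm_of_nonneg (by positivity : (0 : ℝ) ≤ 2 * τ)] at h4
    refine h4.trans (le_of_eq ?_)
    rw [poissonWeight, finrank_euclideanSpace_fin, div_pow]
    field_simp
  -- The degree `-n` matches the scaling of Lebesgue measure on `ℝⁿ`, so the integral does not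
  -- depend on the height.
  have hGs : ∀ τ, 0 < τ → ∫ u, G τ u = ∫ u, G 1 u := fun τ hτ => by
    rw [← (integrable_scaled (hGi 1 one_pos) hτ).2]
    refine integral_congr_ae (Eventually.of_forall fun u => ?_)
    simp only [G, finrank_euclideanSpace_fin]
    rw [affineGraph_eq_smul hτ, affineGraph_eq_smul hτ (-u), smul_neg,
      hK.homogeneous τ hτ _ (affineGraph_ne_zero one_pos _),
      hK.homogeneous τ hτ _ (affineGraph_ne_zero one_pos _), mul_add]
  have hi := hb.integrable_fderiv_affineGraph (c := c) hN ht e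
  have hder := (hasDerivAt_integral_of_dominated_loc_of_deriv_le (μ := volume) (F := G) (x₀ := t)
    (F' := fun τ u => fderiv ℝ K (affineGraph c τ u) e + fderiv ℝ K (affineGraph c τ (-u)) e)
    (s := Ioi (t / 2)) (bound := fun u => 2 * (N * (2 * (1 + ‖c‖)) ^ (n + 1) / (t / 2) *
      poissonWeight (t / 2) u * ‖e‖))
    (Ioi_mem_nhds (half_lt_self ht))
    ((lt_mem_nhds ht).mono fun τ hτ => (hGc τ hτ).aestronglyMeasurable) (hGi t ht)
    (hi.add hi.comp_neg).aestronglyMeasurable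
    (Eventually.of_forall fun u τ hτ => by
      have hτ0 : 0 < τ := (half_pos ht).trans hτ
      have key : ∀ u : EuclideanSpace ℝ (Fin n), |fderiv ℝ K (affineGraph c τ u) e| ≤
          N * (2 * (1 + ‖c‖)) ^ (n + 1) / (t / 2) * poissonWeight (t / 2) u * ‖e‖ := fun u => by
        refine (hb.abs_fderiv_affineGraph_le hN hτ0 e u).trans ?_
        have h1 : ∀ r : ℝ, 0 < r → N * (2 * (1 + ‖c‖)) ^ (n + 1) / r * poissonWeight r u * ‖e‖ =
            N * (2 * (1 + ‖c‖)) ^ (n + 1) / (r + ‖u‖) ^ (n + 1) * ‖e‖ := fun r hr => by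
          rw [poissonWeight, finrank_euclideanSpace_fin]
          field_simp
        rw [h1 τ hτ0, h1 _ (half_pos ht)]
        have : t / 2 ≤ τ := le_of_lt hτ
        gcongr
      have h2 := key (-u)
      rw [poissonWeight_neg] at h2
      refine (norm_add_le _ _).trans ?_
      have h1 := key u
      simp only [Real.norm_eq_abs]
      linarith)
    ((((integrable_poissonWeight (half_pos ht)).const_mul _).mul_const _).const_mul _)
    (Eventually.of_forall fun u τ hτ => by
      have hτ0 : 0 < τ := (half_pos ht).trans hτ
      have key : ∀ u : EuclideanSpace ℝ (Fin n), HasDerivAt (fun τ => K (affineGraph c τ u))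
          (fderiv ℝ K (affineGraph c τ u) e) τ := fun u =>
        (hK.differentiableAt _ (affineGraph_ne_zero hτ0 u)).hasFDerivAt.comp_hasDerivAt τ
          (hasDerivAt_affineGraph u)
      exact (key u).add (key (-u)))).2
  have hconst : HasDerivAt (fun τ => ∫ u, G τ u) 0 t :=
    (hasDerivAt_const t (∫ u, G 1 u)).congr_of_eventuallyEq
      ((lt_mem_nhds ht).mono fun τ hτ => hGs τ hτ)
  -- The derivative in the height is twice the integral sought, and it is zero.
  have h0 := hder.unique hconst
  rw [integral_add hi hi.comp_neg,
    integral_neg_eq_self (fun u => fderiv ℝ K (affineGraph c t u) e)] at h0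
  linarith

/-- The derivatives of the kernel have vanishing integrals over hyperplanes. -/
theorem IsHomogeneousOddKernel.integral_fderiv_eq_zero (hK : IsHomogeneousOddKernel n K)
    (hb : HasKernelBounds K N) (hN : 0 ≤ N) (ht : 0 < t) (v : EuclideanSpace ℝ (Fin (n + 1))) :
    ∫ u, fderiv ℝ K (affineGraph c t u) v = 0 := by
  obtain ⟨⟨w, s⟩, rfl⟩ := (snocEquiv n).surjective v
  have e : snocEquiv n (w, s) = snocEquiv n (w, inner ℝ c w) +
      (s - inner ℝ c w) • snocEquiv n (0, 1) := by
    rw [← map_smul, ← map_add]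
    congr 1
    ext1 <;> simp
  simp_rw [e, map_add, map_smul, smul_eq_mul]
  rw [integral_add (hb.integrable_fderiv_affineGraph hN ht _)
    ((hb.integrable_fderiv_affineGraph hN ht _).const_mul _), integral_const_mul,
    hK.integral_fderiv_tangential hb hN ht, hK.integral_fderiv_vertical hb hN ht, mul_zero,
    add_zero]

/-- A partial derivative of the kernel, in the coordinates of `ℝⁿ × ℝ`. -/
def partialKernel (K : EuclideanSpace ℝ (Fin (n + 1)) → ℝ) (v : EuclideanSpace ℝ (Fin (n + 1)))
    (u : EuclideanSpace ℝ (Fin n)) (s : ℝ) : ℝ := fderiv ℝ K (snocEquiv n (u, s)) v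

theorem abs_partialKernel_le_norm {v : EuclideanSpace ℝ (Fin (n + 1))} (hv : ‖v‖ ≤ 1)
    (u : EuclideanSpace ℝ (Fin n)) (s : ℝ) :
    |partialKernel K v u s| ≤ ‖fderiv ℝ K (snocEquiv n (u, s))‖ :=
  ((fderiv ℝ K _).le_opNorm v).trans (mul_le_of_le_one_right (norm_nonneg _) hv)

theorem HasKernelBounds.abs_partialKernel_le (hb : HasKernelBounds K N) (hN : 0 ≤ N)
    {v : EuclideanSpace ℝ (Fin (n + 1))} (hv : ‖v‖ ≤ 1) {u : EuclideanSpace ℝ (Fin n)} {s : ℝ}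
    (h : 0 < ‖u‖ + |s|) :
    |partialKernel K v u s| ≤ 2 ^ (n + 1) * N / (‖u‖ + |s|) ^ (n + 1) := by
  have h2 : (‖u‖ + |s|) / 2 ≤ ‖snocEquiv n (u, s)‖ := le_norm_snocEquiv (u, s)
  refine (abs_partialKernel_le_norm hv u s).trans ((hb.one (snocEquiv n (u, s))
    (snocEquiv_ne_zero (p := (u, s)) h)).trans ?_)
  have h3 : N / ‖snocEquiv n (u, s)‖ ^ (n + 1) ≤ N / ((‖u‖ + |s|) / 2) ^ (n + 1) :=
    div_le_div_of_nonneg_left hN (pow_pos (half_pos h) _)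
      (pow_le_pow_left₀ (half_pos h).le h2 _)
  refine h3.trans (le_of_eq ?_)
  rw [div_pow, div_div_eq_mul_div, mul_comm]

theorem IsHomogeneousOddKernel.abs_partialKernel_sub_le (hK : IsHomogeneousOddKernel n K)
    (hb : HasKernelBounds K N) (hN : 0 ≤ N) {v : EuclideanSpace ℝ (Fin (n + 1))} (hv : ‖v‖ ≤ 1)
    {u u' : EuclideanSpace ℝ (Fin n)} {s s' m : ℝ} (hm : 0 < m) (h : m ≤ ‖u‖ + |s|)
    (h' : m ≤ ‖u'‖ + |s'|) :
    |partialKernel K v u s - partialKernel K v u' s'| ≤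
      (4 * N + 2 ^ (n + 2) * N) * 2 ^ (n + 2) * (‖u - u'‖ + |s - s'|) / m ^ (n + 2) := by
  have h1 : (‖u‖ + |s|) / 2 ≤ ‖snocEquiv n (u, s)‖ := le_norm_snocEquiv (u, s)
  have h1' : (‖u'‖ + |s'|) / 2 ≤ ‖snocEquiv n (u', s')‖ := le_norm_snocEquiv (u', s')
  have h2 : ‖fderiv ℝ K (snocEquiv n (u, s)) - fderiv ℝ K (snocEquiv n (u', s'))‖ ≤
      (4 * N + 2 ^ (n + 2) * N) * ‖snocEquiv n (u, s) - snocEquiv n (u', s')‖ /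
        (m / 2) ^ (n + 2) :=
    norm_sub_le_of_fderiv_bound (H := fderiv ℝ K) (a := n + 1) hK.differentiableAt_fderiv hb.one
      hb.two hN hN (half_pos hm) (by linarith) (by linarith)
  have h3 : |partialKernel K v u s - partialKernel K v u' s'| ≤
      ‖fderiv ℝ K (snocEquiv n (u, s)) - fderiv ℝ K (snocEquiv n (u', s'))‖ :=
    (ContinuousLinearMap.le_opNorm (fderiv ℝ K (snocEquiv n (u, s)) -
      fderiv ℝ K (snocEquiv n (u', s'))) v).trans (mul_le_of_le_one_right (norm_nonneg _) hv)
  have h4 : ‖snocEquiv n (u, s) - snocEquiv n (u', s')‖ ≤ ‖u - u'‖ + |s - s'| := by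
    rw [← map_sub]
    exact norm_snocEquiv_le _
  refine h3.trans (h2.trans ?_)
  calc (4 * N + 2 ^ (n + 2) * N) * ‖snocEquiv n (u, s) - snocEquiv n (u', s')‖ /
        (m / 2) ^ (n + 2)
      ≤ (4 * N + 2 ^ (n + 2) * N) * (‖u - u'‖ + |s - s'|) / (m / 2) ^ (n + 2) := by gcongr
    _ = _ := by rw [div_pow]; field_simp

/-- The constant of the partial derivatives of the kernel. -/
def partialKernelConst (n : ℕ) (N : ℝ) : ℝ := 2 ^ (n + 1) * N + (4 * N + 2 ^ (n + 2) * N) * 2 ^ (n + 2)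

theorem IsHomogeneousOddKernel.isFlatKernel (hK : IsHomogeneousOddKernel n K)
    (hb : HasKernelBounds K N) (hN : 0 ≤ N) {v : EuclideanSpace ℝ (Fin (n + 1))} (hv : ‖v‖ ≤ 1) :
    IsFlatKernel (partialKernel K v) (partialKernelConst n N) where
  measurable := (measurable_fderiv_apply_const ℝ K v).comp (snocEquiv n).continuous.measurable
  size u s h := by
    rw [finrank_euclideanSpace_fin]
    refine (hb.abs_partialKernel_le hN hv h).trans (div_le_div_of_nonneg_right ?_ (by positivity))
    exact le_add_of_nonneg_right (by positivity)
  diff u s u' s' m hm h h' := by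
    rw [finrank_euclideanSpace_fin]
    refine (hK.abs_partialKernel_sub_le hb hN hv hm h h').trans
      (div_le_div_of_nonneg_right (mul_le_mul_of_nonneg_right ?_ (by positivity)) (by positivity))
    exact le_add_of_nonneg_left (by positivity)
  flat c t ht := hK.integral_fderiv_eq_zero hb hN ht v

theorem IsHomogeneousOddKernel.partialKernel_neg (hK : IsHomogeneousOddKernel n K)
    (v : EuclideanSpace ℝ (Fin (n + 1))) {u : EuclideanSpace ℝ (Fin n)} {s : ℝ}
    (h : 0 < ‖u‖ + |s|) : partialKernel K v u (-s) = partialKernel K v (-u) s := by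
  have e : snocEquiv n (u, -s) = -snocEquiv n (-u, s) := by
    rw [← map_neg, Prod.neg_mk, neg_neg]
  rw [partialKernel, e, hK.fderiv_neg_eq (snocEquiv_ne_zero (p := (-u, s)) (by simpa using h)), partialKernel]

theorem IsHomogeneousOddKernel.isFlatKernel_reflected (hK : IsHomogeneousOddKernel n K)
    (hb : HasKernelBounds K N) (hN : 0 ≤ N) {v : EuclideanSpace ℝ (Fin (n + 1))} (hv : ‖v‖ ≤ 1) :
    IsFlatKernel (fun u s => partialKernel K v u (-s)) (partialKernelConst n N) where
  measurable := by
    have h := (hK.isFlatKernel hb hN hv).measurable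
    exact h.comp (measurable_fst.prodMk measurable_snd.neg)
  size u s h := by
    simpa using (hK.isFlatKernel hb hN hv).size u (-s) (by simpa using h)
  diff u s u' s' m hm h h' := by
    have h1 := (hK.isFlatKernel hb hN hv).diff u (-s) u' (-s') m hm (by simpa using h)
      (by simpa using h')
    have e : |-s - -s'| = |s - s'| := by rw [neg_sub_neg, abs_sub_comm]
    rwa [e] at h1
  flat c t ht := by
    -- The derivative of the odd function `K` is even, so the substitution `u ↦ -u` leads back to
    -- the unreflected kernel with slope `-c`.
    rw [← (hK.isFlatKernel hb hN hv).flat (-c) t ht, ← integral_neg_eq_self]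
    refine integral_congr_ae (Eventually.of_forall fun u => ?_)
    have h1 := add_le_mul_norm_add_abs (t := t) (norm_nonneg c) (abs_real_inner_le_norm c (-u))
    have h2 : 0 < (t + ‖-u‖) / (1 + ‖c‖) := by positivity
    simp only
    rw [hK.partialKernel_neg v (h2.trans_le h1), neg_neg, inner_neg_left, inner_neg_right]

end Snoc

/-! ### Surface measure and volume in graph coordinates -/

section Density

open Set Filter Topology

/-- A measure dominated by a multiple of a σ-finite measure has a bounded density. -/
theorem MeasureTheory.exists_density_le_of_le_smul {α : Type*} [MeasurableSpace α]
    {μ ν : Measure α} [SigmaFinite ν] {c : ℝ≥0} (h : μ ≤ c • ν) :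
    ∃ ρ : α → ℝ≥0, Measurable ρ ∧ (∀ᵐ x ∂ν, ρ x ≤ c) ∧ μ = ν.withDensity fun x => ρ x := by
  have : SigmaFinite μ := Measure.sigmaFinite_of_le _ h
  set f : α → ℝ≥0∞ := μ.rnDeriv (c • ν)
  have hf : Measurable f := Measure.measurable_rnDeriv _ _
  have hμ : (c • ν).withDensity f = μ :=
    Measure.withDensity_rnDeriv_eq _ _ (Measure.absolutelyContinuous_of_le h)
  have hf1 : ∀ᵐ x ∂(c • ν), f x ≤ 1 := Measure.rnDeriv_le_one_of_le h
  rcases eq_or_ne c 0 with rfl | hc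
  · refine ⟨0, measurable_zero, Eventually.of_forall fun x => le_rfl, ?_⟩
    rw [zero_smul] at h
    rw [Measure.nonpos_iff_eq_zero'.1 h]
    simp
  · have hf1' : ∀ᵐ x ∂ν, f x ≤ 1 := by
      rwa [Measure.ae_smul_measure_iff hc] at hf1
    refine ⟨fun x => c * (f x).toNNReal, hf.ennreal_toNNReal.const_mul c, ?_, ?_⟩
    · filter_upwards [hf1'] with x hx
      refine mul_le_of_le_one_right' ?_
      simpa using ENNReal.toNNReal_mono ENNReal.one_ne_top hx
    · have e : (fun x => ((c * (f x).toNNReal : ℝ≥0) : ℝ≥0∞)) =ᵐ[ν] (c : ℝ≥0∞) • f := by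
        filter_upwards [hf1'] with x hx
        rw [ENNReal.coe_mul, ENNReal.coe_toNNReal (hx.trans_lt ENNReal.one_lt_top).ne]
        rfl
      rw [withDensity_congr_ae e, withDensity_smul _ hf, ← withDensity_smul_measure]
      exact hμ.symm

variable {n : ℕ} {A : EuclideanSpace ℝ (Fin n) → ℝ} {L : ℝ≥0}

/-- The parametrization of the graph. -/
def graphMap (A : EuclideanSpace ℝ (Fin n) → ℝ) (x : EuclideanSpace ℝ (Fin n)) :
    EuclideanSpace ℝ (Fin (n + 1)) := snocEquiv n (x, A x)

theorem LipschitzWith.abs_sub_le (hA : LipschitzWith L A) (x y : EuclideanSpace ℝ (Fin n)) :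
    |A x - A y| ≤ L * ‖x - y‖ := by
  rw [← Real.dist_eq, ← dist_eq_norm]; exact hA.dist_le_mul x y

theorem LipschitzWith.graphMap (hA : LipschitzWith L A) : LipschitzWith (1 + L) (graphMap A) := by
  refine LipschitzWith.of_dist_le_mul fun x y => ?_
  rw [dist_eq_norm, dist_eq_norm, _root_.graphMap, _root_.graphMap, ← map_sub, Prod.mk_sub_mk]
  refine (norm_snocEquiv_le _).trans ?_
  have := hA.abs_sub_le x y
  simp only [NNReal.coe_add, NNReal.coe_one]
  linarith

theorem isClosedEmbedding_graphMap (hA : Continuous A) :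
    Topology.IsClosedEmbedding (graphMap A) := by
  have h1 : Topology.IsClosedEmbedding fun x => (x, A x) :=
    Function.LeftInverse.isClosedEmbedding (f := Prod.fst) (fun x => rfl) continuous_fst
      (continuous_id.prodMk hA)
  exact (snocEquiv n).toHomeomorph.isClosedEmbedding.comp h1

theorem measurableEmbedding_graphMap (hA : Continuous A) : MeasurableEmbedding (graphMap A) :=
  (isClosedEmbedding_graphMap hA).measurableEmbedding

/-- The surface measure in the coordinates of the base. -/
def baseMeasure (A : EuclideanSpace ℝ (Fin n) → ℝ) : Measure (EuclideanSpace ℝ (Fin n)) :=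
  (μH[(n : ℝ)] : Measure (EuclideanSpace ℝ (Fin (n + 1)))).comap (graphMap A)

theorem map_baseMeasure (hA : Continuous A) :
    (baseMeasure A).map (graphMap A) = surfaceMeasure (graphSet A) :=
  (measurableEmbedding_graphMap hA).map_comap _

variable (n) in
/-- The constant comparing the surface measure of a graph with Lebesgue measure. -/
def graphConst (L : ℝ≥0) : ℝ≥0 :=
  (1 + L) ^ n * Measure.addHaarScalarFactor
    (μH[(n : ℝ)] : Measure (EuclideanSpace ℝ (Fin n))) volume

/-- The graph map is `(1 + L)`-Lipschitz, so it enlarges `n`-dimensional Hausdorff measure by at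
most `(1 + L) ^ n`. On `ℝⁿ` Hausdorff measure is translation invariant, hence a multiple of Lebesgue
measure, whose value is irrelevant. -/
theorem baseMeasure_le (hA : LipschitzWith L A) : baseMeasure A ≤ graphConst n L • volume := by
  refine Measure.le_iff.2 fun s hs => ?_
  rw [baseMeasure, (measurableEmbedding_graphMap hA.continuous).comap_apply]
  refine (hA.graphMap.hausdorffMeasure_image_le (Nat.cast_nonneg n) s).trans (le_of_eq ?_)
  conv_lhs => rw [Measure.isAddLeftInvariant_eq_smul
    (μH[(n : ℝ)] : Measure (EuclideanSpace ℝ (Fin n))) volume]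
  rw [ENNReal.rpow_natCast, graphConst, Measure.smul_apply, Measure.smul_apply, ENNReal.smul_def,
    ENNReal.smul_def, smul_eq_mul, smul_eq_mul, ← mul_assoc]
  push_cast
  rfl

/-- Integrals of a square integrable density over the graph, in the coordinates of the base. -/
theorem exists_base_density (hA : LipschitzWith L A) {f : EuclideanSpace ℝ (Fin (n + 1)) → ℂ}
    (hf : MemLp f 2 (surfaceMeasure (graphSet A))) :
    ∃ g : EuclideanSpace ℝ (Fin n) → ℂ, StronglyMeasurable g ∧ MemLp g 2 ∧
      eLpNorm g 2 ^ 2 ≤ graphConst n L * eLpNorm f 2 (surfaceMeasure (graphSet A)) ^ 2 ∧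
      ∀ k : EuclideanSpace ℝ (Fin (n + 1)) → ℝ,
        (Integrable (fun y => k y • f y) (surfaceMeasure (graphSet A)) ↔
          Integrable fun y => k (graphMap A y) • g y) ∧
        ∫ y, k y • f y ∂(surfaceMeasure (graphSet A)) = ∫ y, k (graphMap A y) • g y := by
  have hΦ := measurableEmbedding_graphMap hA.continuous
  obtain ⟨ρ, hρm, hρc, hρ⟩ := exists_density_le_of_le_smul (baseMeasure_le hA)
  rw [← map_baseMeasure hA.continuous] at hf ⊢
  have hf2 : MemLp (f ∘ graphMap A) 2 (baseMeasure A) := hΦ.memLp_map_measure_iff.1 hf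
  -- `f ∘ graphMap A` is known to be measurable only for the base measure, which does not see the
  -- zeros of `ρ`; the product with `ρ` is measurable for Lebesgue measure.
  have hgm : AEStronglyMeasurable (fun y => (ρ y : ℝ) • f (graphMap A y)) := by
    rw [← aestronglyMeasurable_withDensity_iff hρm, ← hρ]
    exact hf2.aestronglyMeasurable
  have hk : ∀ k : EuclideanSpace ℝ (Fin (n + 1)) → ℝ,
      (fun y => ρ y • (k (graphMap A y) • f (graphMap A y))) =ᵐ[volume]
        fun y => k (graphMap A y) • hgm.mk _ y := fun k => by
    filter_upwards [hgm.ae_eq_mk] with y hy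
    rw [← hy, smul_comm, NNReal.smul_def]
  -- The bound `ρ ≤ graphConst n L` gives `ρ² ≤ graphConst n L · ρ`, and one factor `ρ` is needed to
  -- recover the base measure.
  have hnorm : eLpNorm (hgm.mk _) 2 ^ 2 ≤
      graphConst n L * eLpNorm f 2 ((baseMeasure A).map (graphMap A)) ^ 2 := by
    rw [hΦ.eLpNorm_map_measure, ← lintegral_enorm_sq_eq_eLpNorm, ← lintegral_enorm_sq_eq_eLpNorm]
    conv_rhs => rw [hρ]
    rw [lintegral_withDensity_eq_lintegral_mul_non_measurable₀ _ hρm.coe_nnreal_ennreal.aemeasurable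
      (Eventually.of_forall fun x => ENNReal.coe_lt_top),
      ← lintegral_const_mul' _ _ ENNReal.coe_ne_top]
    refine lintegral_mono_ae ?_
    filter_upwards [hgm.ae_eq_mk, hρc] with y hy hc
    rw [← hy, enorm_smul, mul_pow]
    simp only [Pi.mul_apply, Function.comp_apply]
    rw [← mul_assoc, sq, Real.enorm_eq_ofReal (NNReal.coe_nonneg _), ENNReal.ofReal_coe_nnreal]
    gcongr
  refine ⟨hgm.mk _, hgm.stronglyMeasurable_mk, ⟨hgm.stronglyMeasurable_mk.aestronglyMeasurable,
    ?_⟩, hnorm, fun k => ⟨?_, ?_⟩⟩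
  · have h2 : eLpNorm (hgm.mk _) 2 ^ 2 < ∞ := hnorm.trans_lt
      (ENNReal.mul_lt_top ENNReal.coe_lt_top (ENNReal.pow_lt_top hf.eLpNorm_lt_top))
    by_contra h
    rw [not_lt, top_le_iff] at h
    rw [h] at h2
    simp at h2
  · rw [hΦ.integrable_map_iff, hρ, integrable_withDensity_iff_integrable_smul hρm]
    exact integrable_congr (hk k)
  · rw [hΦ.integral_map, hρ, integral_withDensity_eq_integral_smul hρm]
    exact integral_congr_ae (hk k)

theorem measurePreserving_snocEquiv (n : ℕ) :
    MeasurePreserving (snocEquiv n) (volume.prod volume) volume := by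
  have h1 : MeasurePreserving
      (Prod.map (WithLp.ofLp (p := 2) (V := Fin n → ℝ)) (id : ℝ → ℝ))
      ((volume : Measure (EuclideanSpace ℝ (Fin n))).prod volume) (volume.prod volume) :=
    (PiLp.volume_preserving_ofLp (Fin n)).prod (MeasurePreserving.id _)
  have h2 := (volume_preserving_piFinSuccAbove (fun _ : Fin (n + 1) => ℝ) (Fin.last n)).symm
  have h3 := ((PiLp.volume_preserving_toLp (Fin (n + 1))).comp h2).comp
    ((Measure.measurePreserving_swap (μ := (volume : Measure (Fin n → ℝ)))
      (ν := (volume : Measure ℝ))).comp h1)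
  have e : ⇑(snocEquiv n) = (WithLp.toLp 2 ∘
      ⇑(MeasurableEquiv.piFinSuccAbove (fun _ : Fin (n + 1) => ℝ) (Fin.last n)).symm) ∘
      Prod.swap ∘ Prod.map WithLp.ofLp id := by
    funext p
    simp only [Function.comp_apply]
    rw [snocEquiv_apply]
    congr 1
    exact (Fin.insertNth_last' p.2 (WithLp.ofLp p.1)).symm
  rw [e]
  exact h3

/-- The flattening of the graph preserves the volume. -/
theorem measurePreserving_shear (hA : Measurable A) :
    MeasurePreserving (fun p : EuclideanSpace ℝ (Fin n) × ℝ => snocEquiv n (p.1, A p.1 + p.2))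
      volume volume := by
  refine (measurePreserving_snocEquiv n).comp ((MeasurePreserving.id volume).skew_product
    (g := fun x t => A x + t) ?_ (Eventually.of_forall fun x => map_add_left_eq_self volume (A x)))
  exact (hA.comp measurable_fst).add measurable_snd

theorem measurableEmbedding_shear (hA : Continuous A) :
    MeasurableEmbedding
      (fun p : EuclideanSpace ℝ (Fin n) × ℝ => snocEquiv n (p.1, A p.1 + p.2)) := by
  refine Continuous.measurableEmbedding (by fun_prop) fun p q h => ?_
  have h2 := (snocEquiv n).injective h
  have h3 : p.1 = q.1 := (Prod.ext_iff.1 h2).1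
  have h4 : A p.1 + p.2 = A q.1 + q.2 := (Prod.ext_iff.1 h2).2
  rw [h3] at h4
  exact Prod.ext h3 (add_left_cancel h4)

end Density

/-! ### Convergence and differentiation of the layer potential off the graph -/

section Layer

open Set Filter Topology

variable {n : ℕ} {A : EuclideanSpace ℝ (Fin n) → ℝ} {L : ℝ≥0}
  {K : EuclideanSpace ℝ (Fin (n + 1)) → ℝ} {N : ℝ} {g : EuclideanSpace ℝ (Fin n) → ℂ}

theorem shear_sub_graphMap (p : EuclideanSpace ℝ (Fin n) × ℝ) (y : EuclideanSpace ℝ (Fin n)) :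
    snocEquiv n (p.1, A p.1 + p.2) - graphMap A y = snocEquiv n (p.1 - y, A p.1 - A y + p.2) := by
  rw [graphMap, ← map_sub, Prod.mk_sub_mk]
  congr 2
  ring

/-- Negative heights are reduced to positive ones by a change of sign in the last coordinate. -/
theorem le_norm_shear_sub_graphMap (hA : LipschitzWith L A) {p : EuclideanSpace ℝ (Fin n) × ℝ}
    (y : EuclideanSpace ℝ (Fin n)) :
    (|p.2| + ‖p.1 - y‖) / (2 * (1 + L)) ≤ ‖snocEquiv n (p.1, A p.1 + p.2) - graphMap A y‖ := by
  have h0 : (|p.2| + ‖p.1 - y‖) / (1 + L) ≤ ‖p.1 - y‖ + |A p.1 - A y + p.2| := by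
    rcases le_total 0 p.2 with h | h
    · rw [abs_of_nonneg h]
      exact add_le_mul_norm_add_abs (t := p.2) L.coe_nonneg (hA.abs_sub_le p.1 y)
    · rw [abs_of_nonpos h]
      have h1 := add_le_mul_norm_add_abs (t := -p.2) (s := -(A p.1 - A y)) L.coe_nonneg
        ((abs_neg _).trans_le (hA.abs_sub_le p.1 y))
      rwa [← neg_add, abs_neg] at h1
  rw [shear_sub_graphMap]
  refine le_trans ?_ (le_norm_snocEquiv (p.1 - y, A p.1 - A y + p.2))
  calc _ = (|p.2| + ‖p.1 - y‖) / (1 + L) / 2 := by rw [div_div, mul_comm 2]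
    _ ≤ _ := div_le_div_of_nonneg_right h0 (by norm_num)

theorem exists_eq_shear (z : EuclideanSpace ℝ (Fin (n + 1))) :
    ∃ p : EuclideanSpace ℝ (Fin n) × ℝ, z = snocEquiv n (p.1, A p.1 + p.2) := by
  obtain ⟨⟨x, s⟩, rfl⟩ := (snocEquiv n).surjective z
  exact ⟨(x, s - A x), by simp⟩

theorem shear_notMem_graphSet {p : EuclideanSpace ℝ (Fin n) × ℝ}
    (h : snocEquiv n (p.1, A p.1 + p.2) ∉ graphSet A) : 0 < |p.2| := by
  rw [abs_pos]
  intro h0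
  refine h ⟨p.1, ?_⟩
  rw [h0, add_zero]
  rfl

theorem memLp_poissonWeight_sub {t : ℝ} (ht : 0 < t) (x : EuclideanSpace ℝ (Fin n)) :
    MemLp (fun y => poissonWeight t (x - y)) 2 :=
  (memLp_two_poissonWeight ht).comp_measurePreserving
    (Measure.measurePreserving_sub_left volume x)

theorem continuous_kernel_sub_graphMap (hA : Continuous A) (hK : IsHomogeneousOddKernel n K)
    {z : EuclideanSpace ℝ (Fin (n + 1))} (hz : ∀ y, z - graphMap A y ≠ 0) :
    Continuous fun y => K (z - graphMap A y) :=
  continuous_iff_continuousAt.2 fun y => ContinuousAt.comp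
    (f := fun y => z - graphMap A y)
    (hK.differentiableAt _ (hz y)).continuousAt
    (continuous_const.sub (isClosedEmbedding_graphMap hA).continuous).continuousAt

/-- Cauchy–Schwarz: along the graph the square of `K` decays with order `-2 n`, which is integrable
over `ℝⁿ` because `2 n ≥ n + 1`. This is where `1 ≤ n` is needed. -/
theorem integrable_kernel_smul (hn : 1 ≤ n) (hA : LipschitzWith L A)
    (hK : IsHomogeneousOddKernel n K) (hb : HasKernelBounds K N) (hN : 0 ≤ N) (hg : MemLp g 2)
    {p : EuclideanSpace ℝ (Fin n) × ℝ} (hp : 0 < |p.2|) :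
    Integrable fun y => K (snocEquiv n (p.1, A p.1 + p.2) - graphMap A y) • g y := by
  set z := snocEquiv n (p.1, A p.1 + p.2)
  have hlow := fun y => le_norm_shear_sub_graphMap hA (p := p) y
  have hpos : ∀ y, 0 < (|p.2| + ‖p.1 - y‖) / (2 * (1 + L)) := fun y => by positivity
  have hz : ∀ y, z - graphMap A y ≠ 0 := fun y => norm_pos_iff.1 ((hpos y).trans_le (hlow y))
  set c : ℝ := N * (2 * (1 + L)) ^ n with hc
  have hc0 : 0 ≤ c := by positivity
  have hkc := continuous_kernel_sub_graphMap hA.continuous hK hz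
  have hmaj : MemLp (fun y => (|p.2| + ‖p.1 - y‖)⁻¹ ^ n) 2 := by
    have hcont : Continuous fun y => (|p.2| + ‖p.1 - y‖)⁻¹ ^ n :=
      ((continuous_const.add (by fun_prop)).inv₀ fun y =>
        (add_pos_of_pos_of_nonneg hp (norm_nonneg _)).ne').pow n
    rw [memLp_two_iff_integrable_sq hcont.aestronglyMeasurable]
    refine (((integrable_poissonWeight (E := EuclideanSpace ℝ (Fin n)) hp).comp_sub_left
      p.1).const_mul (|p.2|⁻¹ ^ n)).mono' (hcont.pow 2).aestronglyMeasurable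
      (Eventually.of_forall fun y => ?_)
    obtain ⟨m, rfl⟩ : ∃ m, n = m + 1 := ⟨n - 1, by omega⟩
    rw [Real.norm_of_nonneg (by positivity), poissonWeight, finrank_euclideanSpace_fin]
    have h1 : (|p.2| + ‖p.1 - y‖)⁻¹ ≤ |p.2|⁻¹ := inv_anti₀ hp (by simp)
    calc ((|p.2| + ‖p.1 - y‖)⁻¹ ^ (m + 1)) ^ 2
        = (|p.2| + ‖p.1 - y‖)⁻¹ ^ m * (|p.2| + ‖p.1 - y‖)⁻¹ ^ (m + 2) := by ring
      _ ≤ |p.2|⁻¹ ^ m * (|p.2| + ‖p.1 - y‖)⁻¹ ^ (m + 2) := by gcongr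
      _ = _ := by rw [inv_pow (|p.2| + _), pow_succ |p.2|⁻¹]; field_simp
  have hk2 : MemLp (fun y => K (z - graphMap A y)) 2 :=
    (hmaj.const_mul c).mono' hkc.aestronglyMeasurable (Eventually.of_forall fun y => by
      refine (hb.zero _ (hz y)).trans ?_
      calc N / ‖z - graphMap A y‖ ^ n ≤ N / ((|p.2| + ‖p.1 - y‖) / (2 * (1 + L))) ^ n :=
            div_le_div_of_nonneg_left hN (pow_pos (hpos y) _)
              (pow_le_pow_left₀ (hpos y).le (hlow y) _)
        _ = _ := by rw [div_pow, inv_pow, hc]; field_simp)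
  exact memLp_one_iff_integrable.1 (hg.smul hk2 (p := 2) (q := 2) (r := 1))

/-- Differentiation under the integral sign. On the ball of radius `|p.2| / (4 (1 + L))` the
distances to graph points stay above half the lower bound of `le_norm_shear_sub_graphMap`, so one
majorant serves for the whole ball. -/
theorem hasFDerivAt_integral_kernel (hn : 1 ≤ n) (hA : LipschitzWith L A)
    (hK : IsHomogeneousOddKernel n K) (hb : HasKernelBounds K N) (hN : 0 ≤ N)
    (hgm : StronglyMeasurable g) (hg : MemLp g 2)
    {p : EuclideanSpace ℝ (Fin n) × ℝ} (hp : 0 < |p.2|) :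
    Integrable (fun y => (fderiv ℝ K (snocEquiv n (p.1, A p.1 + p.2) - graphMap A y)).smulRight
      (g y)) ∧
    HasFDerivAt (fun z => ∫ y, K (z - graphMap A y) • g y)
      (∫ y, (fderiv ℝ K (snocEquiv n (p.1, A p.1 + p.2) - graphMap A y)).smulRight (g y))
      (snocEquiv n (p.1, A p.1 + p.2)) := by
  set z := snocEquiv n (p.1, A p.1 + p.2)
  set ε : ℝ := |p.2| / (4 * (1 + L)) with hε
  have hε0 : 0 < ε := by positivity
  have hpos : ∀ y, 0 < (|p.2| + ‖p.1 - y‖) / (4 * (1 + L)) := fun y => by positivity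
  have hlow : ∀ w ∈ Metric.ball z ε, ∀ y,
      (|p.2| + ‖p.1 - y‖) / (4 * (1 + L)) ≤ ‖w - graphMap A y‖ := fun w hw y => by
    have h1 := le_norm_shear_sub_graphMap hA (p := p) y
    have h2 : ‖z - graphMap A y‖ ≤ ‖w - graphMap A y‖ + ‖w - z‖ := by
      have h3 := norm_sub_le (w - graphMap A y) (w - z)
      rwa [sub_sub_sub_cancel_left, ← neg_sub, norm_neg, ← neg_sub z, norm_neg] at h3
    have h4 : ‖w - z‖ < ε := by rwa [← dist_eq_norm]
    have h5 : (|p.2| + ‖p.1 - y‖) / (2 * (1 + L)) =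
        (|p.2| + ‖p.1 - y‖) / (4 * (1 + L)) + (ε + ‖p.1 - y‖ / (4 * (1 + L))) := by
      rw [hε]; field_simp; ring
    have h6 : (|p.2| + ‖p.1 - y‖) / (4 * (1 + L)) = ε + ‖p.1 - y‖ / (4 * (1 + L)) := by
      rw [hε, add_div]
    have h7 : 0 ≤ ‖p.1 - y‖ / (4 * (1 + L)) := by positivity
    change _ ≤ ‖z - graphMap A y‖ at h1
    linarith
  have hne : ∀ w ∈ Metric.ball z ε, ∀ y, w - graphMap A y ≠ 0 := fun w hw y =>
    norm_pos_iff.1 ((hpos y).trans_le (hlow w hw y))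
  set c : ℝ := N * (4 * (1 + L)) ^ (n + 1) / |p.2| with hc
  have hbound : ∀ y, ∀ w ∈ Metric.ball z ε,
      ‖(fderiv ℝ K (w - graphMap A y)).smulRight (g y)‖ ≤
        c * (poissonWeight |p.2| (p.1 - y) * ‖g y‖) := fun y w hw => by
    rw [ContinuousLinearMap.norm_smulRight_apply, ← mul_assoc]
    refine mul_le_mul_of_nonneg_right ((hb.one _ (hne w hw y)).trans ?_) (norm_nonneg _)
    calc N / ‖w - graphMap A y‖ ^ (n + 1)
        ≤ N / ((|p.2| + ‖p.1 - y‖) / (4 * (1 + L))) ^ (n + 1) :=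
          div_le_div_of_nonneg_left hN (pow_pos (hpos y) _)
            (pow_le_pow_left₀ (hpos y).le (hlow w hw y) _)
      _ = _ := by rw [div_pow, hc, poissonWeight, finrank_euclideanSpace_fin]; field_simp
  have hbi : Integrable fun y => c * (poissonWeight |p.2| (p.1 - y) * ‖g y‖) :=
    ((memLp_poissonWeight_sub hp p.1).integrable_fun_mul hg.norm).const_mul c
  have hΦc : Continuous (graphMap A) := (isClosedEmbedding_graphMap hA.continuous).continuous
  have hm' : AEStronglyMeasurable
      (fun y => (fderiv ℝ K (z - graphMap A y)).smulRight (g y)) volume := by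
    have h1 : Measurable fun y => fderiv ℝ K (z - graphMap A y) :=
      (measurable_fderiv ℝ K).comp (continuous_const.sub hΦc).measurable
    exact (ContinuousLinearMap.smulRightL ℝ (EuclideanSpace ℝ (Fin (n + 1))) ℂ
      ).aestronglyMeasurable_comp₂ h1.aestronglyMeasurable hgm.aestronglyMeasurable
  refine ⟨hbi.mono' hm' (Eventually.of_forall fun y => hbound y z (Metric.mem_ball_self hε0)), ?_⟩
  refine hasFDerivAt_integral_of_dominated_of_fderiv_le (Metric.ball_mem_nhds z hε0)
    ?_ (integrable_kernel_smul hn hA hK hb hN hg hp) hm' (Eventually.of_forall hbound) hbi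
    (Eventually.of_forall fun y w hw => ?_)
  · filter_upwards [Metric.ball_mem_nhds z hε0] with w hw
    exact ((continuous_kernel_sub_graphMap hA.continuous hK (hne w hw)).stronglyMeasurable.smul
      hgm).aestronglyMeasurable
  · have h1 : HasFDerivAt (fun w => K (w - graphMap A y)) (fderiv ℝ K (w - graphMap A y)) w := by
      have h2 := (hK.differentiableAt _ (hne w hw y)).hasFDerivAt.comp w
        ((hasFDerivAt_id w).sub_const (graphMap A y))
      exact h2
    exact h1.smul_const (g y)

end Layer

end

/-! ### Conclusion -/

theorem theorem5p1 (n : ℕ) (hn : 1 ≤ n) (M : ℝ) (L : ℝ≥0) :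
    ∃ C : ℝ, 0 < C ∧
      ∀ (A : EuclideanSpace ℝ (Fin n) → ℝ) (K : EuclideanSpace ℝ (Fin (n + 1)) → ℝ),
        LipschitzWith L A →
        IsHomogeneousOddKernel n K →
        (∀ k : ℕ, k ≤ 2 → ∀ i : Fin k → Fin (n + 1),
          ∀ ω ∈ Metric.sphere (0 : EuclideanSpace ℝ (Fin (n + 1))) 1, |mixedPartial i K ω| ≤ M) →
        ∀ f : EuclideanSpace ℝ (Fin (n + 1)) → ℂ,
          MemLp f 2 (surfaceMeasure (graphSet A)) →
          (∀ x ∉ graphSet A,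
            Integrable (fun y => K (x - y) • f y) (surfaceMeasure (graphSet A))) ∧
          (∀ x ∉ graphSet A, DifferentiableAt ℝ (layerOperator K (graphSet A) f) x) ∧
          ∫⁻ x in (graphSet A)ᶜ,
              ENNReal.ofReal (gradSq (layerOperator K (graphSet A) f) x *
                Metric.infDist x (graphSet A)) ≤
            ENNReal.ofReal (C * ∫ y, ‖f y‖ ^ 2 ∂(surfaceMeasure (graphSet A))) := by
  -- The maximum keeps the constants positive for every real `M`.
  set N : ℝ := (n + 1) ^ 2 * max M 1
  have hN : 0 < N := by positivity
  have hB : 0 < partialKernelConst n N := by unfold partialKernelConst; positivity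
  obtain ⟨C, hC, H⟩ := exists_lintegral_potential_le (EuclideanSpace ℝ (Fin n))
    (partialKernelConst n N) L hB L.coe_nonneg
  -- The factor `n + 1` counts the partial derivatives; adding `1` to `graphConst n L` makes
  -- positivity evident.
  refine ⟨(n + 1) * (C * (graphConst n L + 1)), by positivity, fun A K hA hK hM f hf => ?_⟩
  have hb : HasKernelBounds K N := hK.hasKernelBounds (by positivity)
    fun k hk i ω hω => (hM k hk i ω hω).trans (le_max_left _ _)
  obtain ⟨g, hgm, hg, hgn, hk⟩ := exists_base_density hA hf
  have hT : layerOperator K (graphSet A) f = fun z => ∫ y, K (z - graphMap A y) • g y :=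
    funext fun z => (hk fun y => K (z - y)).2
  have hder : ∀ p : EuclideanSpace ℝ (Fin n) × ℝ, 0 < |p.2| → ∀ v,
      fderiv ℝ (layerOperator K (graphSet A) f) (snocEquiv n (p.1, A p.1 + p.2)) v =
        potential (partialKernel K v) A g p := fun p hp v => by
    have h := hasFDerivAt_integral_kernel hn hA hK hb hN.le hgm hg hp
    rw [hT, h.2.fderiv, ContinuousLinearMap.integral_apply h.1]
    refine integral_congr_ae (Filter.Eventually.of_forall fun y => ?_)
    simp only [ContinuousLinearMap.smulRight_apply, partialKernel, shear_sub_graphMap]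
  refine ⟨fun x hx => ?_, fun x hx => ?_, ?_⟩
  · obtain ⟨p, rfl⟩ := exists_eq_shear (A := A) x
    exact (hk _).1.2 (integrable_kernel_smul hn hA hK hb hN.le hg (shear_notMem_graphSet hx))
  · obtain ⟨p, rfl⟩ := exists_eq_shear (A := A) x
    rw [hT]
    exact (hasFDerivAt_integral_kernel hn hA hK hb hN.le hgm hg
      (shear_notMem_graphSet hx)).2.differentiableAt
  have hcl : IsClosed (graphSet A) := (isClosedEmbedding_graphMap hA.continuous).isClosed_range
  have hemb := measurableEmbedding_shear hA.continuous
  have hpres := measurePreserving_shear hA.continuous.measurable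
  have hnorm : ∀ j : Fin (n + 1), ‖EuclideanSpace.single j (1 : ℝ)‖ ≤ 1 := fun j => by simp
  have hmeas : ∀ j : Fin (n + 1), Measurable fun p : EuclideanSpace ℝ (Fin n) × ℝ =>
      ENNReal.ofReal |p.2| *
        ‖potential (partialKernel K (EuclideanSpace.single j 1)) A g p‖ₑ ^ 2 := fun j => by
    have := (stronglyMeasurable_potential (hK.isFlatKernel hb hN.le (hnorm j)).measurable
      hA.continuous.measurable hgm).enorm
    fun_prop
  have hf2 : eLpNorm f 2 (surfaceMeasure (graphSet A)) ^ 2 =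
      ENNReal.ofReal (∫ y, ‖f y‖ ^ 2 ∂(surfaceMeasure (graphSet A))) := by
    rw [← lintegral_enorm_sq_eq hf.norm, ← lintegral_enorm_sq_eq_eLpNorm]
    simp only [enorm_norm]
  rw [← hpres.setLIntegral_comp_preimage_emb hemb]
  have hpt : ∀ p ∈ (fun p : EuclideanSpace ℝ (Fin n) × ℝ => snocEquiv n (p.1, A p.1 + p.2)) ⁻¹'
      (graphSet A)ᶜ, ENNReal.ofReal (gradSq (layerOperator K (graphSet A) f)
        (snocEquiv n (p.1, A p.1 + p.2)) *
          Metric.infDist (snocEquiv n (p.1, A p.1 + p.2)) (graphSet A)) ≤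
      ∑ j, ENNReal.ofReal |p.2| *
        ‖potential (partialKernel K (EuclideanSpace.single j 1)) A g p‖ₑ ^ 2 := fun p hp => by
    have hp0 := shear_notMem_graphSet hp
    -- Only an upper bound of the distance is needed, and the vertical distance gives one.
    have hd : Metric.infDist (snocEquiv n (p.1, A p.1 + p.2)) (graphSet A) ≤ |p.2| := by
      have hmem : graphMap A p.1 ∈ graphSet A := Set.mem_range_self (f := graphMap A) p.1
      refine (Metric.infDist_le_dist_of_mem hmem).trans ?_
      rw [dist_eq_norm, shear_sub_graphMap]
      refine (norm_snocEquiv_le _).trans (le_of_eq ?_)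
      simp
    simp_rw [ofReal_mul_enorm_sq (abs_nonneg _)]
    rw [← ENNReal.ofReal_sum_of_nonneg fun j _ => by positivity, ← Finset.mul_sum]
    refine ENNReal.ofReal_le_ofReal ?_
    rw [gradSq, mul_comm]
    simp_rw [hder p hp0]
    gcongr
  refine (setLIntegral_mono' (hemb.measurable hcl.isOpen_compl.measurableSet) hpt).trans ?_
  refine (setLIntegral_le_lintegral _ _).trans ?_
  rw [lintegral_finsetSum _ fun j _ => hmeas j]
  have hj : ∀ j : Fin (n + 1), ∫⁻ p : EuclideanSpace ℝ (Fin n) × ℝ, ENNReal.ofReal |p.2| *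
      ‖potential (partialKernel K (EuclideanSpace.single j 1)) A g p‖ₑ ^ 2 ≤
      ENNReal.ofReal (C * (graphConst n L + 1) *
        ∫ y, ‖f y‖ ^ 2 ∂(surfaceMeasure (graphSet A))) := fun j => by
    refine (H _ A g (hK.isFlatKernel hb hN.le (hnorm j)) (hK.isFlatKernel_reflected hb hN.le
      (hnorm j)) (hA.abs_sub_le) hg).trans ?_
    rw [hf2] at hgn
    rw [mul_assoc, ENNReal.ofReal_mul hC.le, ENNReal.ofReal_mul (by positivity)]
    have : (graphConst n L : ℝ≥0∞) ≤ ENNReal.ofReal (graphConst n L + 1) := by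
      rw [← ENNReal.ofReal_coe_nnreal]
      exact ENNReal.ofReal_le_ofReal (by linarith)
    exact mul_le_mul_right (hgn.trans (mul_le_mul_left this _)) _
  refine (Finset.sum_le_sum fun j _ => hj j).trans (le_of_eq ?_)
  rw [Finset.sum_const, Finset.card_univ, Fintype.card_fin, nsmul_eq_mul, mul_assoc (_ + 1 : ℝ),
    ENNReal.ofReal_mul (by positivity : (0 : ℝ) ≤ n + 1)]
  congr 1
  rw [ENNReal.ofReal_add (by positivity) one_pos.le]
  simp
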